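/- **Setting.** Let $\pi_{XY}:Y\to X$ be a smooth submersion (for instance a fibre bundle) to an $(n+1)$-manifold $X$, with vertical spaces $VY=\ker T\pi_{XY}$. Let $Z\subset\Lambda^{n+1}Y$ be the bundle of $(n+1)$-forms $z$ on $Y$ with $\mathbf i_v\mathbf i_w z=0$ for all vertical $v,w$, with projections $\pi_{YZ}:Z\to Y$ and $\pi_{XZ}=\pi_{XY}\circ\pi_{YZ}$, canonical form $\Theta_z=\pi_{YZ}^*z$ and $\Omega=-\mathbf d\Theta$. Let $\Sigma$ be a compact connected oriented $n$-manifold without boundary, $\tau:\Sigma\to X$ a smooth embedding, $\Sigma_\tau=\tau(\Sigma)$, oriented through $\tau$. Let $\mathcal Y_\tau$ and $\mathcal Z_\tau$ be the spaces of smooth sections over $\Sigma_\tau$ of $Y$ and $Z$, and $T^*\mathcal Y_\tau$ the smooth cotangent bundle: its points over $\varphi\in\mathcal Y_\tau$ are the smooth sections $\pi$ of $L(VY,\Lambda^n\Sigma_\tau)$ covering $\varphi$. These spaces carry the one-forms $$\Theta_\tau(\sigma)(V)=\int_{\Sigma_\tau}\sigma^*(\mathbf i_V\Theta),\qquad \theta_\tau(\varphi,\pi)(V)=\int_{\Sigma_\tau}\pi(T\mathrm{pr}\cdot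 V),\quad \mathrm{pr}:T^*\mathcal Y_\tau\to\mathcal Y_\tau,$$ and the two-forms $\Omega_\tau=-\mathbf d\Theta_\tau$, $\omega_\tau=-\mathbf d\theta_\tau$. Let $R_\tau:\mathcal Z_\tau\to T^*\mathcal Y_\tau$ be given by $\langle R_\tau(\sigma)(x),v\rangle=\varphi^*(\mathbf i_v\sigma(x))$ with $\varphi=\pi_{YZ}\circ\sigma$. Let $\mathcal G$ be a Lie group, possibly infinite-dimensional, with Lie algebra $\mathfrak g$ and exponential map, acting smoothly on $Z$ by covariant canonical transformations, i.e. $\eta_Z$ covers a diffeomorphism $\eta_X$ of $X$ and $\eta_Z^*\Omega=\Omega$. Let $\mathcal G_\tau=\{\eta\in\mathcal G\mid \eta_X(\Sigma_\tau)=\Sigma_\tau\}$, with Lie algebra $\mathfrak g_\tau=\{\xi\mid \exp(t\xi)\in\mathcal G_\tau\ \forall t\}$ (assumed to be a Lie subalgebra of $\mathfrak g$), and $\eta_\tau=\eta_X|_{\Sigma_\tau}$. The group $\mathcal G_\tau$ acts on $\mathcal Z_\tau$ by $\eta_{\mathcal Z_\tau}(\sigma)=\eta_Z\circ\sigma\circ\eta_\tau^{-1}$.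 A momentum map for an action of $\mathcal G_\tau$ on $\mathcal Z_\tau$ (resp. $T^*\mathcal Y_\tau$) is a smooth map $J$ to $\mathfrak g_\tau^*$ with $\mathbf d\langle J,\xi\rangle=\mathbf i_{\xi}\Omega_\tau$ (resp. $\mathbf i_\xi\omega_\tau$) for all $\xi\in\mathfrak g_\tau$, where on the right $\xi$ stands for the infinitesimal generator of the action; it is $\mathrm{Ad}^*$-equivariant if $\langle J(\eta\cdot x),\xi\rangle=\langle J(x),\mathrm{Ad}_{\eta^{-1}}\xi\rangle$ for all $\eta\in\mathcal G_\tau$, all points $x$ and all $\xi\in\mathfrak g_\tau$. **Proposition 7.5.** The map $R_\tau$ is surjective, and there is an action of $\mathcal G_\tau$ on $T^*\mathcal Y_\tau$, necessarily unique, such that $$\eta_{T^*\mathcal Y_\tau}(R_\tau(\sigma))=R_\tau(\eta_{\mathcal Z_\tau}(\sigma))\qquad(\eta\in\mathcal G_\tau,\ \sigma\in\mathcal Z_\tau).$$ This action is by diffeomorphisms, the maps $(t,x)\mapsto\exp(t\xi)_{T^*\mathcal Y_\tau}(x)$ are smooth for $\xi\in\mathfrak g_\tau$, and the action is canonical: $(\eta_{T^*\mathcal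 Y_\tau})^*\omega_\tau=\omega_\tau$ for every $\eta\in\mathcal G_\tau$ for which $\eta_\tau$ preserves the orientation of $\Sigma_\tau$. If $J_\tau:\mathcal Z_\tau\to\mathfrak g_\tau^*$ is a momentum map for the action of $\mathcal G_\tau$ on $\mathcal Z_\tau$, then there is a unique map $\mathcal J_\tau:T^*\mathcal Y_\tau\to\mathfrak g_\tau^*$ with $\mathcal J_\tau\circ R_\tau=J_\tau$, and $\mathcal J_\tau$ is a momentum map for the induced action of $\mathcal G_\tau$ on $T^*\mathcal Y_\tau$. Further, if $J_\tau$ is $\mathrm{Ad}^*$-equivariant, then so is $\mathcal J_\tau$. -/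

import Mathlib

open scoped Manifold ContDiff Topology Pointwise
open Manifold

set_option linter.unusedSectionVars false

noncomputable section

/-- The model space `ℝ^d`. -/
abbrev Euc (d : ℕ) : Type := EuclideanSpace ℝ (Fin d)

/-! ### Bundles of exterior forms, the multiphase space `Z` and its canonical forms -/

/-- `Λ^j T_y^* M`. -/
abbrev FormFiber (d j : ℕ) (M : Type*) [TopologicalSpace M] [ChartedSpace (Euc d) M] (y : M) :
    Type :=
  TangentSpace 𝓘(ℝ, Euc d) y [⋀^Fin j]→L[ℝ] Bundle.Trivial M ℝ y

/-- The total space of the bundle `Λ^j M` of `j`-forms on the `d`-dimensional manifold `M`. It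
carries Mathlib's vector bundle structure, and in particular its charts. -/
abbrev FormBundle (d j : ℕ) (M : Type*) [TopologicalSpace M] [ChartedSpace (Euc d) M] : Type _ :=
  Bundle.TotalSpace (Euc d [⋀^Fin j]→L[ℝ] ℝ) (FormFiber d j M)

/-- The model with corners of the manifold `FormBundle d j M`. -/
abbrev formModel (d j : ℕ) :
    ModelWithCorners ℝ (Euc d × (Euc d [⋀^Fin j]→L[ℝ] ℝ))
      (ModelProd (Euc d) (Euc d [⋀^Fin j]→L[ℝ] ℝ)) :=
  𝓘(ℝ, Euc d).prod 𝓘(ℝ, Euc d [⋀^Fin j]→L[ℝ] ℝ)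

section Multiphase

variable (n k : ℕ) {X Y : Type*}
  [TopologicalSpace X] [ChartedSpace (Euc (n + 1)) X]
  [TopologicalSpace Y] [ChartedSpace (Euc k) Y] [IsManifold 𝓘(ℝ, Euc k) ∞ Y] (π : Y → X)

/-- The vertical subspace `V_y Y = ker T_y π`. -/
def vert (y : Y) : Submodule ℝ (TangentSpace 𝓘(ℝ, Euc k) y) :=
  LinearMap.ker (mfderiv 𝓘(ℝ, Euc k) 𝓘(ℝ, Euc (n + 1)) π y).toLinearMap

/-- The multiphase space `Z`: the subbundle of `Λ^{n+1} Y` of those `z` with `i_v i_w z = 0` for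
all vertical `v`, `w`. -/
def Multiphase : Type _ :=
  {z : FormBundle k (n + 1) Y //
    ∀ u : Fin (n + 1) → TangentSpace 𝓘(ℝ, Euc k) z.proj,
      (∃ i j, i ≠ j ∧ u i ∈ vert n k π z.proj ∧ u j ∈ vert n k π z.proj) → z.2 u = 0}

variable {n k π}

/-- The projection `π_{YZ} : Z → Y`. -/
def Multiphase.pt (z : Multiphase n k π) : Y := z.1.proj

/-- The `(n+1)`-form at `π_{YZ} z` that the point `z` of `Z` is. (Tangent spaces of a
`k`-dimensional manifold are by definition copies of `ℝ^k`.) -/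
def Multiphase.form (z : Multiphase n k π) : Euc k [⋀^Fin (n + 1)]→L[ℝ] ℝ := z.1.2

/-- Smoothness on an open set `U` of a map from a manifold into `Z`, a submanifold of
`Λ^{n+1} Y`. -/
def Multiphase.SmoothOn {E H M : Type*} [NormedAddCommGroup E] [NormedSpace ℝ E]
    [TopologicalSpace H] (I : ModelWithCorners ℝ E H) [TopologicalSpace M] [ChartedSpace H M]
    (f : M → Multiphase n k π) (U : Set M) : Prop :=
  ContMDiffOn I (formModel k (n + 1)) ∞ (fun m => (f m).1) U

/-- Smoothness of a map of `Z` to itself: it sends smooth maps from open subsets of Euclidean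
spaces to smooth maps. -/
def Multiphase.SmoothMap (Φ : Multiphase n k π → Multiphase n k π) : Prop :=
  ∀ (m : ℕ) (U : Set (Euc m)), IsOpen U → ∀ f : Euc m → Multiphase n k π,
    Multiphase.SmoothOn 𝓘(ℝ, Euc m) f U → Multiphase.SmoothOn 𝓘(ℝ, Euc m) (fun p => Φ (f p)) U

/-- The pull-back `f^*Θ` along `f : P → Z` of the canonical `(n+1)`-form `Θ` of `Z`, given by
`Θ_z(u_0, …, u_n) = z(Tπ_{YZ} u_0, …, Tπ_{YZ} u_n)`. -/
def Multiphase.pullTheta {P : Type*} [NormedAddCommGroup P] [NormedSpace ℝ P]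
    (f : P → Multiphase n k π) (p : P) : P [⋀^Fin (n + 1)]→L[ℝ] ℝ :=
  (f p).form.compContinuousLinearMap
    (mfderiv 𝓘(ℝ, P) 𝓘(ℝ, Euc k) (fun q => (f q).pt) p : P →L[ℝ] Euc k)

/-- The pull-back `f^*Ω` along `f : P → Z` of `Ω = -dΘ`. -/
def Multiphase.pullOmega {P : Type*} [NormedAddCommGroup P] [NormedSpace ℝ P]
    (f : P → Multiphase n k π) (p : P) : P [⋀^Fin (n + 2)]→L[ℝ] ℝ :=
  -extDeriv (Multiphase.pullTheta f) p

/-- `Φ^*Ω = Ω`. A form on `Z` is determined by its pull-backs along the smooth maps from open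
subsets of Euclidean spaces to `Z`. -/
def Multiphase.PreservesOmega (Φ : Multiphase n k π → Multiphase n k π) : Prop :=
  ∀ (m : ℕ) (U : Set (Euc m)), IsOpen U → ∀ f : Euc m → Multiphase n k π,
    Multiphase.SmoothOn 𝓘(ℝ, Euc m) f U →
      ∀ p ∈ U, Multiphase.pullOmega (fun q => Φ (f q)) p = Multiphase.pullOmega f p

end Multiphase

/-! ### Integration of `n`-forms over an oriented compact `n`-manifold -/

section Integration

variable (n : ℕ) (S : Type*) [TopologicalSpace S] [ChartedSpace (Euc n) S]

/-- An orientation of an `n`-manifold, given as an atlas all of whose transition maps have positive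
Jacobian determinant. -/
def OrientedAtlas : Prop :=
  ∀ e ∈ atlas (Euc n) S, ∀ e' ∈ atlas (Euc n) S, ∀ y ∈ (e.symm.trans e').source,
    0 < (fderiv ℝ (e.symm.trans e') y).det

variable {S}

/-- A map of an oriented manifold to itself preserves orientation. (In Mathlib the derivative at
`x` is read in the preferred charts at `x` and at `h x`, which belong to the oriented atlas.) -/
def OrientationPreserving (h : S → S) : Prop :=
  ∀ x, 0 < (mfderiv 𝓘(ℝ, Euc n) 𝓘(ℝ, Euc n) h x : Euc n →L[ℝ] Euc n).det

variable [IsManifold 𝓘(ℝ, Euc n) ∞ S] [CompactSpace S] [T2Space S]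

variable (S) in
/-- A smooth partition of unity subordinate to the chart domains. -/
def chartPartition : SmoothPartitionOfUnity S 𝓘(ℝ, Euc n) S Set.univ :=
  Classical.choose
    (SmoothPartitionOfUnity.exists_isSubordinate_chartAt_source (I := 𝓘(ℝ, Euc n)) (M := S))

variable {n} in
/-- `∫_S α` for an `n`-form `α`: the sum of the integrals in the charts of the pieces `ρ_c α` of `α`
given by a partition of unity. -/
def integralForm (α : S → Euc n [⋀^Fin n]→L[ℝ] ℝ) : ℝ :=
  ∑ᶠ c : S, ∫ y in (chartAt (Euc n) c).target,
    chartPartition n S c ((chartAt (Euc n) c).symm y) *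
      α ((chartAt (Euc n) c).symm y) (fun i =>
        mfderiv 𝓘(ℝ, Euc n) 𝓘(ℝ, Euc n) (chartAt (Euc n) c).symm y (EuclideanSpace.single i 1))

end Integration

/-! ### Spaces of fields with a canonical one-form

A space `D` of fields is an infinite-dimensional manifold of maps. Its smooth structure is given by
its smooth families `P → D`, with `P` a finite-dimensional parameter space, a differential form on
`D` by its pull-backs to the parameter spaces of the smooth families. -/

/-- A space of fields with its smooth families and a one-form `ϑ`: `oneForm f p a` is
`(f^*ϑ)_p(a) = ϑ_{f p}(T_p f a)`. -/
class FieldSpace (D : Type*) where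
  IsFamily : ∀ {P : Type} [NormedAddCommGroup P] [NormedSpace ℝ P], (P → D) → Prop
  oneForm : ∀ {P : Type} [NormedAddCommGroup P] [NormedSpace ℝ P], (P → D) → P → P → ℝ

namespace FieldSpace

variable {D D' : Type*} [FieldSpace D] [FieldSpace D']

/-- The pull-back along the family `f` of the two-form `-dϑ`, where
`(dα)(a, b) = a[α(b)] - b[α(a)]` for constant vector fields `a`, `b` on `P`. -/
def twoForm {P : Type} [NormedAddCommGroup P] [NormedSpace ℝ P] (f : P → D) (p a b : P) : ℝ :=
  -(fderiv ℝ (fun q => oneForm f q b) p a - fderiv ℝ (fun q => oneForm f q a) p b)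

/-- Smoothness of a map of spaces of fields. -/
def SmoothMap (Φ : D → D') : Prop :=
  ∀ (P : Type) [NormedAddCommGroup P] [NormedSpace ℝ P] [FiniteDimensional ℝ P] (f : P → D),
    IsFamily f → IsFamily (fun p => Φ (f p))

/-- `Φ` preserves the two-form `-dϑ`. -/
def PreservesTwoForm (Φ : D → D) : Prop :=
  ∀ (P : Type) [NormedAddCommGroup P] [NormedSpace ℝ P] [FiniteDimensional ℝ P] (f : P → D),
    IsFamily f → ∀ p a b : P, twoForm (fun q => Φ (f q)) p a b = twoForm f p a b

/-- The maps `(t, x) ↦ flow ξ t x` are smooth. -/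
def SmoothFlow {V : Type*} (flow : V → ℝ → D → D) : Prop :=
  ∀ (ξ : V) (P : Type) [NormedAddCommGroup P] [NormedSpace ℝ P] [FiniteDimensional ℝ P]
    (f : P → D), IsFamily f → IsFamily (fun s : ℝ × P => flow ξ s.1 (f s.2))

/-- `J : D → V^*` is a momentum map, `d⟨J, ξ⟩ = i_{ξ_D} (-dϑ)` for all `ξ`, where
`ξ_D(x) = d/dt (flow ξ t x)` at `t = 0` is the infinitesimal generator. Along a family `f`, the
vectors `ξ_D(f p)` and `T_p f a` are the velocities at `(0, p)` of the family
`(t, q) ↦ flow ξ t (f q)` in the directions `(1, 0)` and `(0, a)`. -/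
def IsMomentumMap {V : Type*} [AddCommGroup V] [Module ℝ V] [TopologicalSpace V]
    (flow : V → ℝ → D → D) (J : D → (V →L[ℝ] ℝ)) : Prop :=
  ∀ (ξ : V) (P : Type) [NormedAddCommGroup P] [NormedSpace ℝ P] [FiniteDimensional ℝ P]
    (f : P → D), IsFamily f →
      ContDiff ℝ ∞ (fun p => J (f p) ξ) ∧
      ∀ p a : P, fderiv ℝ (fun q => J (f q) ξ) p a =
        twoForm (fun s : ℝ × P => flow ξ s.1 (f s.2)) (0, p) (1, 0) (0, a)

end FieldSpace

/-! ### The spaces `𝒵_τ` and `T^*𝒴_τ` and the map `R_τ` -/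

section Fields

variable (n k : ℕ) {X Y S : Type*}
  [TopologicalSpace X] [ChartedSpace (Euc (n + 1)) X]
  [TopologicalSpace Y] [ChartedSpace (Euc k) Y] [IsManifold 𝓘(ℝ, Euc k) ∞ Y]
  [TopologicalSpace S] [ChartedSpace (Euc n) S] [IsManifold 𝓘(ℝ, Euc n) ∞ S]
  (π : Y → X) (τ : S → X)

/-- `𝒵_τ`: the smooth sections of `Z` over `Σ_τ = τ(S)`, which is identified with `S` through
`τ`. -/
@[ext] structure ZSection where
  toFun : S → Multiphase n k π
  covers : ∀ x, π (toFun x).pt = τ x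
  smooth : Multiphase.SmoothOn 𝓘(ℝ, Euc n) toFun Set.univ

variable {n k} in
/-- Smoothness of a family of elements `μ m` of `L(V_{φ m} Y, Λ^n T_{b m}^* S)`, indexed by a
manifold `M`: the function `μ(v)(w_1, …, w_n)` is smooth for all smooth local vector fields `v` along
`φ` that are vertical and `w_1, …, w_n` along `b`. -/
def SmoothMomentum {E H M : Type*} [NormedAddCommGroup E] [NormedSpace ℝ E]
    [TopologicalSpace H] (I : ModelWithCorners ℝ E H) [TopologicalSpace M] [ChartedSpace H M]
    (b : M → S) (φ : M → Y) (μ : ∀ m, vert n k π (φ m) →ₗ[ℝ] (Euc n [⋀^Fin n]→L[ℝ] ℝ)) : Prop :=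
  ∀ W : Set M, IsOpen W →
    ∀ v : ∀ m, vert n k π (φ m),
      ContMDiffOn I 𝓘(ℝ, Euc k).tangent ∞
        (fun m => (⟨φ m, (v m).1⟩ : TangentBundle 𝓘(ℝ, Euc k) Y)) W →
    ∀ w : Fin n → ∀ m, TangentSpace 𝓘(ℝ, Euc n) (b m),
      (∀ i, ContMDiffOn I 𝓘(ℝ, Euc n).tangent ∞
        (fun m => (⟨b m, w i m⟩ : TangentBundle 𝓘(ℝ, Euc n) S)) W) →
    ContMDiffOn I 𝓘(ℝ, ℝ) ∞ (fun m => μ m (v m) (fun i => w i m)) W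

/-- `T^*𝒴_τ`, the smooth cotangent bundle of the space `𝒴_τ` of smooth sections `φ` of `Y` over
`Σ_τ ≅ S`: a point is a `φ ∈ 𝒴_τ` and a smooth section, covering `φ`, of `L(VY_τ, Λ^n S)`. -/
@[ext] structure CotSection where
  field : S → Y
  covers : ∀ x, π (field x) = τ x
  smooth_field : ContMDiff 𝓘(ℝ, Euc n) 𝓘(ℝ, Euc k) ∞ field
  mom : ∀ x, vert n k π (field x) →ₗ[ℝ] (Euc n [⋀^Fin n]→L[ℝ] ℝ)
  smooth_mom : SmoothMomentum π 𝓘(ℝ, Euc n) (fun x : S => x) field mom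

variable {n k π τ}

theorem Multiphase.pt_smooth {E H M : Type*} [NormedAddCommGroup E] [NormedSpace ℝ E]
    [TopologicalSpace H] {I : ModelWithCorners ℝ E H} [TopologicalSpace M] [ChartedSpace H M]
    {f : M → Multiphase n k π} {U : Set M} (h : Multiphase.SmoothOn I f U) :
    ContMDiffOn I 𝓘(ℝ, Euc k) ∞ (fun m => (f m).pt) U :=
  fun m hm => (Bundle.contMDiffWithinAt_totalSpace.1 (h m hm)).1

theorem Multiphase.SmoothOn.comp {E H M E' H' M' : Type*} [NormedAddCommGroup E]
    [NormedSpace ℝ E] [TopologicalSpace H] {I : ModelWithCorners ℝ E H} [TopologicalSpace M]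
    [ChartedSpace H M] [NormedAddCommGroup E'] [NormedSpace ℝ E'] [TopologicalSpace H']
    {I' : ModelWithCorners ℝ E' H'} [TopologicalSpace M'] [ChartedSpace H' M']
    {f : M → Multiphase n k π} {U : Set M} {g : M' → M} {V : Set M'}
    (hf : Multiphase.SmoothOn I f U) (hg : ContMDiffOn I' I ∞ g V) (hV : V ⊆ g ⁻¹' U) :
    Multiphase.SmoothOn I' (fun m => f (g m)) V :=
  ContMDiffOn.comp (g := fun m => (f m).1) hf hg hV

/-- The value of a smooth family of points of `Z` on smooth vector fields is smooth. -/
theorem Multiphase.form_apply_smooth {E H M : Type*} [NormedAddCommGroup E] [NormedSpace ℝ E]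
    [TopologicalSpace H] {I : ModelWithCorners ℝ E H} [TopologicalSpace M] [ChartedSpace H M]
    {f : M → Multiphase n k π} {U : Set M} (hf : Multiphase.SmoothOn I f U)
    (u : Fin (n + 1) → M → Euc k)
    (hu : ∀ i, ContMDiffOn I 𝓘(ℝ, Euc k).tangent ∞
      (fun m => (⟨(f m).pt, u i m⟩ : TangentBundle 𝓘(ℝ, Euc k) Y)) U) :
    ContMDiffOn I 𝓘(ℝ, ℝ) ∞ (fun m => (f m).form (fun i => u i m)) U := by
  intro m₀ hm₀
  have hA := (Bundle.contMDiffWithinAt_totalSpace.1 (hf m₀ hm₀)).2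
  have hV := fun i => (Bundle.contMDiffWithinAt_totalSpace.1 (hu i m₀ hm₀)).2
  set e := trivializationAt (Euc k) (TangentSpace 𝓘(ℝ, Euc k) : Y → Type _) (f m₀).pt with he
  have hV' : ContMDiffWithinAt I 𝓘(ℝ, Fin (n + 1) → Euc k) ∞
      (fun m => fun i => (e ⟨(f m).pt, u i m⟩).2) U m₀ :=
    contMDiffWithinAt_pi_space.2 hV
  have hAV := hA.prodMk_space hV'
  have key : ContDiff ℝ ∞
      (fun p : (Euc k [⋀^Fin (n + 1)]→L[ℝ] ℝ) × (Fin (n + 1) → Euc k) =>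
        (ContinuousAlternatingMap.toContinuousMultilinearMapCLM ℝ p.1) p.2) :=
    contDiff_iff_contDiffAt.2 fun x =>
      (ContinuousLinearMap.cpolynomialAt_uncurry_of_multilinear
        (ContinuousAlternatingMap.toContinuousMultilinearMapCLM ℝ :
          (Euc k [⋀^Fin (n + 1)]→L[ℝ] ℝ) →L[ℝ] _) (x := x)).contDiffAt
  have h := key.contMDiff.contMDiffAt.comp_contMDiffWithinAt m₀ hAV
  have hev : ∀ᶠ m in 𝓝[U] m₀, (f m).pt ∈ e.baseSet :=
    (Multiphase.pt_smooth hf m₀ hm₀).continuousWithinAt.eventually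
      (e.open_baseSet.mem_nhds (FiberBundle.mem_baseSet_trivializationAt' _))
  have hval : ∀ m, (f m).pt ∈ e.baseSet →
      (f m).form (fun i => u i m) =
        (ContinuousAlternatingMap.toContinuousMultilinearMapCLM ℝ
          ((trivializationAt (Euc k [⋀^Fin (n + 1)]→L[ℝ] ℝ) (FormFiber k (n + 1) Y)
            (f m₀).1.proj (f m).1).2)) (fun i => (e ⟨(f m).pt, u i m⟩).2) := by
    intro m hm
    have hu' : (fun i => u i m) =
        fun i => (e.symmL ℝ (f m).pt (e ⟨(f m).pt, u i m⟩).2 : Euc k) := by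
      funext i
      rw [Bundle.Trivialization.symmL_apply]
      · exact (e.symm_apply_apply_mk hm (u i m)).symm
      · exact hm
    rw [FiberBundle.trivializationAt_continuousAlternatingMap_apply,
      ContinuousAlternatingMap.inCoordinates]
    simp only [ContinuousAlternatingMap.toContinuousMultilinearMapCLM_apply,
      ContinuousAlternatingMap.coe_toContinuousMultilinearMap,
      Bundle.Trivial.continuousLinearMapAt_trivialization,
      Bundle.Trivial.fiberBundle_trivializationAt']
    exact congrArg (f m).form hu'
  exact h.congr_of_eventuallyEq (hev.mono fun m hm => hval m hm)
    (hval m₀ (FiberBundle.mem_baseSet_trivializationAt' _))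

/-- The variation of a map into a fibre of `π` is vertical. -/
theorem variation_mem_vert {P : Type*} [NormedAddCommGroup P] [NormedSpace ℝ P] {h : P → Y} {x : X}
    (hx : ∀ q, π (h q) = x) (p a : P) :
    mfderiv 𝓘(ℝ, P) 𝓘(ℝ, Euc k) h p a ∈ vert n k π (h p) := by
  rw [vert, LinearMap.mem_ker]
  change mfderiv 𝓘(ℝ, Euc k) 𝓘(ℝ, Euc (n + 1)) π (h p) (mfderiv 𝓘(ℝ, P) 𝓘(ℝ, Euc k) h p a) = 0
  by_cases h1 : MDifferentiableAt 𝓘(ℝ, Euc k) 𝓘(ℝ, Euc (n + 1)) π (h p)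
  · by_cases h2 : MDifferentiableAt 𝓘(ℝ, P) 𝓘(ℝ, Euc k) h p
    · have hc : mfderiv 𝓘(ℝ, P) 𝓘(ℝ, Euc (n + 1)) (π ∘ h) p = 0 := by
        have : π ∘ h = fun _ => x := funext hx
        rw [this]
        exact mfderiv_const
      rw [mfderiv_comp p h1 h2] at hc
      exact congrArg (fun L => L a) hc
    · rw [mfderiv_zero_of_not_mdifferentiableAt h2]
      exact map_zero _
  · rw [mfderiv_zero_of_not_mdifferentiableAt h1]
    rfl

/-- The vertical vector `(d/dp φ_p(x)) · a` at `φ_p(x)`, for a family `φ_p` in `𝒴_τ`. -/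
def CotSection.variation {P : Type*} [NormedAddCommGroup P] [NormedSpace ℝ P]
    (f : P → CotSection n k π τ) (p a : P) (x : S) : vert n k π ((f p).field x) :=
  ⟨mfderiv 𝓘(ℝ, P) 𝓘(ℝ, Euc k) (fun q => (f q).field x) p a,
    variation_mem_vert (fun q => (f q).covers x) p a⟩

/-- `R_τ : 𝒵_τ → T^*𝒴_τ`, `⟨R_τ(σ)(x), v⟩ = φ^*(i_v σ(x))` with `φ = π_{YZ} ∘ σ`. -/
def R (σ : ZSection n k π τ) : CotSection n k π τ where
  field x := (σ.toFun x).pt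
  covers := σ.covers
  smooth_field := contMDiffOn_univ.1 (Multiphase.pt_smooth σ.smooth)
  mom x :=
    { toFun := fun v => ((σ.toFun x).form.curryLeft (v.1 : Euc k)).compContinuousLinearMap
        (mfderiv 𝓘(ℝ, Euc n) 𝓘(ℝ, Euc k) (fun y => (σ.toFun y).pt) x : Euc n →L[ℝ] Euc k)
      map_add' := fun v w => by
        simp only [Submodule.coe_add]
        erw [map_add]
        rfl
      map_smul' := fun c v => by
        simp only [Submodule.coe_smul]
        erw [map_smul]
        rfl }
  smooth_mom := by
    intro W _ v hv w hw
    have hσ : Multiphase.SmoothOn 𝓘(ℝ, Euc n) σ.toFun W := σ.smooth.mono (Set.subset_univ _)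
    have hφ := contMDiffOn_univ.1 (Multiphase.pt_smooth σ.smooth)
    have hT := hφ.contMDiff_tangentMap (m := ∞) (by norm_num)
    refine (Multiphase.form_apply_smooth hσ
      (Fin.cons (fun m => (v m).1) fun i m => mfderiv 𝓘(ℝ, Euc n) 𝓘(ℝ, Euc k)
        (fun y => (σ.toFun y).pt) m (w i m)) ?_).congr ?_
    · intro i
      refine Fin.cases ?_ (fun j => ?_) i
      · exact hv
      · exact hT.comp_contMDiffOn (hw j)
    · intro m _
      change (σ.toFun m).form (Fin.cons _ _) = _
      congr 1
      funext i
      refine Fin.cases ?_ (fun j => ?_) i <;> rfl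

variable [CompactSpace S] [T2Space S]

/-- The smooth families in `𝒵_τ` are those that are jointly smooth, and
`Θ_τ(σ)(V) = ∫ σ^*(i_V Θ)`. -/
instance ZSection.fieldSpace : FieldSpace (ZSection n k π τ) where
  IsFamily {P} _ _ f := Multiphase.SmoothOn (𝓘(ℝ, P).prod 𝓘(ℝ, Euc n))
    (fun q : P × S => (f q.1).toFun q.2) Set.univ
  oneForm {P} _ _ f p a := integralForm fun x =>
    (((f p).toFun x).form.curryLeft
        (mfderiv 𝓘(ℝ, P) 𝓘(ℝ, Euc k) (fun q => ((f q).toFun x).pt) p a : Euc k)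
      ).compContinuousLinearMap
        (mfderiv 𝓘(ℝ, Euc n) 𝓘(ℝ, Euc k) (fun y => ((f p).toFun y).pt) x : Euc n →L[ℝ] Euc k)

/-- The smooth families in `T^*𝒴_τ` are those that are jointly smooth, and `θ_τ` is the canonical
one-form `θ_τ(φ, π)(V) = ∫ π(Tpr · V)` with `pr : T^*𝒴_τ → 𝒴_τ` the projection. -/
instance CotSection.fieldSpace : FieldSpace (CotSection n k π τ) where
  IsFamily {P} _ _ f :=
    ContMDiff (𝓘(ℝ, P).prod 𝓘(ℝ, Euc n)) 𝓘(ℝ, Euc k) ∞ (fun q : P × S => (f q.1).field q.2) ∧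
    SmoothMomentum π (𝓘(ℝ, P).prod 𝓘(ℝ, Euc n)) (fun q : P × S => q.2)
      (fun q => (f q.1).field q.2) (fun q => (f q.1).mom q.2)
  oneForm f p a := integralForm fun x => (f p).mom x (CotSection.variation f p a x)

end Fields

/-! ### Lie groups, possibly infinite-dimensional, and actions by covariant canonical
transformations -/

/-- The data of a Lie group `G`, possibly infinite-dimensional and not modelled on a Banach space
(for instance a group of diffeomorphisms), with Lie algebra `𝔤`, that are used for actions:
the one-parameter subgroups `t ↦ exp (t ξ)` and the adjoint action. -/
class LieGroupExp (G 𝔤 : Type*) [Group G] [LieRing 𝔤] [LieAlgebra ℝ 𝔤] [TopologicalSpace 𝔤]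
    [ContinuousSMul ℝ 𝔤] where
  exp : 𝔤 → G
  Ad : G → 𝔤 ≃ₗ⁅ℝ⁆ 𝔤
  exp_add_smul : ∀ (s t : ℝ) (ξ : 𝔤), exp ((s + t) • ξ) = exp (s • ξ) * exp (t • ξ)
  Ad_mul : ∀ (g h : G) (ξ : 𝔤), Ad (g * h) ξ = Ad g (Ad h ξ)
  continuous_Ad : ∀ g : G, Continuous (Ad g)
  exp_Ad : ∀ (g : G) (ξ : 𝔤), exp (Ad g ξ) = g * exp ξ * g⁻¹
  hasDerivAt_Ad : ∀ ξ ζ : 𝔤, HasDerivAt (fun t : ℝ => Ad (exp (t • ξ)) ζ) ⁅ξ, ζ⁆ 0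

open LieGroupExp

/-- `𝔥` is the Lie algebra of the subgroup `K` of `G`. -/
def IsLieAlgebraOf {G 𝔤 : Type*} [Group G] [LieRing 𝔤] [LieAlgebra ℝ 𝔤] [TopologicalSpace 𝔤]
    [ContinuousSMul ℝ 𝔤]
    [LieGroupExp G 𝔤] (𝔥 : LieSubalgebra ℝ 𝔤) (K : Subgroup G) : Prop :=
  ∀ ξ : 𝔤, ξ ∈ 𝔥 ↔ ∀ t : ℝ, (exp (t • ξ) : G) ∈ K

section Action

variable {n k : ℕ} {X Y S : Type*}
  [TopologicalSpace X] [ChartedSpace (Euc (n + 1)) X]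
  [TopologicalSpace Y] [ChartedSpace (Euc k) Y] [IsManifold 𝓘(ℝ, Euc k) ∞ Y]
  [TopologicalSpace S] [ChartedSpace (Euc n) S] [IsManifold 𝓘(ℝ, Euc n) ∞ S]
  {π : Y → X} {τ : S → X}
  {G : Type*} [Group G] [MulAction G X] [MulAction G (Multiphase n k π)]

variable (G π n k) in
/-- `G` acts smoothly on `Z` by covariant canonical transformations, covering an action on `X`. -/
structure ActsCanonically (𝔤 : Type*) [LieRing 𝔤] [LieAlgebra ℝ 𝔤] [TopologicalSpace 𝔤]
    [ContinuousSMul ℝ 𝔤]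
    [LieGroupExp G 𝔤] : Prop where
  covers : ∀ (g : G) (z : Multiphase n k π), π (g • z).pt = g • π z.pt
  smooth_X : ∀ g : G, ContMDiff 𝓘(ℝ, Euc (n + 1)) 𝓘(ℝ, Euc (n + 1)) ∞ (fun x : X => g • x)
  smooth_Z : ∀ g : G, Multiphase.SmoothMap (fun z : Multiphase n k π => g • z)
  smooth_exp_X : ∀ ξ : 𝔤, ContMDiff (𝓘(ℝ, ℝ).prod 𝓘(ℝ, Euc (n + 1))) 𝓘(ℝ, Euc (n + 1)) ∞
    (fun s : ℝ × X => (exp (s.1 • ξ) : G) • s.2)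
  /-- Smoothness of `ℝ × Z → Z`, `(t, z) ↦ exp (t ξ) • z`. -/
  smooth_exp_Z : ∀ (ξ : 𝔤) (m : ℕ) (U : Set (Euc m)), IsOpen U →
    ∀ (c : Euc m → ℝ) (f : Euc m → Multiphase n k π), ContDiffOn ℝ ∞ c U →
      Multiphase.SmoothOn 𝓘(ℝ, Euc m) f U →
      Multiphase.SmoothOn 𝓘(ℝ, Euc m) (fun p => (exp (c p • ξ) : G) • f p) U
  canonical : ∀ g : G, Multiphase.PreservesOmega (fun z : Multiphase n k π => g • z)

/-- `𝒢_τ = {η ∈ 𝒢 | η_X(Σ_τ) = Σ_τ}`. -/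
abbrev stab (τ : S → X) (G : Type*) [Group G] [MulAction G X] : Subgroup G := MulAction.stabilizer G (Set.range τ)

theorem exists_etaTau (η : stab τ G) (x : S) : ∃ y, τ y = η.1 • τ x := by
  have h : η.1 • τ x ∈ η.1 • Set.range τ := Set.smul_mem_smul_set (Set.mem_range_self x)
  rwa [show η.1 • Set.range τ = Set.range τ from MulAction.mem_stabilizer_iff.1 η.2] at h

/-- The map `η_τ = η_X | Σ_τ`, as a map of `S ≅ Σ_τ`. -/
def etaTau (η : stab τ G) (x : S) : S := Classical.choose (exists_etaTau η x)

theorem tau_etaTau (η : stab τ G) (x : S) : τ (etaTau η x) = η.1 • τ x :=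
  Classical.choose_spec (exists_etaTau η x)

/-- `η_τ` is smooth. -/
theorem etaTau_smooth {𝔤 : Type*} [LieRing 𝔤] [LieAlgebra ℝ 𝔤] [TopologicalSpace 𝔤]
    [ContinuousSMul ℝ 𝔤] [LieGroupExp G 𝔤]
    (hτ : IsSmoothEmbedding 𝓘(ℝ, Euc n) 𝓘(ℝ, Euc (n + 1)) ∞ τ) (hG : ActsCanonically n k π G 𝔤)
    (η : stab τ G) : ContMDiff 𝓘(ℝ, Euc n) 𝓘(ℝ, Euc n) ∞ (etaTau η) := by
  have hcomp : τ ∘ etaTau η = (fun x : X => η.1 • x) ∘ τ := funext fun x => tau_etaTau η x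
  have hs : ContMDiff 𝓘(ℝ, Euc n) 𝓘(ℝ, Euc (n + 1)) ∞ (τ ∘ etaTau η) := by
    rw [hcomp]
    exact (hG.smooth_X η.1).comp hτ.contMDiff
  have hc : Continuous (etaTau η) := hτ.isEmbedding.continuous_iff.2 hs.continuous
  intro x
  exact (ContMDiffAt.iff_comp_isImmersionAt (hτ.isImmersion.isImmersionAt _)).2
    ⟨hc.continuousAt, hs x⟩

/-- A smooth map of `Z` to itself sends smooth maps `S → Z` to smooth maps. -/
theorem Multiphase.SmoothMap.comp_smooth {Φ : Multiphase n k π → Multiphase n k π}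
    (hΦ : Multiphase.SmoothMap Φ) {f : S → Multiphase n k π}
    (hf : Multiphase.SmoothOn 𝓘(ℝ, Euc n) f Set.univ) :
    Multiphase.SmoothOn 𝓘(ℝ, Euc n) (fun x => Φ (f x)) Set.univ := by
  intro x _
  set e := chartAt (Euc n) x
  have h1 : Multiphase.SmoothOn 𝓘(ℝ, Euc n) (fun y => f (e.symm y)) e.target :=
    hf.comp (contMDiffOn_chart_symm (I := 𝓘(ℝ, Euc n)) (x := x))
      (fun _ _ => Set.mem_univ _)
  have h2 := hΦ n e.target e.open_target _ h1
  have h3 : ContMDiffOn 𝓘(ℝ, Euc n) (formModel k (n + 1)) ∞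
      (fun y => (Φ (f (e.symm (e y)))).1) e.source :=
    ContMDiffOn.comp (g := fun y => (Φ (f (e.symm y))).1) h2 (contMDiffOn_chart (I := 𝓘(ℝ, Euc n)) (x := x)) (fun y hy => e.map_source hy)
  have h4 : ContMDiffOn 𝓘(ℝ, Euc n) (formModel k (n + 1)) ∞
      (fun y => (Φ (f y)).1) e.source :=
    h3.congr fun y hy => by rw [e.left_inv hy]
  exact (h4.contMDiffAt (e.open_source.mem_nhds (mem_chart_source _ x))).contMDiffWithinAt

/-- The action `η_{𝒵_τ}(σ) = η_Z ∘ σ ∘ η_τ⁻¹` of `𝒢_τ` on `𝒵_τ`. -/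
def actZ {𝔤 : Type*} [LieRing 𝔤] [LieAlgebra ℝ 𝔤] [TopologicalSpace 𝔤]
    [ContinuousSMul ℝ 𝔤] [LieGroupExp G 𝔤]
    (hτ : IsSmoothEmbedding 𝓘(ℝ, Euc n) 𝓘(ℝ, Euc (n + 1)) ∞ τ) (hG : ActsCanonically n k π G 𝔤)
    (η : stab τ G) (σ : ZSection n k π τ) : ZSection n k π τ where
  toFun x := η.1 • σ.toFun (etaTau η⁻¹ x)
  covers x := by
    rw [hG.covers, σ.covers, tau_etaTau (τ := τ) η⁻¹ x]
    simp
  smooth := (hG.smooth_Z η.1).comp_smooth <|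
    σ.smooth.comp (etaTau_smooth hτ hG η⁻¹).contMDiffOn (fun _ _ => Set.mem_univ _)

/-- The one-parameter subgroup `t ↦ exp (t ξ)` of `𝒢_τ`, for `ξ` in its Lie algebra. -/
def expτ {𝔤 : Type*} [LieRing 𝔤] [LieAlgebra ℝ 𝔤] [TopologicalSpace 𝔤]
    [ContinuousSMul ℝ 𝔤] [LieGroupExp G 𝔤] {𝔥 : LieSubalgebra ℝ 𝔤} {K : Subgroup G}
    (h : IsLieAlgebraOf 𝔥 K) (ξ : 𝔥) (t : ℝ) : K :=
  ⟨exp (t • (ξ : 𝔤)), (h ξ).1 ξ.2 t⟩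

/-- The adjoint action of a subgroup on its Lie algebra. -/
def adτ {𝔤 : Type*} [LieRing 𝔤] [LieAlgebra ℝ 𝔤] [TopologicalSpace 𝔤]
    [ContinuousSMul ℝ 𝔤] [LieGroupExp G 𝔤] {𝔥 : LieSubalgebra ℝ 𝔤} {K : Subgroup G}
    (h : IsLieAlgebraOf 𝔥 K) (η : K) (ξ : 𝔥) : 𝔥 :=
  ⟨Ad η.1 (ξ : 𝔤), (h _).2 fun t => by
    rw [← map_smul, exp_Ad]
    exact K.mul_mem (K.mul_mem η.2 ((h ξ).1 ξ.2 t)) (K.inv_mem η.2)⟩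

/-- `Ad^*`-equivariance of `J : D → 𝔥^*`: `⟨J(η x), ξ⟩ = ⟨J(x), Ad_{η⁻¹} ξ⟩`. -/
def AdEquivariant {𝔤 : Type*} [LieRing 𝔤] [LieAlgebra ℝ 𝔤] [TopologicalSpace 𝔤]
    [ContinuousSMul ℝ 𝔤] [LieGroupExp G 𝔤] {𝔥 : LieSubalgebra ℝ 𝔤} {K : Subgroup G}
    (h : IsLieAlgebraOf 𝔥 K) {D : Type*} (act : K → D → D) (J : D → (𝔥 →L[ℝ] ℝ)) : Prop :=
  ∀ (η : K) (x : D) (ξ : 𝔥), J (act η x) ξ = J x (adτ h η⁻¹ ξ)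

end Action

end

/-! The difficulty is that a transformation of `Z` covers a map of `X` but is not assumed to cover a
map of `Y`, so it is not clear that it respects the fibres of `R_τ`. This has to be extracted from
invariance of `Ω`.

Surjectivity is a pointwise extension problem. A momentum at `φ(x)` prescribes an `(n+1)`-form on
one vertical vector and `n` vectors over `TΣ_τ`. In a chart adapted to `π`, with a local retraction
of `X` onto `Σ_τ`, `momentumForm` extends these values to an element of `Z`. The requirements are
affine, so a partition of unity glues the local extensions. The same construction over `P × S` lifts
smooth families (`exists_lift`, `exists_family_lift`), hence smoothness and two-forms on `T^*𝒴_τ`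
can be tested on families in `𝒵_τ`.

The fibres of `R_τ` are affine: `R σ = R σ'` holds exactly when, at every `x`, the values of `σ` and
`σ'` have the same base point in `Y` and agree on a vertical vector followed by vectors over `TΣ_τ`
(`R_eq_iff`, `Multiphase.RelatedAt`). Let `z + t(z' - z)` be a line of related points. Its velocity
`a` has no component along `Y`, so `Ω(a, b, w_1, …, w_n) = -(z' - z)(b, w_1, …, w_n) = 0` for `b`
vertical over `X` and `w_i` over `TΣ_τ`. Invariance of `Ω` gives the same vanishing for the image
line under `η`. In adapted coordinates, with `y'` the base velocity of the image line, `α'` its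
fibre velocity, and `(v, ζ)` an arbitrary vertical direction, this reads `α'(v, e) = ζ(y', e)` for
all `e_i` over `TΣ_τ` (`fderiv_coordForm_smul_lineMap`). Taking `v = 0` and a suitable `ζ` forces
`y' = 0`; taking `ζ = 0` then forces `α'(v, e) = 0`. The image line therefore stays in one fibre
(`relatedAt_smul`), and the action descends (`R_actZ_congr`).

Canonicity: `R_τ^*ω_τ = Ω_τ` holds by definition. Variations of sections over a fixed `τ` are
vertical, so `Ω_τ` is the integral of the pointwise form `σ^*(i_W i_V Ω)`, with no boundary term.
Pointwise invariance of `Ω` and change of variables on `S` then give invariance of `Ω_τ`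
(`preservesTwoForm_actZ`).

Momentum maps: along a line in a fibre of `R_τ`, `d⟨J, ξ⟩` is `Ω_τ` of the generator and the line's
velocity, that is, `ω_τ` of their images under `R_τ`. The second image is zero
(`twoForm_orbit_eq_zero`), so `J` is constant on fibres. The momentum identity and equivariance for
the descended map are read off upstairs. -/

noncomputable section

/-! ### Smoothness of forms and of maps into `Z`, tested on vector fields. -/

section Smoothness

variable {E H M : Type*} [NormedAddCommGroup E] [NormedSpace ℝ E] [TopologicalSpace H]
  {I : ModelWithCorners ℝ E H} [TopologicalSpace M] [ChartedSpace H M]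

/-- A family of alternating forms on a finite-dimensional space is smooth if its values are. -/
theorem contMDiffWithinAt_alternating_of_apply {V : Type*} [NormedAddCommGroup V]
    [NormedSpace ℝ V] [FiniteDimensional ℝ V] {j : ℕ} {f : M → V [⋀^Fin j]→L[ℝ] ℝ} {U : Set M}
    {m₀ : M} (h : ∀ v : Fin j → V, ContMDiffWithinAt I 𝓘(ℝ, ℝ) ∞ (fun m => f m v) U m₀) :
    ContMDiffWithinAt I 𝓘(ℝ, V [⋀^Fin j]→L[ℝ] ℝ) ∞ f U m₀ := by
  let b := Module.finBasis ℝ V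
  -- Values on tuples of basis vectors determine a form; a linear left inverse of this evaluation
  -- recovers the family from finitely many smooth functions.
  let L : (V [⋀^Fin j]→L[ℝ] ℝ) →ₗ[ℝ] ((Fin j → Fin (Module.finrank ℝ V)) → ℝ) :=
    { toFun := fun α s => α fun i => b (s i)
      map_add' := fun _ _ => rfl
      map_smul' := fun _ _ => rfl }
  have hL : Function.Injective L := by
    intro α β hα
    have : α.toContinuousMultilinearMap.toMultilinearMap
        = β.toContinuousMultilinearMap.toMultilinearMap :=
      Module.Basis.ext_multilinear (fun _ => b) fun s => congrFun hα s
    ext v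
    exact congrArg (fun μ : MultilinearMap ℝ (fun _ : Fin j => V) ℝ => μ v) this
  obtain ⟨g, hg⟩ := L.exists_leftInverse_of_injective (LinearMap.ker_eq_bot.2 hL)
  have h1 : ContMDiffWithinAt I 𝓘(ℝ, (Fin j → Fin (Module.finrank ℝ V)) → ℝ) ∞
      (fun m => L (f m)) U m₀ := contMDiffWithinAt_pi_space.2 fun s => h _
  have h2 := g.toContinuousLinearMap.contMDiff.contMDiffAt.comp_contMDiffWithinAt (n := ∞) m₀ h1
  refine h2.congr_of_eventuallyEq (Filter.Eventually.of_forall fun m => ?_) ?_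
  · exact (LinearMap.congr_fun hg (f m)).symm
  · exact (LinearMap.congr_fun hg (f m₀)).symm

/-- The value of a smooth family of alternating forms on smooth families of vectors is smooth. -/
theorem ContMDiffWithinAt.alternating_apply {V : Type*} [NormedAddCommGroup V]
    [NormedSpace ℝ V] {j : ℕ} {f : M → V [⋀^Fin j]→L[ℝ] ℝ} {U : Set M}
    {m₀ : M} (hf : ContMDiffWithinAt I 𝓘(ℝ, V [⋀^Fin j]→L[ℝ] ℝ) ∞ f U m₀) {v : Fin j → M → V}
    (hv : ∀ i, ContMDiffWithinAt I 𝓘(ℝ, V) ∞ (v i) U m₀) :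
    ContMDiffWithinAt I 𝓘(ℝ, ℝ) ∞ (fun m => f m fun i => v i m) U m₀ := by
  have hV' : ContMDiffWithinAt I 𝓘(ℝ, Fin j → V) ∞ (fun m => fun i => v i m) U m₀ :=
    contMDiffWithinAt_pi_space.2 hv
  -- Evaluation is jointly polynomial in the form and the vectors.
  have key : ContDiff ℝ ∞ (fun p : (V [⋀^Fin j]→L[ℝ] ℝ) × (Fin j → V) =>
        (ContinuousAlternatingMap.toContinuousMultilinearMapCLM ℝ p.1) p.2) :=
    contDiff_iff_contDiffAt.2 fun x =>
      (ContinuousLinearMap.cpolynomialAt_uncurry_of_multilinear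
        (ContinuousAlternatingMap.toContinuousMultilinearMapCLM ℝ :
          (V [⋀^Fin j]→L[ℝ] ℝ) →L[ℝ] _) (x := x)).contDiffAt
  exact key.contMDiff.contMDiffAt.comp_contMDiffWithinAt m₀ (hf.prodMk_space hV')

theorem ContMDiffOn.alternating_apply {V : Type*} [NormedAddCommGroup V]
    [NormedSpace ℝ V] {j : ℕ} {f : M → V [⋀^Fin j]→L[ℝ] ℝ} {U : Set M}
    (hf : ContMDiffOn I 𝓘(ℝ, V [⋀^Fin j]→L[ℝ] ℝ) ∞ f U) {v : Fin j → M → V}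
    (hv : ∀ i, ContMDiffOn I 𝓘(ℝ, V) ∞ (v i) U) :
    ContMDiffOn I 𝓘(ℝ, ℝ) ∞ (fun m => f m fun i => v i m) U :=
  fun m hm => (hf m hm).alternating_apply fun i => hv i m hm

variable {n k : ℕ} {X Y : Type*}
  [TopologicalSpace X] [ChartedSpace (Euc (n + 1)) X]
  [TopologicalSpace Y] [ChartedSpace (Euc k) Y] [IsManifold 𝓘(ℝ, Euc k) ∞ Y] {π : Y → X}

/-- A map into `Z` is smooth if its projection to `Y` and its values on smooth vector fields are. -/
theorem Multiphase.smoothOn_of_apply {f : M → Multiphase n k π} {U : Set M} (hU : IsOpen U)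
    (hpt : ContMDiffOn I 𝓘(ℝ, Euc k) ∞ (fun m => (f m).pt) U)
    (h : ∀ W ⊆ U, IsOpen W → ∀ u : Fin (n + 1) → M → Euc k,
      (∀ i, ContMDiffOn I 𝓘(ℝ, Euc k).tangent ∞
        (fun m => (⟨(f m).pt, u i m⟩ : TangentBundle 𝓘(ℝ, Euc k) Y)) W) →
      ContMDiffOn I 𝓘(ℝ, ℝ) ∞ (fun m => (f m).form fun i => u i m) W) :
    Multiphase.SmoothOn I f U := by
  intro m₀ hm₀
  set e := trivializationAt (Euc k) (TangentSpace 𝓘(ℝ, Euc k) : Y → Type _) (f m₀).pt with he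
  set W : Set M := U ∩ (fun m => (f m).pt) ⁻¹' e.baseSet with hW
  have hWo : IsOpen W := hpt.continuousOn.isOpen_inter_preimage hU e.open_baseSet
  have hm₀W : m₀ ∈ W := ⟨hm₀, FiberBundle.mem_baseSet_trivializationAt (Euc k) (TangentSpace 𝓘(ℝ, Euc k) : Y → Type _) (f m₀).pt⟩
  refine Bundle.contMDiffWithinAt_totalSpace.2 ⟨hpt m₀ hm₀, ?_⟩
  refine contMDiffWithinAt_alternating_of_apply fun v => ?_
  -- The test fields are constant in the trivialization at the base point, so the values on them are
  -- the coordinates of the form.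
  have hfield : ∀ i, ContMDiffOn I 𝓘(ℝ, Euc k).tangent ∞
      (fun m => (⟨(f m).pt, e.symm (f m).pt (v i)⟩ : TangentBundle 𝓘(ℝ, Euc k) Y)) W := by
    intro i
    have h1 := (Bundle.Trivialization.contMDiffOn_symm (n := ∞) (IB := 𝓘(ℝ, Euc k)) e)
    have h2 : ContMDiffOn I (𝓘(ℝ, Euc k).prod 𝓘(ℝ, Euc k)) ∞
        (fun m => ((f m).pt, v i)) W :=
      (hpt.mono Set.inter_subset_left).prodMk contMDiffOn_const
    refine (h1.comp h2 fun m hm => by simpa [e.target_eq] using hm.2).congr fun m hm => ?_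
    exact e.mk_symm hm.2 (v i)
  have := h W Set.inter_subset_left hWo (fun i m => e.symm (f m).pt (v i)) hfield
  have h3 := (this m₀ hm₀W).contMDiffAt (hWo.mem_nhds hm₀W)
  refine (h3.congr_of_eventuallyEq ?_).contMDiffWithinAt
  filter_upwards [hWo.mem_nhds hm₀W] with m hm
  rw [FiberBundle.trivializationAt_continuousAlternatingMap_apply,
    ContinuousAlternatingMap.inCoordinates]
  simp only [Bundle.Trivial.continuousLinearMapAt_trivialization,
    Bundle.Trivial.fiberBundle_trivializationAt']
  refine congrArg (f m).form (funext fun i => ?_)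
  exact e.symmL_apply hm.2 (v i)

end Smoothness

/-! ### Passing from Euclidean parameter spaces to manifolds. -/

section Operators

variable {E H M : Type*} [NormedAddCommGroup E] [NormedSpace ℝ E] [FiniteDimensional ℝ E]
  [TopologicalSpace H] {I : ModelWithCorners ℝ E H} [I.Boundaryless] [TopologicalSpace M]
  [ChartedSpace H M] [IsManifold I ∞ M]
  {n k : ℕ} {X Y : Type*}
  [TopologicalSpace X] [ChartedSpace (Euc (n + 1)) X]
  [TopologicalSpace Y] [ChartedSpace (Euc k) Y] [IsManifold 𝓘(ℝ, Euc k) ∞ Y] {π : Y → X}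

/-- A family of maps of `Z` that is smooth on families over Euclidean spaces is smooth on families
over manifolds. -/
theorem Multiphase.SmoothOn.map_param {T : ℝ → Multiphase n k π → Multiphase n k π}
    (hT : ∀ (m : ℕ) (U : Set (Euc m)), IsOpen U →
      ∀ (c : Euc m → ℝ) (f : Euc m → Multiphase n k π), ContDiffOn ℝ ∞ c U →
        Multiphase.SmoothOn 𝓘(ℝ, Euc m) f U →
        Multiphase.SmoothOn 𝓘(ℝ, Euc m) (fun p => T (c p) (f p)) U)
    {U : Set M} (hU : IsOpen U) {c : M → ℝ} (hc : ContMDiffOn I 𝓘(ℝ, ℝ) ∞ c U)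
    {f : M → Multiphase n k π} (hf : Multiphase.SmoothOn I f U) :
    Multiphase.SmoothOn I (fun m => T (c m) (f m)) U := by
  intro m₀ hm₀
  let χ := extChartAt I m₀
  -- The hypothesis speaks of parameter spaces `Euc m` only; an extended chart followed by this
  -- isomorphism brings the problem there.
  let L : E ≃L[ℝ] Euc (Module.finrank ℝ E) := toEuclidean
  let V : Set E := χ.target ∩ χ.symm ⁻¹' U
  have hχs : ContMDiffOn 𝓘(ℝ, E) I ∞ χ.symm χ.target := contMDiffOn_extChartAt_symm m₀
  have hV : IsOpen V := hχs.continuousOn.isOpen_inter_preimage (isOpen_extChartAt_target m₀) hU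
  let V' : Set (Euc (Module.finrank ℝ E)) := L.symm ⁻¹' V
  have hV' : IsOpen V' := hV.preimage L.symm.continuous
  have hg : ContMDiffOn 𝓘(ℝ, Euc (Module.finrank ℝ E)) I ∞ (fun p => χ.symm (L.symm p)) V' :=
    (hχs.mono Set.inter_subset_left).comp L.symm.contDiff.contMDiff.contMDiffOn fun p hp => hp
  have hgU : V' ⊆ (fun p => χ.symm (L.symm p)) ⁻¹' U := fun p hp => hp.2
  have h1 := hT _ V' hV' (fun p => c (χ.symm (L.symm p))) (fun p => f (χ.symm (L.symm p)))
    (hc.comp hg hgU).contDiffOn (hf.comp hg hgU)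
  have hsrc : IsOpen (χ.source ∩ U) := (isOpen_extChartAt_source m₀).inter hU
  have hχ : ContMDiffOn I 𝓘(ℝ, Euc (Module.finrank ℝ E)) ∞ (fun m => L (χ m)) (χ.source ∩ U) :=
    L.contDiff.contMDiff.comp_contMDiffOn
      (((contMDiffOn_extChartAt (n := ∞) (x := m₀)).mono
        (by rw [← extChartAt_source I m₀])).mono Set.inter_subset_left)
  have h2 : Multiphase.SmoothOn I
      (fun m => T (c (χ.symm (L.symm (L (χ m))))) (f (χ.symm (L.symm (L (χ m))))))
      (χ.source ∩ U) := by
    refine h1.comp hχ fun m hm => ?_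
    simp only [V', V, Set.mem_preimage, ContinuousLinearEquiv.symm_apply_apply, Set.mem_inter_iff]
    exact ⟨χ.map_source hm.1, by rw [χ.left_inv hm.1]; exact hm.2⟩
  have h3 : Multiphase.SmoothOn I (fun m => T (c m) (f m)) (χ.source ∩ U) := by
    refine ContMDiffOn.congr h2 fun m hm => ?_
    simp only [ContinuousLinearEquiv.symm_apply_apply, χ.left_inv hm.1]
  exact (ContMDiffOn.contMDiffAt h3 (hsrc.mem_nhds
    ⟨mem_extChartAt_source m₀, hm₀⟩)).contMDiffWithinAt

theorem Multiphase.SmoothMap.smoothOn {Φ : Multiphase n k π → Multiphase n k π}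
    (hΦ : Multiphase.SmoothMap Φ) {U : Set M} (hU : IsOpen U)
    {f : M → Multiphase n k π} (hf : Multiphase.SmoothOn I f U) :
    Multiphase.SmoothOn I (fun m => Φ (f m)) U :=
  Multiphase.SmoothOn.map_param (T := fun _ => Φ) (c := fun _ => 0)
    (fun m U hU _ f _ hf => hΦ m U hU f hf) hU contMDiffOn_const hf

end Operators

/-! ### Derivatives along the factor `S` of `P × S`. -/

section PartialDerivatives

variable {P S N E' H' : Type*} [NormedAddCommGroup P] [NormedSpace ℝ P]
  {d : ℕ} [TopologicalSpace S] [ChartedSpace (Euc d) S] [IsManifold 𝓘(ℝ, Euc d) ∞ S]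
  [NormedAddCommGroup E'] [NormedSpace ℝ E'] [TopologicalSpace H']
  {J : ModelWithCorners ℝ E' H'} [TopologicalSpace N] [ChartedSpace H' N] [IsManifold J ∞ N]

theorem mfderiv_partial_snd {φ : P × S → N} {p : P} {x : S}
    (h : MDifferentiableAt (𝓘(ℝ, P).prod 𝓘(ℝ, Euc d)) J φ (p, x)) (w : Euc d) :
    mfderiv 𝓘(ℝ, Euc d) J (fun y => φ (p, y)) x w =
      mfderiv (𝓘(ℝ, P).prod 𝓘(ℝ, Euc d)) J φ (p, x) ((0, w) : P × Euc d) := by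
  have h1 : MDifferentiableAt 𝓘(ℝ, Euc d) (𝓘(ℝ, P).prod 𝓘(ℝ, Euc d)) (fun y : S => (p, y)) x :=
    mdifferentiableAt_const.prodMk mdifferentiableAt_id
  have := mfderiv_comp (I'' := J) x (g := φ) h h1
  rw [mfderiv_prod_right] at this
  exact congrArg (fun L => L w) this

/-- The partial derivatives of a smooth map along smooth vector fields are smooth. -/
theorem contMDiffOn_partial_snd {φ : P × S → N}
    (hφ : ContMDiff (𝓘(ℝ, P).prod 𝓘(ℝ, Euc d)) J ∞ φ) {W : Set (P × S)}
    {w : ∀ m : P × S, TangentSpace 𝓘(ℝ, Euc d) m.2}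
    (hw : ContMDiffOn (𝓘(ℝ, P).prod 𝓘(ℝ, Euc d)) 𝓘(ℝ, Euc d).tangent ∞
      (fun m => (⟨m.2, w m⟩ : TangentBundle 𝓘(ℝ, Euc d) S)) W) :
    ContMDiffOn (𝓘(ℝ, P).prod 𝓘(ℝ, Euc d)) J.tangent ∞
      (fun m => (⟨φ m, mfderiv 𝓘(ℝ, Euc d) J (fun y => φ (m.1, y)) m.2 (w m)⟩ :
        TangentBundle J N)) W := by
  -- The partial derivative along `w` is the full tangent map applied to `(0, w)`, whence the zero
  -- section of `TP`.
  have h0 : ContMDiffOn (𝓘(ℝ, P).prod 𝓘(ℝ, Euc d)) 𝓘(ℝ, P).tangent ∞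
      (fun m : P × S => (⟨m.1, 0⟩ : TangentBundle 𝓘(ℝ, P) P)) W :=
    ((Bundle.contMDiff_zeroSection (IB := 𝓘(ℝ, P)) ℝ (TangentSpace 𝓘(ℝ, P) : P → Type _)).comp
      (contMDiff_fst (M := P) (N := S))).contMDiffOn
  have h1 := (contMDiff_equivTangentBundleProd_symm (n := ∞) (I := 𝓘(ℝ, P)) (I' := 𝓘(ℝ, Euc d))
    (M := P) (M' := S)).comp_contMDiffOn (h0.prodMk hw)
  have h2 := (hφ.contMDiff_tangentMap (m := ∞) (by norm_num)).comp_contMDiffOn h1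
  refine h2.congr fun m _ => ?_
  have := mfderiv_partial_snd (J := J) (φ := φ) (p := m.1) (x := m.2)
    (hφ.mdifferentiableAt (by norm_num)) (w m)
  change (⟨φ m, _⟩ : TangentBundle J N) = ⟨φ m, _⟩
  rw [this]
  rfl

end PartialDerivatives

/-! ### `R_τ` on smooth families, and the pull-back of `ω_τ`. -/

section RFamily

variable {n k : ℕ} {X Y S : Type*}
  [TopologicalSpace X] [ChartedSpace (Euc (n + 1)) X]
  [TopologicalSpace Y] [ChartedSpace (Euc k) Y] [IsManifold 𝓘(ℝ, Euc k) ∞ Y]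
  [TopologicalSpace S] [ChartedSpace (Euc n) S] [IsManifold 𝓘(ℝ, Euc n) ∞ S]
  {π : Y → X} {τ : S → X} [CompactSpace S] [T2Space S]

theorem smoothMap_R :
    FieldSpace.SmoothMap (R : ZSection n k π τ → CotSection n k π τ) := by
  intro P _ _ _ F hF
  have hφ : ContMDiff (𝓘(ℝ, P).prod 𝓘(ℝ, Euc n)) 𝓘(ℝ, Euc k) ∞
      (fun q : P × S => ((F q.1).toFun q.2).pt) := contMDiffOn_univ.1 (Multiphase.pt_smooth hF)
  refine ⟨hφ, ?_⟩
  intro W _ v hv w hw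
  have hF' : Multiphase.SmoothOn (𝓘(ℝ, P).prod 𝓘(ℝ, Euc n))
    (fun q : P × S => (F q.1).toFun q.2) W := ContMDiffOn.mono hF (Set.subset_univ _)
  refine (Multiphase.form_apply_smooth hF'
    (Fin.cons (fun m => (v m).1) fun i m => mfderiv 𝓘(ℝ, Euc n) 𝓘(ℝ, Euc k)
      (fun y => ((F m.1).toFun y).pt) m.2 (w i m)) ?_).congr ?_
  · intro i
    refine Fin.cases ?_ (fun j => ?_) i
    · exact hv
    · exact contMDiffOn_partial_snd hφ (hw j)
  · intro m _
    change ((F m.1).toFun m.2).form (Fin.cons _ _) = _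
    congr 1
    funext i
    refine Fin.cases ?_ (fun j => ?_) i <;> rfl

/-- `R_τ` pulls `ω_τ` back to `Ω_τ`. -/
theorem twoForm_R {P : Type} [NormedAddCommGroup P] [NormedSpace ℝ P] (F : P → ZSection n k π τ)
    (p a b : P) : FieldSpace.twoForm (fun q => R (F q)) p a b = FieldSpace.twoForm F p a b := rfl

end RFamily

/-! ### Normal forms of the submersion `π` and the immersion `τ`. -/

section NormalForms

variable {n k : ℕ} {X Y S : Type*}
  [TopologicalSpace X] [ChartedSpace (Euc (n + 1)) X] [IsManifold 𝓘(ℝ, Euc (n + 1)) ∞ X]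
  [TopologicalSpace Y] [ChartedSpace (Euc k) Y] [IsManifold 𝓘(ℝ, Euc k) ∞ Y]
  [TopologicalSpace S] [ChartedSpace (Euc n) S] [IsManifold 𝓘(ℝ, Euc n) ∞ S]
  {π : Y → X} {τ : S → X}

theorem mdifferentiable_of_mem_maximalAtlas {d : ℕ} {M : Type*} [TopologicalSpace M]
    [ChartedSpace (Euc d) M] [IsManifold 𝓘(ℝ, Euc d) ∞ M] {ψ : OpenPartialHomeomorph M (Euc d)}
    (hψ : ψ ∈ IsManifold.maximalAtlas 𝓘(ℝ, Euc d) ∞ M) :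
    ψ.MDifferentiable 𝓘(ℝ, Euc d) 𝓘(ℝ, Euc d) :=
  ⟨(contMDiffOn_of_mem_maximalAtlas hψ).mdifferentiableOn (by norm_num),
    (contMDiffOn_symm_of_mem_maximalAtlas hψ).mdifferentiableOn (by norm_num)⟩

/-- A chart of `Y` in which `π` is a linear projection. The vertical vectors are those in the range
of the linear projection `T`. -/
structure AdaptedChart (n : ℕ) {k : ℕ} {X Y : Type*}
    [TopologicalSpace X] [ChartedSpace (Euc (n + 1)) X]
    [TopologicalSpace Y] [ChartedSpace (Euc k) Y] [IsManifold 𝓘(ℝ, Euc k) ∞ Y] (π : Y → X) where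
  chart : OpenPartialHomeomorph Y (Euc k)
  mem_maximalAtlas : chart ∈ IsManifold.maximalAtlas 𝓘(ℝ, Euc k) ∞ Y
  T : Euc k →L[ℝ] Euc k
  T_T : ∀ u, T (T u) = T u
  mem_vert_iff : ∀ y ∈ chart.source, ∀ u : Euc k, u ∈ vert n k π y ↔
    T (mfderiv 𝓘(ℝ, Euc k) 𝓘(ℝ, Euc k) chart y u) = mfderiv 𝓘(ℝ, Euc k) 𝓘(ℝ, Euc k) chart y u
  surjective : ∀ y ∈ chart.source, ∀ a : Euc (n + 1), ∃ u : Euc k,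
    (mfderiv 𝓘(ℝ, Euc k) 𝓘(ℝ, Euc (n + 1)) π y u : Euc (n + 1)) = a

/-- In the normal form of a submersion, `π` reads as the first projection of `Euc (n + 1) × F`. The
vertical vectors are then those with zero first component, and `T` is the projection onto the factor
`F`, independent of the point. -/
theorem exists_adaptedChart (hπ : IsSubmersion 𝓘(ℝ, Euc k) 𝓘(ℝ, Euc (n + 1)) ∞ π) (y₀ : Y) :
    ∃ A : AdaptedChart n (k := k) π, y₀ ∈ A.chart.source := by
  obtain ⟨F, _, _, h⟩ := hπ.isSubmersionAt y₀
  have key : ∀ y ∈ h.domChart.source, h.codChart (π y) = (h.equiv (h.domChart y)).1 := by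
    intro y hy
    have hy' : h.domChart y ∈ (h.domChart.extend 𝓘(ℝ, Euc k)).target := by
      simpa using h.domChart.map_source hy
    have := h.writtenInCharts hy'
    simpa [h.domChart.left_inv hy] using this
  let T : Euc k →L[ℝ] Euc k := (h.equiv.symm : (Euc (n + 1) × F) →L[ℝ] Euc k) ∘L
    ((ContinuousLinearMap.inr ℝ (Euc (n + 1)) F) ∘L (ContinuousLinearMap.snd ℝ (Euc (n + 1)) F)) ∘L
      (h.equiv : Euc k →L[ℝ] Euc (n + 1) × F)
  have hT : ∀ u, T u = h.equiv.symm (0, (h.equiv u).2) := fun u => rfl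
  have hT' : ∀ u, T u = u ↔ (h.equiv u).1 = 0 := by
    intro u
    rw [hT, ContinuousLinearEquiv.symm_apply_eq, Prod.ext_iff]
    simp [eq_comm]
  have hd := mdifferentiable_of_mem_maximalAtlas h.domChart_mem_maximalAtlas
  have hc := mdifferentiable_of_mem_maximalAtlas h.codChart_mem_maximalAtlas
  -- The derivative of the normal form. Both the description of the vertical vectors and the
  -- surjectivity of `Tπ` follow, since the derivatives of the charts are bijective.
  have e3 : ∀ y ∈ h.domChart.source, ∀ u : Euc k,
      (mfderiv 𝓘(ℝ, Euc (n + 1)) 𝓘(ℝ, Euc (n + 1)) h.codChart (π y)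
        (mfderiv 𝓘(ℝ, Euc k) 𝓘(ℝ, Euc (n + 1)) π y u) : Euc (n + 1)) =
        (h.equiv (mfderiv 𝓘(ℝ, Euc k) 𝓘(ℝ, Euc k) h.domChart y u)).1 := by
    intro y hy u
    have hπy : π y ∈ h.codChart.source := h.mapsto_domChart_source_codChart_source hy
    have hπd : MDifferentiableAt 𝓘(ℝ, Euc k) 𝓘(ℝ, Euc (n + 1)) π y :=
      (h.contMDiffOn.contMDiffAt (h.domChart.open_source.mem_nhds hy)).mdifferentiableAt
        (by norm_num)
    have e1 : mfderiv 𝓘(ℝ, Euc k) 𝓘(ℝ, Euc (n + 1)) (h.codChart ∘ π) y =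
        mfderiv 𝓘(ℝ, Euc k) 𝓘(ℝ, Euc (n + 1))
          ((ContinuousLinearMap.fst ℝ (Euc (n + 1)) F ∘L
            (h.equiv : Euc k →L[ℝ] Euc (n + 1) × F)) ∘ h.domChart) y := by
      refine Filter.EventuallyEq.mfderiv_eq ?_
      filter_upwards [h.domChart.open_source.mem_nhds hy] with z hz
      exact key z hz
    rw [mfderiv_comp y (hc.mdifferentiableAt hπy) hπd,
      mfderiv_comp y (ContinuousLinearMap.mdifferentiableAt _) (hd.mdifferentiableAt hy),
      ContinuousLinearMap.mfderiv_eq] at e1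
    exact congrArg (fun L => L u) e1
  refine ⟨⟨h.domChart, h.domChart_mem_maximalAtlas, T, fun u => ?_, fun y hy u => ?_,
    fun y hy a => ?_⟩, h.mem_domChart_source⟩
  · rw [hT (T u), hT u, ContinuousLinearEquiv.apply_symm_apply]
  · have hπy : π y ∈ h.codChart.source := h.mapsto_domChart_source_codChart_source hy
    have e3 := e3 y hy u
    refine Iff.trans ⟨fun h0 => ?_, fun h0 => ?_⟩ (hT' _).symm
    · have h0' : mfderiv 𝓘(ℝ, Euc k) 𝓘(ℝ, Euc (n + 1)) π y u = 0 := h0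
      rw [h0'] at e3
      exact e3.symm.trans (map_zero _)
    · exact hc.mfderiv_injective hπy ((e3.trans h0).trans (map_zero _).symm)
  · have hπy : π y ∈ h.codChart.source := h.mapsto_domChart_source_codChart_source hy
    let a' : Euc (n + 1) := mfderiv 𝓘(ℝ, Euc (n + 1)) 𝓘(ℝ, Euc (n + 1)) h.codChart (π y) a
    obtain ⟨u, hu⟩ := hd.mfderiv_surjective hy (h.equiv.symm (a', 0))
    refine ⟨u, hc.mfderiv_injective hπy ((e3 y hy u).trans ?_)⟩
    have h1 : (h.equiv (mfderiv 𝓘(ℝ, Euc k) 𝓘(ℝ, Euc k) h.domChart y u)) =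
        h.equiv (h.equiv.symm (a', 0)) := congrArg h.equiv hu
    rw [h1, ContinuousLinearEquiv.apply_symm_apply]

/-- An immersion has local smooth retractions. -/
theorem exists_local_retraction
    (hτ : IsImmersion 𝓘(ℝ, Euc n) 𝓘(ℝ, Euc (n + 1)) ∞ τ) (x₀ : S) :
    ∃ (r : X → S) (U : Set X) (W : Set S), IsOpen U ∧ IsOpen W ∧ x₀ ∈ W ∧
      ContMDiffOn 𝓘(ℝ, Euc (n + 1)) 𝓘(ℝ, Euc n) ∞ r U ∧ ∀ x ∈ W, τ x ∈ U ∧ r (τ x) = x := by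
  obtain ⟨F, _, _, h⟩ := hτ.isImmersionAt x₀
  have key : ∀ x ∈ h.domChart.source, h.codChart (τ x) = h.equiv (h.domChart x, 0) := by
    intro x hx
    have hx' : h.domChart x ∈ (h.domChart.extend 𝓘(ℝ, Euc n)).target := by
      simpa using h.domChart.map_source hx
    have := h.writtenInCharts hx'
    simpa [h.domChart.left_inv hx] using this
  -- In the normal form `τ` is the inclusion of the first factor; forgetting the second factor
  -- retracts onto it.
  let g : X → Euc n := fun x' => (h.equiv.symm (h.codChart x')).1
  have hg : ContMDiffOn 𝓘(ℝ, Euc (n + 1)) 𝓘(ℝ, Euc n) ∞ g h.codChart.source := by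
    have h1 : ContDiff ℝ ∞ (fun u : Euc (n + 1) => (h.equiv.symm u).1) :=
      contDiff_fst.comp h.equiv.symm.contDiff
    exact h1.contMDiff.comp_contMDiffOn
      (contMDiffOn_of_mem_maximalAtlas h.codChart_mem_maximalAtlas)
  refine ⟨fun x' => h.domChart.symm (g x'), h.codChart.source ∩ g ⁻¹' h.domChart.target,
    h.domChart.source, hg.continuousOn.isOpen_inter_preimage h.codChart.open_source
      h.domChart.open_target, h.domChart.open_source, h.mem_domChart_source, ?_, ?_⟩
  · exact (contMDiffOn_symm_of_mem_maximalAtlas h.domChart_mem_maximalAtlas).comp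
      (hg.mono Set.inter_subset_left) fun x hx => hx.2
  · intro x hx
    have hgx : g (τ x) = h.domChart x := by simp only [g]; rw [key x hx]; simp
    refine ⟨⟨h.source_subset_preimage_source hx, ?_⟩, ?_⟩
    · rw [Set.mem_preimage, hgx]; exact h.domChart.map_source hx
    · simp only [hgx, h.domChart.left_inv hx]

end NormalForms

/-! ### Vector fields along maps. -/

section Fields

variable {E H M : Type*} [NormedAddCommGroup E] [NormedSpace ℝ E] [TopologicalSpace H]
  {I : ModelWithCorners ℝ E H} [TopologicalSpace M] [ChartedSpace H M]
  {E₁ H₁ N₁ : Type*} [NormedAddCommGroup E₁] [NormedSpace ℝ E₁] [TopologicalSpace H₁]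
  {J₁ : ModelWithCorners ℝ E₁ H₁} [TopologicalSpace N₁] [ChartedSpace H₁ N₁] [IsManifold J₁ ∞ N₁]
  {E₂ H₂ N₂ : Type*} [NormedAddCommGroup E₂] [NormedSpace ℝ E₂] [TopologicalSpace H₂]
  {J₂ : ModelWithCorners ℝ E₂ H₂} [TopologicalSpace N₂] [ChartedSpace H₂ N₂] [IsManifold J₂ ∞ N₂]

/-- Smooth maps send smooth vector fields along a map to smooth vector fields. -/
theorem contMDiffOn_mfderiv_field {g : N₁ → N₂} {U : Set N₁} (hU : IsOpen U)
    (hg : ContMDiffOn J₁ J₂ ∞ g U) {φ : M → N₁} {u : ∀ m, TangentSpace J₁ (φ m)} {W : Set M}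
    (hu : ContMDiffOn I J₁.tangent ∞ (fun m => (⟨φ m, u m⟩ : TangentBundle J₁ N₁)) W)
    (hW : ∀ m ∈ W, φ m ∈ U) :
    ContMDiffOn I J₂.tangent ∞
      (fun m => (⟨g (φ m), mfderiv J₁ J₂ g (φ m) (u m)⟩ : TangentBundle J₂ N₂)) W := by
  have h1 := hg.contMDiffOn_tangentMapWithin (m := ∞) (by norm_num) hU.uniqueMDiffOn
  refine (h1.comp hu fun m hm => hW m hm).congr fun m hm => ?_
  change (⟨g (φ m), _⟩ : TangentBundle J₂ N₂) = ⟨g (φ m), mfderivWithin J₁ J₂ g U (φ m) (u m)⟩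
  rw [mfderivWithin_of_isOpen hU (hW m hm)]

/-- Vector fields along a map into a vector space are functions. -/
theorem contMDiffOn_field_vectorSpace_iff {f u : M → E₁} {W : Set M} :
    ContMDiffOn I 𝓘(ℝ, E₁).tangent ∞ (fun m => (⟨f m, u m⟩ : TangentBundle 𝓘(ℝ, E₁) E₁)) W ↔
      ContMDiffOn I 𝓘(ℝ, E₁) ∞ f W ∧ ContMDiffOn I 𝓘(ℝ, E₁) ∞ u W := by
  have key : ∀ m₀, ContMDiffWithinAt I 𝓘(ℝ, E₁).tangent ∞
      (fun m => (⟨f m, u m⟩ : TangentBundle 𝓘(ℝ, E₁) E₁)) W m₀ ↔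
      ContMDiffWithinAt I 𝓘(ℝ, E₁) ∞ f W m₀ ∧ ContMDiffWithinAt I 𝓘(ℝ, E₁) ∞ u W m₀ := by
    intro m₀
    rw [ModelWithCorners.tangent, Bundle.contMDiffWithinAt_totalSpace]
    simp only [trivializationAt_model_space_apply]
  exact ⟨fun h => ⟨fun m hm => ((key m).1 (h m hm)).1, fun m hm => ((key m).1 (h m hm)).2⟩,
    fun h m hm => (key m).2 ⟨h.1 m hm, h.2 m hm⟩⟩

theorem tangentBundle_mk_eq {d : ℕ} {N : Type*} [TopologicalSpace N] [ChartedSpace (Euc d) N]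
    {x y : N} (h : x = y) (v : Euc d) :
    (⟨x, v⟩ : TangentBundle 𝓘(ℝ, Euc d) N) = ⟨y, v⟩ := by subst h; rfl

end Fields

/-! ### Building `(n+1)`-forms from momenta. -/

section MomentumForm

variable {n k : ℕ}

/-- The `(n+1)`-form `q^*κ` made of a linear map `κ` to `n`-forms and a linear map `q`. -/
def momentumForm (κ : Euc k →ₗ[ℝ] (Euc n [⋀^Fin n]→L[ℝ] ℝ)) (q : Euc k →L[ℝ] Euc n) :
    Euc k [⋀^Fin (n + 1)]→L[ℝ] ℝ :=
  ContinuousAlternatingMap.alternatizeUncurryFin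
    (LinearMap.toContinuousLinearMap
      (ContinuousAlternatingMap.compContinuousLinearMapₗ q ∘ₗ κ))

theorem momentumForm_apply (κ : Euc k →ₗ[ℝ] (Euc n [⋀^Fin n]→L[ℝ] ℝ)) (q : Euc k →L[ℝ] Euc n)
    (u : Fin (n + 1) → Euc k) :
    momentumForm κ q u =
      ∑ i : Fin (n + 1), (-1 : ℝ) ^ (i : ℕ) * κ (u i) fun j => q (u (i.succAbove j)) := by
  rw [momentumForm, ContinuousAlternatingMap.alternatizeUncurryFin_apply]
  refine Finset.sum_congr rfl fun i _ => ?_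
  rw [← smul_eq_mul]
  simp
  rfl

/-- In each term of the alternating sum all arguments but one go through `q`. Of two arguments
killed by `q`, at least one is therefore fed to `q`. -/
theorem momentumForm_eq_zero {κ : Euc k →ₗ[ℝ] (Euc n [⋀^Fin n]→L[ℝ] ℝ)} {q : Euc k →L[ℝ] Euc n}
    {u : Fin (n + 1) → Euc k} {i j : Fin (n + 1)} (hij : i ≠ j) (hi : q (u i) = 0)
    (hj : q (u j) = 0) : momentumForm κ q u = 0 := by
  rw [momentumForm_apply]
  refine Finset.sum_eq_zero fun l _ => ?_
  have : ∃ l', q (u (l.succAbove l')) = 0 := by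
    by_cases h : l = i
    · obtain ⟨l', hl'⟩ := Fin.exists_succAbove_eq (x := j) (y := l) (by rw [h]; exact hij.symm)
      exact ⟨l', by rw [hl', hj]⟩
    · obtain ⟨l', hl'⟩ := Fin.exists_succAbove_eq (x := i) (y := l) (Ne.symm h)
      exact ⟨l', by rw [hl', hi]⟩
  obtain ⟨l', hl'⟩ := this
  rw [ContinuousAlternatingMap.map_coord_zero _ l' hl', mul_zero]

/-- Only the term in which `v` is the argument of `κ` survives; in all the others `v` is fed to `q`.
This is why no normalizing factor is needed to recover the momentum. -/
theorem momentumForm_cons {κ : Euc k →ₗ[ℝ] (Euc n [⋀^Fin n]→L[ℝ] ℝ)} {q : Euc k →L[ℝ] Euc n}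
    {v : Euc k} (hv : q v = 0) (u : Fin n → Euc k) :
    momentumForm κ q (Fin.cons v u) = κ v fun i => q (u i) := by
  rw [momentumForm_apply, Fin.sum_univ_succ, Finset.sum_eq_zero, add_zero]
  · simp
  · intro i _
    have : ∃ l', (Fin.cons v u : Fin (n + 1) → Euc k) (i.succ.succAbove l') = v := by
      obtain ⟨l', hl'⟩ := Fin.exists_succAbove_eq (x := 0) (y := i.succ) (Fin.succ_ne_zero i).symm
      exact ⟨l', by rw [hl', Fin.cons_zero]⟩
    obtain ⟨l', hl'⟩ := this
    rw [ContinuousAlternatingMap.map_coord_zero _ l' (by rw [hl', hv]), mul_zero]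

end MomentumForm

/-! ### Projection onto the vertical spaces in an adapted chart. -/

section VertProj

variable {n k : ℕ} {X Y : Type*}
  [TopologicalSpace X] [ChartedSpace (Euc (n + 1)) X]
  [TopologicalSpace Y] [ChartedSpace (Euc k) Y] [IsManifold 𝓘(ℝ, Euc k) ∞ Y] {π : Y → X}

namespace AdaptedChart

variable (A : AdaptedChart n (k := k) π)

/-- The derivative of the inverse chart. -/
def dSymm (y : Y) : Euc k →L[ℝ] Euc k :=
  mfderiv 𝓘(ℝ, Euc k) 𝓘(ℝ, Euc k) A.chart.symm (A.chart y)

/-- The derivative of the chart. -/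
def d (y : Y) : Euc k →L[ℝ] Euc k := mfderiv 𝓘(ℝ, Euc k) 𝓘(ℝ, Euc k) A.chart y

theorem dSymm_d {y : Y} (hy : y ∈ A.chart.source) (u : Euc k) : A.dSymm y (A.d y u) = u := by
  have := (mdifferentiable_of_mem_maximalAtlas A.mem_maximalAtlas).symm_comp_deriv hy
  exact congrArg (fun L => L u) this

theorem d_dSymm {y : Y} (hy : y ∈ A.chart.source) (u : Euc k) : A.d y (A.dSymm y u) = u := by
  have := (mdifferentiable_of_mem_maximalAtlas A.mem_maximalAtlas).comp_symm_deriv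
    (A.chart.map_source hy)
  rw [A.chart.left_inv hy] at this
  exact congrArg (fun L => L u) this

theorem mem_vert {y : Y} (hy : y ∈ A.chart.source) {u : Euc k} :
    u ∈ vert n k π y ↔ A.T (A.d y u) = A.d y u := A.mem_vert_iff y hy u

theorem dSymm_mem_vert {y : Y} (hy : y ∈ A.chart.source) (u : Euc k) :
    A.dSymm y (A.T u) ∈ vert n k π y := by
  rw [A.mem_vert hy, A.d_dSymm hy, A.T_T]

open Classical in
/-- The projection onto the vertical space given by an adapted chart. -/
def vertProj (y : Y) : Euc k →ₗ[ℝ] vert n k π y :=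
  if h : y ∈ A.chart.source then
    LinearMap.codRestrict (vert n k π y)
      (((A.dSymm y).comp (A.T.comp (A.d y)) : Euc k →L[ℝ] Euc k) : Euc k →ₗ[ℝ] Euc k)
      fun u => A.dSymm_mem_vert h (A.d y u)
  else 0

theorem vertProj_coe {y : Y} (hy : y ∈ A.chart.source) (u : Euc k) :
    (A.vertProj y u).1 = A.dSymm y (A.T (A.d y u)) := by
  rw [vertProj, dif_pos hy]
  rfl

theorem vertProj_of_mem {y : Y} (hy : y ∈ A.chart.source) (v : vert n k π y) :
    A.vertProj y v.1 = v := by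
  apply Subtype.ext
  refine (A.vertProj_coe hy _).trans ?_
  have h := (A.mem_vert hy).1 v.2
  exact (congrArg (A.dSymm y) h).trans (A.dSymm_d hy _)

variable {E H M : Type*} [NormedAddCommGroup E] [NormedSpace ℝ E] [TopologicalSpace H]
  {I : ModelWithCorners ℝ E H} [TopologicalSpace M] [ChartedSpace H M]

theorem contMDiffOn_d {φ : M → Y} {u : M → Euc k} {W : Set M}
    (hu : ContMDiffOn I 𝓘(ℝ, Euc k).tangent ∞
      (fun m => (⟨φ m, u m⟩ : TangentBundle 𝓘(ℝ, Euc k) Y)) W)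
    (hW : ∀ m ∈ W, φ m ∈ A.chart.source) :
    ContMDiffOn I 𝓘(ℝ, Euc k) ∞ (fun m => A.chart (φ m)) W ∧
      ContMDiffOn I 𝓘(ℝ, Euc k) ∞ (fun m => A.d (φ m) (u m)) W :=
  contMDiffOn_field_vectorSpace_iff.1 (contMDiffOn_mfderiv_field A.chart.open_source
    (contMDiffOn_of_mem_maximalAtlas A.mem_maximalAtlas) hu hW)

theorem contMDiffOn_dSymm {φ : M → Y} {u : M → Euc k} {W : Set M}
    (hφ : ContMDiffOn I 𝓘(ℝ, Euc k) ∞ φ W) (hu : ContMDiffOn I 𝓘(ℝ, Euc k) ∞ u W)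
    (hW : ∀ m ∈ W, φ m ∈ A.chart.source) :
    ContMDiffOn I 𝓘(ℝ, Euc k).tangent ∞
      (fun m => (⟨φ m, A.dSymm (φ m) (u m)⟩ : TangentBundle 𝓘(ℝ, Euc k) Y)) W := by
  have h1 : ContMDiffOn I 𝓘(ℝ, Euc k) ∞ (fun m => A.chart (φ m)) W :=
    (contMDiffOn_of_mem_maximalAtlas A.mem_maximalAtlas).comp hφ hW
  have h2 := contMDiffOn_mfderiv_field A.chart.open_target
    (contMDiffOn_symm_of_mem_maximalAtlas A.mem_maximalAtlas)
    (contMDiffOn_field_vectorSpace_iff.2 ⟨h1, hu⟩) fun m hm => A.chart.map_source (hW m hm)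
  exact h2.congr fun m hm => tangentBundle_mk_eq (A.chart.left_inv (hW m hm)).symm _

theorem contMDiffOn_vertProj {φ : M → Y} {u : M → Euc k} {W : Set M}
    (hφ : ContMDiffOn I 𝓘(ℝ, Euc k) ∞ φ W) (hu : ContMDiffOn I 𝓘(ℝ, Euc k).tangent ∞
      (fun m => (⟨φ m, u m⟩ : TangentBundle 𝓘(ℝ, Euc k) Y)) W)
    (hW : ∀ m ∈ W, φ m ∈ A.chart.source) :
    ContMDiffOn I 𝓘(ℝ, Euc k).tangent ∞
      (fun m => (⟨φ m, (A.vertProj (φ m) (u m)).1⟩ : TangentBundle 𝓘(ℝ, Euc k) Y)) W := by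
  refine (A.contMDiffOn_dSymm hφ (A.T.contMDiff.comp_contMDiffOn (A.contMDiffOn_d hu hW).2)
    hW).congr fun m hm => ?_
  rw [A.vertProj_coe (hW m hm)]
  rfl

end AdaptedChart

end VertProj

/-! ### Lifting momenta to elements of `Z`. -/

section Lift

variable {E H M : Type*} [NormedAddCommGroup E] [NormedSpace ℝ E]
  [TopologicalSpace H] {I : ModelWithCorners ℝ E H} [TopologicalSpace M]
  [ChartedSpace H M]
  {n k : ℕ} {X Y S : Type*}
  [TopologicalSpace X] [ChartedSpace (Euc (n + 1)) X] [IsManifold 𝓘(ℝ, Euc (n + 1)) ∞ X]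
  [TopologicalSpace Y] [ChartedSpace (Euc k) Y] [IsManifold 𝓘(ℝ, Euc k) ∞ Y]
  [TopologicalSpace S] [ChartedSpace (Euc n) S] [IsManifold 𝓘(ℝ, Euc n) ∞ S]
  {π : Y → X} {τ : S → X}

/-- Near a point of `S`, vectors of `T S` can be recovered from their images in `T X`, by a linear
map that depends smoothly on the point. -/
theorem exists_mfderiv_retraction
    (hτ : IsImmersion 𝓘(ℝ, Euc n) 𝓘(ℝ, Euc (n + 1)) ∞ τ) (x₀ : S) :
    ∃ (r : X → S) (U : Set X) (W : Set S), IsOpen U ∧ IsOpen W ∧ x₀ ∈ W ∧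
      ContMDiffOn 𝓘(ℝ, Euc (n + 1)) 𝓘(ℝ, Euc n) ∞ r U ∧ (∀ x ∈ W, τ x ∈ U ∧ r (τ x) = x) ∧
      ∀ x ∈ W, ∀ w : Euc n, (mfderiv 𝓘(ℝ, Euc (n + 1)) 𝓘(ℝ, Euc n) r (τ x)
        (mfderiv 𝓘(ℝ, Euc n) 𝓘(ℝ, Euc (n + 1)) τ x w) : Euc n) = w := by
  obtain ⟨r, U, W, hU, hW, hx₀, hr, h⟩ := exists_local_retraction hτ x₀
  refine ⟨r, U, W, hU, hW, hx₀, hr, h, fun x hx w => ?_⟩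
  have h1 := mfderiv_comp x (g := r) (f := τ)
    ((hr.contMDiffAt (hU.mem_nhds (h x hx).1)).mdifferentiableAt (by norm_num))
    (hτ.contMDiff.mdifferentiableAt (by norm_num))
  have h2 : mfderiv 𝓘(ℝ, Euc n) 𝓘(ℝ, Euc n) (r ∘ τ) x = mfderiv 𝓘(ℝ, Euc n) 𝓘(ℝ, Euc n) id x := by
    refine Filter.EventuallyEq.mfderiv_eq ?_
    filter_upwards [hW.mem_nhds hx] with z hz
    exact (h z hz).2
  have h3 := congrArg (fun L : Euc n →L[ℝ] Euc n => L w) (h1.symm.trans h2)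
  rw [mfderiv_id] at h3
  exact h3

variable {b : M → S} {φ : M → Y} {μ : ∀ m, vert n k π (φ m) →ₗ[ℝ] (Euc n [⋀^Fin n]→L[ℝ] ℝ)}

/-- The lift is `momentumForm` with `κ` the momentum precomposed with the vertical projection of an
adapted chart, and `q` the derivative of `r ∘ π` for a local retraction `r` of `X` onto `Σ_τ`. Since
`q` kills vertical vectors, the form lies in `Z`; since `q u = w` whenever `u` lies over `Tτ w`, it
reproduces the momentum. Its values on smooth fields are sums of the functions that `SmoothMomentum`
declares smooth. -/
theorem exists_local_lift (hπ : IsSubmersion 𝓘(ℝ, Euc k) 𝓘(ℝ, Euc (n + 1)) ∞ π)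
    (hτ : IsImmersion 𝓘(ℝ, Euc n) 𝓘(ℝ, Euc (n + 1)) ∞ τ)
    (hb : ContMDiff I 𝓘(ℝ, Euc n) ∞ b) (hφ : ContMDiff I 𝓘(ℝ, Euc k) ∞ φ)
    (hcov : ∀ m, π (φ m) = τ (b m)) (hμ : SmoothMomentum π I b φ μ) (m₀ : M) :
    ∃ (U : Set M) (z : M → Euc k [⋀^Fin (n + 1)]→L[ℝ] ℝ), IsOpen U ∧ m₀ ∈ U ∧
      (∀ m ∈ U, ∀ u : Fin (n + 1) → Euc k,
        (∃ i j, i ≠ j ∧ u i ∈ vert n k π (φ m) ∧ u j ∈ vert n k π (φ m)) → z m u = 0) ∧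
      (∀ m ∈ U, ∀ (v : vert n k π (φ m)) (u : Fin n → Euc k) (w : Fin n → Euc n),
        (∀ i, (mfderiv 𝓘(ℝ, Euc k) 𝓘(ℝ, Euc (n + 1)) π (φ m) (u i) : Euc (n + 1)) =
          mfderiv 𝓘(ℝ, Euc n) 𝓘(ℝ, Euc (n + 1)) τ (b m) (w i)) →
        z m (Fin.cons (v.1 : Euc k) u) = μ m v w) ∧
      ∀ W ⊆ U, IsOpen W → ∀ u : Fin (n + 1) → M → Euc k,
        (∀ i, ContMDiffOn I 𝓘(ℝ, Euc k).tangent ∞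
          (fun m => (⟨φ m, u i m⟩ : TangentBundle 𝓘(ℝ, Euc k) Y)) W) →
        ContMDiffOn I 𝓘(ℝ, ℝ) ∞ (fun m => z m fun i => u i m) W := by
  obtain ⟨A, hA⟩ := exists_adaptedChart hπ (φ m₀)
  obtain ⟨r, V, N, hV, hN, hm₀N, hr, hrτ, hDr⟩ := exists_mfderiv_retraction hτ (b m₀)
  let q : M → Euc k →L[ℝ] Euc n := fun m =>
    (mfderiv 𝓘(ℝ, Euc (n + 1)) 𝓘(ℝ, Euc n) r (π (φ m)) : Euc (n + 1) →L[ℝ] Euc n) ∘L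
      (mfderiv 𝓘(ℝ, Euc k) 𝓘(ℝ, Euc (n + 1)) π (φ m) : Euc k →L[ℝ] Euc (n + 1))
  have hqv : ∀ m, ∀ u : Euc k, u ∈ vert n k π (φ m) → q m u = 0 := by
    intro m u hu
    have hu' : mfderiv 𝓘(ℝ, Euc k) 𝓘(ℝ, Euc (n + 1)) π (φ m) u = 0 := hu
    exact (congrArg (mfderiv 𝓘(ℝ, Euc (n + 1)) 𝓘(ℝ, Euc n) r (π (φ m))) hu').trans (map_zero _)
  refine ⟨φ ⁻¹' A.chart.source ∩ b ⁻¹' N,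
    fun m => momentumForm ((μ m).comp (A.vertProj (φ m))) (q m),
    (A.chart.open_source.preimage hφ.continuous).inter (hN.preimage hb.continuous),
    ⟨hA, hm₀N⟩, ?_, ?_, ?_⟩
  · rintro m hm u ⟨i, j, hij, hi, hj⟩
    exact momentumForm_eq_zero hij (hqv m _ hi) (hqv m _ hj)
  · intro m hm v u w huw
    refine (momentumForm_cons (hqv m _ v.2) u).trans ?_
    change μ m (A.vertProj (φ m) v.1) _ = _
    rw [A.vertProj_of_mem hm.1]
    congr 1
    funext i
    change mfderiv 𝓘(ℝ, Euc (n + 1)) 𝓘(ℝ, Euc n) r (π (φ m))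
      (mfderiv 𝓘(ℝ, Euc k) 𝓘(ℝ, Euc (n + 1)) π (φ m) (u i)) = w i
    refine Eq.trans ?_ (hDr (b m) hm.2 (w i))
    rw [← hcov m]
    exact congrArg _ (huw i)
  · intro W hWU hW u hu
    simp only [momentumForm_apply]
    refine contMDiffOn_finsetSum fun i _ => contMDiffOn_const.mul ?_
    refine hμ W hW (fun m => A.vertProj (φ m) (u i m)) ?_
      (fun j m => q m (u (i.succAbove j) m)) fun j => ?_
    · exact A.contMDiffOn_vertProj hφ.contMDiffOn (hu i) fun m hm => (hWU hm).1
    · have h1 := contMDiffOn_mfderiv_field isOpen_univ hπ.contMDiff.contMDiffOn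
        (hu (i.succAbove j)) fun _ _ => Set.mem_univ _
      have h2 := contMDiffOn_mfderiv_field hV hr h1
        fun m hm => by rw [hcov m]; exact (hrτ _ (hWU hm).2).1
      refine h2.congr fun m hm => tangentBundle_mk_eq ?_ _
      rw [hcov m, (hrτ _ (hWU hm).2).2]

/-- Families in `T^*𝒴_τ` lift to families in `𝒵_τ`. -/
theorem exists_lift [FiniteDimensional ℝ E] [I.Boundaryless] [IsManifold I ∞ M] [T2Space M]
    [SigmaCompactSpace M] (hπ : IsSubmersion 𝓘(ℝ, Euc k) 𝓘(ℝ, Euc (n + 1)) ∞ π)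
    (hτ : IsImmersion 𝓘(ℝ, Euc n) 𝓘(ℝ, Euc (n + 1)) ∞ τ)
    (hb : ContMDiff I 𝓘(ℝ, Euc n) ∞ b) (hφ : ContMDiff I 𝓘(ℝ, Euc k) ∞ φ)
    (hcov : ∀ m, π (φ m) = τ (b m)) (hμ : SmoothMomentum π I b φ μ) :
    ∃ z : M → Euc k [⋀^Fin (n + 1)]→L[ℝ] ℝ,
      (∀ m, ∀ u : Fin (n + 1) → Euc k,
        (∃ i j, i ≠ j ∧ u i ∈ vert n k π (φ m) ∧ u j ∈ vert n k π (φ m)) → z m u = 0) ∧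
      (∀ m, ∀ (v : vert n k π (φ m)) (u : Fin n → Euc k) (w : Fin n → Euc n),
        (∀ i, (mfderiv 𝓘(ℝ, Euc k) 𝓘(ℝ, Euc (n + 1)) π (φ m) (u i) : Euc (n + 1)) =
          mfderiv 𝓘(ℝ, Euc n) 𝓘(ℝ, Euc (n + 1)) τ (b m) (w i)) →
        z m (Fin.cons (v.1 : Euc k) u) = μ m v w) ∧
      ∀ W : Set M, IsOpen W → ∀ u : Fin (n + 1) → M → Euc k,
        (∀ i, ContMDiffOn I 𝓘(ℝ, Euc k).tangent ∞
          (fun m => (⟨φ m, u i m⟩ : TangentBundle 𝓘(ℝ, Euc k) Y)) W) →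
        ContMDiffOn I 𝓘(ℝ, ℝ) ∞ (fun m => z m fun i => u i m) W := by
  choose U z hUo hmU hz1 hz2 hz3 using
    fun m₀ => exists_local_lift (μ := μ) hπ hτ hb hφ hcov hμ m₀
  -- At each point the conditions on `z` are affine (vanishing, and prescribed values), so they
  -- survive averaging with weights of sum one.
  obtain ⟨ρ, hρ⟩ := SmoothPartitionOfUnity.exists_isSubordinate I (isClosed_univ (X := M)) U hUo
    fun m _ => Set.mem_iUnion.2 ⟨m, hmU m⟩
  have hsup : ∀ i m, ρ i m ≠ 0 → m ∈ U i := fun i m h => hρ i (subset_tsupport _ h)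
  have happ : ∀ m u, (∑ᶠ i, ρ i m • z i m : Euc k [⋀^Fin (n + 1)]→L[ℝ] ℝ) u =
      ∑ᶠ i, ρ i m • z i m u := by
    intro m u
    have hfin : (Function.support fun i => ρ i m • z i m).Finite :=
      (ρ.locallyFinite.point_finite m).subset fun i hi h0 => hi (by
        have : ρ i m = 0 := h0
        simp only [this, zero_smul])
    let ev : (Euc k [⋀^Fin (n + 1)]→L[ℝ] ℝ) →+ ℝ :=
      { toFun := fun α => α u, map_zero' := rfl, map_add' := fun _ _ => rfl }
    exact AddMonoidHom.map_finsum ev hfin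
  refine ⟨fun m => ∑ᶠ i, ρ i m • z i m, ?_, ?_, ?_⟩
  · intro m u hu
    rw [happ]
    refine finsum_eq_zero_of_forall_eq_zero fun i => ?_
    by_cases h : ρ i m = 0
    · rw [h, zero_smul]
    · rw [hz1 i m (hsup i m h) u hu, smul_zero]
  · intro m v u w huw
    refine (happ m _).trans ?_
    have : ∀ i, ρ i m • z i m (Fin.cons (v.1 : Euc k) u) = ρ i m * μ m v w := by
      intro i
      by_cases h : ρ i m = 0
      · rw [h, zero_smul, zero_mul]
      · rw [hz2 i m (hsup i m h) v u w huw, smul_eq_mul]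
    refine (finsum_congr this).trans ?_
    rw [← finsum_mul, ρ.sum_eq_one (Set.mem_univ m), one_mul]
  · intro W hW u hu m hm
    simp only [happ]
    refine ContMDiffAt.contMDiffWithinAt (ρ.contMDiffAt_finsum (n := ⊤)
      (g := fun i m => z i m fun j => u j m) fun i hi => ?_)
    have hm' : m ∈ W ∩ U i := ⟨hm, hρ i hi⟩
    exact (hz3 i (W ∩ U i) Set.inter_subset_right (hW.inter (hUo i)) u
      fun j => (hu j).mono Set.inter_subset_left).contMDiffAt
        ((hW.inter (hUo i)).mem_nhds hm')

end Lift

/-! ### The fibres of `R_τ` and its surjectivity on points and on families. -/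

section Sections

variable {n k : ℕ} {X Y S : Type*}
  [TopologicalSpace X] [ChartedSpace (Euc (n + 1)) X] [IsManifold 𝓘(ℝ, Euc (n + 1)) ∞ X]
  [TopologicalSpace Y] [ChartedSpace (Euc k) Y] [IsManifold 𝓘(ℝ, Euc k) ∞ Y]
  [TopologicalSpace S] [ChartedSpace (Euc n) S] [IsManifold 𝓘(ℝ, Euc n) ∞ S]
  {π : Y → X} {τ : S → X}

/-- In the multilinear expansion of `γ` at `u' + (u - u')`, every term containing some difference
has an entry in `V` and vanishes. -/
theorem ContinuousAlternatingMap.eq_of_sub_mem {E : Type*} [NormedAddCommGroup E]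
    [NormedSpace ℝ E] {j : ℕ} (γ : E [⋀^Fin j]→L[ℝ] ℝ) (V : Submodule ℝ E)
    (hγ : ∀ u : Fin j → E, (∃ i, u i ∈ V) → γ u = 0) {u u' : Fin j → E}
    (h : ∀ i, u i - u' i ∈ V) : γ u = γ u' := by
  have h1 : u = u' + fun i => u i - u' i := by funext i; simp
  have h2 := γ.toContinuousMultilinearMap.map_add_univ u' (fun i => u i - u' i)
  rw [← h1, Finset.sum_eq_single Finset.univ] at h2
  · simpa using h2
  · intro s _ hs
    obtain ⟨i, hi⟩ : ∃ i, i ∉ s := by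
      by_contra hc
      push Not at hc
      exact hs (Finset.eq_univ_iff_forall.2 hc)
    exact hγ _ ⟨i, by rw [Finset.piecewise_eq_of_notMem _ _ _ hi]; exact h i⟩
  · intro h; exact absurd (Finset.mem_univ _) h

theorem Multiphase.form_eq_zero (z : Multiphase n k π) {u : Fin (n + 1) → Euc k}
    {i j : Fin (n + 1)} (hij : i ≠ j) (hi : u i ∈ vert n k π z.pt) (hj : u j ∈ vert n k π z.pt) :
    z.form u = 0 := z.2 u ⟨i, j, hij, hi, hj⟩

/-- The value of `z` on a vertical vector and on further vectors depends only on the projections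
of the latter to `X`. -/
theorem Multiphase.form_cons_congr (z : Multiphase n k π) {v : Euc k} (hv : v ∈ vert n k π z.pt)
    {u u' : Fin n → Euc k}
    (h : ∀ i, (mfderiv 𝓘(ℝ, Euc k) 𝓘(ℝ, Euc (n + 1)) π z.pt (u i) : Euc (n + 1)) =
      mfderiv 𝓘(ℝ, Euc k) 𝓘(ℝ, Euc (n + 1)) π z.pt (u' i)) :
    z.form (Fin.cons v u) = z.form (Fin.cons v u') := by
  refine ContinuousAlternatingMap.eq_of_sub_mem (z.form.curryLeft v) (vert n k π z.pt) ?_ ?_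
  · rintro w ⟨i, hi⟩
    exact z.form_eq_zero (i := 0) (j := i.succ) (Fin.succ_ne_zero i).symm hv hi
  · intro i
    have := sub_eq_zero.2 (h i)
    exact (map_sub (mfderiv 𝓘(ℝ, Euc k) 𝓘(ℝ, Euc (n + 1)) π z.pt) (u i) (u' i)).trans this

theorem CotSection.mom_congr {A B : CotSection n k π τ} (h : A = B) (x : S) (v : Euc k)
    (hv : v ∈ vert n k π (A.field x)) (hv' : v ∈ vert n k π (B.field x)) :
    A.mom x ⟨v, hv⟩ = B.mom x ⟨v, hv'⟩ := by subst h; rfl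

/-- Testing the momenta on vectors of the model space avoids comparing linear maps whose domains are
vertical spaces over base points that are only propositionally equal. -/
theorem CotSection.ext_apply {A B : CotSection n k π τ} (h : ∀ x, A.field x = B.field x)
    (h' : ∀ (x : S) (v : Euc k) (hv : v ∈ vert n k π (A.field x))
      (hv' : v ∈ vert n k π (B.field x)) (w : Fin n → Euc n),
      A.mom x ⟨v, hv⟩ w = B.mom x ⟨v, hv'⟩ w) : A = B := by
  obtain ⟨a, _, _, m, _⟩ := A
  obtain ⟨b, _, _, m', _⟩ := B
  obtain rfl : a = b := funext h
  have : m = m' := by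
    funext x
    ext v w
    exact h' x v.1 v.2 v.2 w
  subst this
  rfl

variable (τ) in
/-- Two points of `Z` over `τ x` define the same value of `R_τ` at `x`. -/
def Multiphase.RelatedAt (x : S) (z z' : Multiphase n k π) : Prop :=
  z.pt = z'.pt ∧ ∀ v : Euc k, v ∈ vert n k π z.pt → ∀ (u : Fin n → Euc k) (w : Fin n → Euc n),
    (∀ i, (mfderiv 𝓘(ℝ, Euc k) 𝓘(ℝ, Euc (n + 1)) π z.pt (u i) : Euc (n + 1)) =
      mfderiv 𝓘(ℝ, Euc n) 𝓘(ℝ, Euc (n + 1)) τ x (w i)) →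
    z.form (Fin.cons v u) = z'.form (Fin.cons v u)

theorem Multiphase.RelatedAt.symm {x : S} {z z' : Multiphase n k π}
    (h : Multiphase.RelatedAt τ x z z') : Multiphase.RelatedAt τ x z' z :=
  ⟨h.1.symm, fun v hv u w hu => by
    rw [← h.1] at hv hu
    exact (h.2 v hv u w hu).symm⟩

theorem Multiphase.RelatedAt.trans {x : S} {z z' z'' : Multiphase n k π}
    (h : Multiphase.RelatedAt τ x z z') (h' : Multiphase.RelatedAt τ x z' z'') :
    Multiphase.RelatedAt τ x z z'' :=
  ⟨h.1.trans h'.1, fun v hv u w hu => by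
    refine (h.2 v hv u w hu).trans ?_
    rw [h.1] at hv hu
    exact h'.2 v hv u w hu⟩

theorem mfderiv_section (hπ : ContMDiff 𝓘(ℝ, Euc k) 𝓘(ℝ, Euc (n + 1)) ∞ π) {φ : S → Y}
    (hφ : ContMDiff 𝓘(ℝ, Euc n) 𝓘(ℝ, Euc k) ∞ φ) (h : ∀ x, π (φ x) = τ x) (x : S) (w : Euc n) :
    (mfderiv 𝓘(ℝ, Euc k) 𝓘(ℝ, Euc (n + 1)) π (φ x) (mfderiv 𝓘(ℝ, Euc n) 𝓘(ℝ, Euc k) φ x w) :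
      Euc (n + 1)) = mfderiv 𝓘(ℝ, Euc n) 𝓘(ℝ, Euc (n + 1)) τ x w := by
  have h1 : τ = π ∘ φ := funext fun x => (h x).symm
  have h2 := mfderiv_comp x (hπ.mdifferentiableAt (x := φ x) (by norm_num))
    (hφ.mdifferentiableAt (x := x) (by norm_num))
  subst h1
  exact (congrArg (fun L : Euc n →L[ℝ] Euc (n + 1) => L w) h2).symm

theorem ZSection.smooth_pt (σ : ZSection n k π τ) :
    ContMDiff 𝓘(ℝ, Euc n) 𝓘(ℝ, Euc k) ∞ fun x => (σ.toFun x).pt :=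
  contMDiffOn_univ.1 (Multiphase.pt_smooth σ.smooth)

/-- `R_τ` evaluates `σ x` on the particular lifts `Tφ w` of `Tτ w`, whereas `Multiphase.RelatedAt`
allows arbitrary lifts. Two lifts differ by vertical vectors, which do not matter once one argument
is vertical. The pointwise form of the relation no longer involves the derivative of the section. -/
theorem R_eq_iff (hπ : ContMDiff 𝓘(ℝ, Euc k) 𝓘(ℝ, Euc (n + 1)) ∞ π) (σ σ' : ZSection n k π τ) :
    R σ = R σ' ↔ ∀ x, Multiphase.RelatedAt τ x (σ.toFun x) (σ'.toFun x) := by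
  constructor
  · intro h x
    have hpt : ∀ y, (σ.toFun y).pt = (σ'.toFun y).pt :=
      fun y => congrFun (congrArg CotSection.field h) y
    refine ⟨hpt x, fun v hv u w hu => ?_⟩
    have hv' : v ∈ vert n k π (σ'.toFun x).pt := by rw [← hpt x]; exact hv
    have h1 := congrArg (fun α => α w) (CotSection.mom_congr h x v hv hv')
    refine (Multiphase.form_cons_congr _ hv fun i => ?_).trans
      (h1.trans (Multiphase.form_cons_congr _ hv' fun i => ?_))
    · exact (hu i).trans (mfderiv_section hπ σ.smooth_pt σ.covers x (w i)).symm
    · refine (mfderiv_section hπ σ'.smooth_pt σ'.covers x (w i)).trans ((hu i).symm.trans ?_)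
      rw [hpt x]
  · intro h
    have hpt : (fun y => (σ.toFun y).pt) = fun y => (σ'.toFun y).pt := funext fun y => (h y).1
    refine CotSection.ext_apply (fun x => (h x).1) fun x v hv hv' w => ?_
    refine ((h x).2 v hv _ w fun i => mfderiv_section hπ σ.smooth_pt σ.covers x (w i)).trans ?_
    refine Multiphase.form_cons_congr _ hv' fun i => ?_
    have h1 := mfderiv_section hπ σ.smooth_pt σ.covers x (w i)
    have h2 := mfderiv_section hπ σ'.smooth_pt σ'.covers x (w i)
    refine Eq.trans ?_ (h1.trans h2.symm)
    rw [(h x).1]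

theorem R_surjective (hπ : IsSubmersion 𝓘(ℝ, Euc k) 𝓘(ℝ, Euc (n + 1)) ∞ π)
    (hτ : IsImmersion 𝓘(ℝ, Euc n) 𝓘(ℝ, Euc (n + 1)) ∞ τ) [CompactSpace S] [T2Space S] :
    Function.Surjective (R : ZSection n k π τ → CotSection n k π τ) := by
  intro A
  obtain ⟨z, hz1, hz2, hz3⟩ := exists_lift hπ hτ contMDiff_id A.smooth_field A.covers A.smooth_mom
  refine ⟨⟨fun x => ⟨⟨A.field x, z x⟩, hz1 x⟩, A.covers, ?_⟩, ?_⟩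
  · exact Multiphase.smoothOn_of_apply isOpen_univ A.smooth_field.contMDiffOn
      fun W _ hW u hu => hz3 W hW u hu
  · refine CotSection.ext_apply (fun x => rfl) fun x v hv hv' w => ?_
    exact hz2 x ⟨v, hv⟩ _ w
      fun i => mfderiv_section hπ.contMDiff A.smooth_field A.covers x (w i)

/-- Here the lifting is done over `P × S`, which makes the lift jointly smooth in the parameter;
choosing preimages for each `p` separately would not. -/
theorem exists_family_lift (hπ : IsSubmersion 𝓘(ℝ, Euc k) 𝓘(ℝ, Euc (n + 1)) ∞ π)
    (hτ : IsImmersion 𝓘(ℝ, Euc n) 𝓘(ℝ, Euc (n + 1)) ∞ τ) [CompactSpace S] [T2Space S]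
    {P : Type} [NormedAddCommGroup P] [NormedSpace ℝ P] [FiniteDimensional ℝ P]
    {f : P → CotSection n k π τ} (hf : FieldSpace.IsFamily f) :
    ∃ F : P → ZSection n k π τ, FieldSpace.IsFamily F ∧ ∀ p, R (F p) = f p := by
  obtain ⟨z, hz1, hz2, hz3⟩ := exists_lift (I := 𝓘(ℝ, P).prod 𝓘(ℝ, Euc n)) (M := P × S)
    (b := fun q => q.2) hπ hτ contMDiff_snd hf.1 (fun q => (f q.1).covers q.2) hf.2
  have hz : Multiphase.SmoothOn (𝓘(ℝ, P).prod 𝓘(ℝ, Euc n))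
      (fun q : P × S => (⟨⟨(f q.1).field q.2, z q⟩, hz1 q⟩ : Multiphase n k π)) Set.univ :=
    Multiphase.smoothOn_of_apply isOpen_univ hf.1.contMDiffOn
      fun W _ hW u hu => hz3 W hW u hu
  refine ⟨fun p => ⟨fun x => ⟨⟨(f p).field x, z (p, x)⟩, hz1 (p, x)⟩, (f p).covers, ?_⟩, hz,
    fun p => ?_⟩
  · exact hz.comp (contMDiff_const.prodMk contMDiff_id).contMDiffOn fun _ _ => Set.mem_univ _
  · refine CotSection.ext_apply (fun x => rfl) fun x v hv hv' w => ?_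
    exact hz2 (p, x) ⟨v, hv⟩ _ w
      fun i => mfderiv_section hπ.contMDiff (f p).smooth_field (f p).covers x (w i)

end Sections

/-! ### The action of `𝒢_τ` on `𝒵_τ` and its smoothness. -/

section ActionOnSections

open LieGroupExp

variable {n k : ℕ} {X Y S : Type*}
  [TopologicalSpace X] [ChartedSpace (Euc (n + 1)) X] [IsManifold 𝓘(ℝ, Euc (n + 1)) ∞ X]
  [TopologicalSpace Y] [ChartedSpace (Euc k) Y] [IsManifold 𝓘(ℝ, Euc k) ∞ Y]
  [TopologicalSpace S] [ChartedSpace (Euc n) S] [IsManifold 𝓘(ℝ, Euc n) ∞ S]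
  {π : Y → X} {τ : S → X}
  {G 𝔤 : Type*} [Group G] [LieRing 𝔤] [LieAlgebra ℝ 𝔤] [TopologicalSpace 𝔤]
  [ContinuousSMul ℝ 𝔤] [LieGroupExp G 𝔤] [MulAction G X] [MulAction G (Multiphase n k π)]

theorem etaTau_eq (hτ : Function.Injective τ) {η : stab τ G} {x y : S} (h : τ y = η.1 • τ x) :
    etaTau η x = y := hτ ((tau_etaTau η x).trans h.symm)

theorem etaTau_mul (hτ : Function.Injective τ) (η η' : stab τ G) (x : S) :
    etaTau (η * η') x = etaTau η (etaTau η' x) :=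
  etaTau_eq hτ (by
    rw [tau_etaTau (τ := τ), tau_etaTau (τ := τ)]; exact (mul_smul _ _ _).symm)

theorem etaTau_one (hτ : Function.Injective τ) (x : S) : etaTau (1 : stab τ G) x = x :=
  etaTau_eq hτ (one_smul G _).symm

theorem etaTau_etaTau_inv (hτ : Function.Injective τ) (η : stab τ G) (x : S) :
    etaTau η (etaTau η⁻¹ x) = x := by
  rw [← etaTau_mul hτ, mul_inv_cancel, etaTau_one hτ]

theorem etaTau_inv_etaTau (hτ : Function.Injective τ) (η : stab τ G) (x : S) :
    etaTau η⁻¹ (etaTau η x) = x := by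
  rw [← etaTau_mul hτ, inv_mul_cancel, etaTau_one hτ]

variable (hτ : IsSmoothEmbedding 𝓘(ℝ, Euc n) 𝓘(ℝ, Euc (n + 1)) ∞ τ)
  (hG : ActsCanonically n k π G 𝔤)

theorem actZ_mul (η η' : stab τ G) (σ : ZSection n k π τ) :
    actZ hτ hG (η * η') σ = actZ hτ hG η (actZ hτ hG η' σ) := by
  refine ZSection.ext (funext fun x => ?_)
  change (η.1 * η'.1) • σ.toFun (etaTau (η * η')⁻¹ x) =
    η.1 • η'.1 • σ.toFun (etaTau η'⁻¹ (etaTau η⁻¹ x))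
  rw [mul_inv_rev, etaTau_mul hτ.isEmbedding.injective, mul_smul]

theorem actZ_one (σ : ZSection n k π τ) : actZ hτ hG 1 σ = σ := by
  refine ZSection.ext (funext fun x => ?_)
  change (1 : G) • σ.toFun (etaTau (1 : stab τ G)⁻¹ x) = _
  rw [inv_one, etaTau_one hτ.isEmbedding.injective, one_smul]

theorem exp_zero' : (exp (0 : 𝔤) : G) = 1 := by
  have h := exp_add_smul (G := G) 0 0 (0 : 𝔤)
  simpa using h

theorem exp_neg_smul (ξ : 𝔤) (t : ℝ) : (exp ((-t) • ξ) : G) = (exp (t • ξ))⁻¹ := by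
  have h := exp_add_smul (G := G) (-t) t ξ
  rw [neg_add_cancel, zero_smul, exp_zero'] at h
  exact eq_inv_of_mul_eq_one_left h.symm

/-- The flow on `S ≅ Σ_τ` of an element of `𝔤_τ` is smooth. -/
theorem etaTau_exp_inv_smooth (hτ : IsSmoothEmbedding 𝓘(ℝ, Euc n) 𝓘(ℝ, Euc (n + 1)) ∞ τ)
    (hG : ActsCanonically n k π G 𝔤) {𝔤τ : LieSubalgebra ℝ 𝔤} (h𝔤τ : IsLieAlgebraOf 𝔤τ (stab τ G))
    (ξ : 𝔤τ) : ContMDiff (𝓘(ℝ, ℝ).prod 𝓘(ℝ, Euc n)) 𝓘(ℝ, Euc n) ∞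
      (fun s : ℝ × S => etaTau (expτ h𝔤τ ξ s.1)⁻¹ s.2) := by
  have hcomp : τ ∘ (fun s : ℝ × S => etaTau (expτ h𝔤τ ξ s.1)⁻¹ s.2) =
      fun s : ℝ × S => (exp ((-s.1) • (ξ : 𝔤)) : G) • τ s.2 := by
    funext s
    refine (tau_etaTau (expτ h𝔤τ ξ s.1)⁻¹ s.2).trans ?_
    rw [exp_neg_smul]
    rfl
  have hneg : ContMDiff (𝓘(ℝ, ℝ).prod 𝓘(ℝ, Euc n)) 𝓘(ℝ, ℝ) ∞ (fun s : ℝ × S => -s.1) :=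
    (contDiff_neg (𝕜 := ℝ) (F := ℝ)).contMDiff.comp contMDiff_fst
  have hs : ContMDiff (𝓘(ℝ, ℝ).prod 𝓘(ℝ, Euc n)) 𝓘(ℝ, Euc (n + 1)) ∞
      (τ ∘ (fun s : ℝ × S => etaTau (expτ h𝔤τ ξ s.1)⁻¹ s.2)) := by
    rw [hcomp]
    exact (hG.smooth_exp_X (ξ : 𝔤)).comp (hneg.prodMk (hτ.contMDiff.comp contMDiff_snd))
  have hc : Continuous (fun s : ℝ × S => etaTau (expτ h𝔤τ ξ s.1)⁻¹ s.2) :=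
    hτ.isEmbedding.continuous_iff.2 hs.continuous
  intro s
  exact (ContMDiffAt.iff_comp_isImmersionAt (hτ.isImmersion.isImmersionAt _)).2
    ⟨hc.continuousAt, hs s⟩

variable [CompactSpace S] [T2Space S]

theorem smoothMap_actZ (η : stab τ G) :
    FieldSpace.SmoothMap (fun σ : ZSection n k π τ => actZ hτ hG η σ) := by
  intro P _ _ _ F hF
  have h1 : ContMDiff (𝓘(ℝ, P).prod 𝓘(ℝ, Euc n)) (𝓘(ℝ, P).prod 𝓘(ℝ, Euc n)) ∞
      (fun q : P × S => (q.1, etaTau η⁻¹ q.2)) :=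
    contMDiff_fst.prodMk ((etaTau_smooth hτ hG η⁻¹).comp contMDiff_snd)
  have h2 : Multiphase.SmoothOn (𝓘(ℝ, P).prod 𝓘(ℝ, Euc n))
      (fun q : P × S => (F q.1).toFun (etaTau η⁻¹ q.2)) Set.univ :=
    Multiphase.SmoothOn.comp hF h1.contMDiffOn fun _ _ => Set.mem_univ _
  exact (hG.smooth_Z η.1).smoothOn isOpen_univ h2

/-- Time enters twice, through the flow on `Z` and through the inverse flow on `S`; each is jointly
smooth, and the two are composed over `(ℝ × P) × S`. -/
theorem smoothFlow_actZ {𝔤τ : LieSubalgebra ℝ 𝔤} (h𝔤τ : IsLieAlgebraOf 𝔤τ (stab τ G)) :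
    FieldSpace.SmoothFlow
      (fun (ξ : 𝔤τ) t (σ : ZSection n k π τ) => actZ hτ hG (expτ h𝔤τ ξ t) σ) := by
  intro ξ P _ _ _ F hF
  have hs : ContMDiff (𝓘(ℝ, ℝ × P).prod 𝓘(ℝ, Euc n)) 𝓘(ℝ, ℝ) ∞
      (fun q : (ℝ × P) × S => q.1.1) := (contDiff_fst (𝕜 := ℝ)).contMDiff.comp contMDiff_fst
  have hp : ContMDiff (𝓘(ℝ, ℝ × P).prod 𝓘(ℝ, Euc n)) 𝓘(ℝ, P) ∞
      (fun q : (ℝ × P) × S => q.1.2) := (contDiff_snd (𝕜 := ℝ)).contMDiff.comp contMDiff_fst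
  have h1 : ContMDiff (𝓘(ℝ, ℝ × P).prod 𝓘(ℝ, Euc n)) (𝓘(ℝ, P).prod 𝓘(ℝ, Euc n)) ∞
      (fun q : (ℝ × P) × S => (q.1.2, etaTau (expτ h𝔤τ ξ q.1.1)⁻¹ q.2)) :=
    hp.prodMk ((etaTau_exp_inv_smooth hτ hG h𝔤τ ξ).comp (hs.prodMk contMDiff_snd))
  have h2 : Multiphase.SmoothOn (𝓘(ℝ, ℝ × P).prod 𝓘(ℝ, Euc n))
      (fun q : (ℝ × P) × S => (F q.1.2).toFun (etaTau (expτ h𝔤τ ξ q.1.1)⁻¹ q.2)) Set.univ :=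
    Multiphase.SmoothOn.comp hF h1.contMDiffOn fun _ _ => Set.mem_univ _
  exact Multiphase.SmoothOn.map_param (T := fun t z => (exp (t • (ξ : 𝔤)) : G) • z)
    (fun m U hU c f hc hf => hG.smooth_exp_Z (ξ : 𝔤) m U hU c f hc hf) isOpen_univ
    hs.contMDiffOn h2

end ActionOnSections

/-! ### Lines in the fibres of `R_τ`, and vanishing of the two-form on constant directions. -/

section Affine

variable {n k : ℕ} {X Y S : Type*}
  [TopologicalSpace X] [ChartedSpace (Euc (n + 1)) X] [IsManifold 𝓘(ℝ, Euc (n + 1)) ∞ X]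
  [TopologicalSpace Y] [ChartedSpace (Euc k) Y] [IsManifold 𝓘(ℝ, Euc k) ∞ Y]
  [TopologicalSpace S] [ChartedSpace (Euc n) S] [IsManifold 𝓘(ℝ, Euc n) ∞ S]
  {π : Y → X} {τ : S → X}

/-- The point `z + t (z' - z)` of `Z`, for `z` and `z'` over the same point of `Y`. -/
def Multiphase.lineMap (z z' : Multiphase n k π) (h : z.pt = z'.pt) (t : ℝ) : Multiphase n k π :=
  ⟨⟨z.pt, z.form + t • (z'.form - z.form)⟩, by
    rintro u ⟨i, j, hij, hi, hj⟩
    have h1 : z.form u = 0 := z.form_eq_zero hij hi hj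
    have h2 : z'.form u = 0 := z'.form_eq_zero hij (by rw [← h]; exact hi) (by rw [← h]; exact hj)
    change z.form u + t * (z'.form u - z.form u) = 0
    rw [h1, h2]
    ring⟩

theorem Multiphase.lineMap_form_apply (z z' : Multiphase n k π) (h : z.pt = z'.pt) (t : ℝ)
    (u : Fin (n + 1) → Euc k) :
    (z.lineMap z' h t).form u = z.form u + t * (z'.form u - z.form u) := rfl

theorem Multiphase.form_eq_of_eq {z z' : Multiphase n k π} (h : z.pt = z'.pt)
    (h' : z.form = z'.form) : z = z' := by
  obtain ⟨⟨y, α⟩, hz⟩ := z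
  obtain ⟨⟨y', α'⟩, hz'⟩ := z'
  obtain rfl : y = y' := h
  obtain rfl : α = α' := h'
  rfl

theorem Multiphase.lineMap_zero (z z' : Multiphase n k π) (h : z.pt = z'.pt) :
    z.lineMap z' h 0 = z :=
  Multiphase.form_eq_of_eq rfl (by
    ext u
    rw [Multiphase.lineMap_form_apply]
    ring)

theorem Multiphase.lineMap_one (z z' : Multiphase n k π) (h : z.pt = z'.pt) :
    z.lineMap z' h 1 = z' :=
  Multiphase.form_eq_of_eq h (by
    ext u
    rw [Multiphase.lineMap_form_apply]
    ring)

theorem Multiphase.RelatedAt.lineMap {x : S} {z z' : Multiphase n k π}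
    (h : Multiphase.RelatedAt τ x z z') (t : ℝ) :
    Multiphase.RelatedAt τ x z (z.lineMap z' h.1 t) :=
  ⟨rfl, fun v hv u w hu => by
    rw [Multiphase.lineMap_form_apply, ← h.2 v hv u w hu]
    ring⟩

theorem Multiphase.SmoothOn.lineMap {E H M : Type*} [NormedAddCommGroup E] [NormedSpace ℝ E]
    [TopologicalSpace H] {I : ModelWithCorners ℝ E H} [TopologicalSpace M] [ChartedSpace H M]
    {f f' : M → Multiphase n k π} {U : Set M} (hU : IsOpen U) (hf : Multiphase.SmoothOn I f U)
    (hf' : Multiphase.SmoothOn I f' U) (h : ∀ m, (f m).pt = (f' m).pt) {c : M → ℝ}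
    (hc : ContMDiffOn I 𝓘(ℝ, ℝ) ∞ c U) :
    Multiphase.SmoothOn I (fun m => (f m).lineMap (f' m) (h m) (c m)) U := by
  have hpt : ContMDiffOn I 𝓘(ℝ, Euc k) ∞
      (fun m => (f m).pt) U := Multiphase.pt_smooth hf
  refine Multiphase.smoothOn_of_apply hU hpt fun W hWU hW u hu => ?_
  have hW1 : Multiphase.SmoothOn I f W := ContMDiffOn.mono hf hWU
  have hW2 : Multiphase.SmoothOn I f' W := ContMDiffOn.mono hf' hWU
  have h1 := Multiphase.form_apply_smooth hW1 u hu
  have h2 := Multiphase.form_apply_smooth hW2 u fun i =>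
    (hu i).congr fun m _ => tangentBundle_mk_eq (h m).symm _
  exact h1.add ((hc.mono hWU).mul (h2.sub h1))

variable [CompactSpace S] [T2Space S]

/-- The relation characterizing the fibres is affine in the form, so the pointwise segment joins the
two sections without leaving the fibre. This connectedness lets a derivative along families detect
constancy on fibres. -/
theorem exists_isFamily_joining (hπ : ContMDiff 𝓘(ℝ, Euc k) 𝓘(ℝ, Euc (n + 1)) ∞ π)
    {σ σ' : ZSection n k π τ} (h : R σ = R σ') :
    ∃ F : ℝ → ZSection n k π τ, FieldSpace.IsFamily F ∧ F 0 = σ ∧ F 1 = σ' ∧ ∀ t, R (F t) = R σ := by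
  have hr := (R_eq_iff hπ σ σ').1 h
  have hF : Multiphase.SmoothOn (𝓘(ℝ, ℝ).prod 𝓘(ℝ, Euc n))
      (fun q : ℝ × S => (σ.toFun q.2).lineMap (σ'.toFun q.2) (hr q.2).1 q.1) Set.univ :=
    Multiphase.SmoothOn.lineMap isOpen_univ
      (σ.smooth.comp contMDiff_snd.contMDiffOn fun _ _ => Set.mem_univ _)
      (σ'.smooth.comp contMDiff_snd.contMDiffOn fun _ _ => Set.mem_univ _)
      _ contMDiff_fst.contMDiffOn
  refine ⟨fun t => ⟨fun x => (σ.toFun x).lineMap (σ'.toFun x) (hr x).1 t, σ.covers, ?_⟩, hF,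
    ?_, ?_, fun t => ?_⟩
  · exact hF.comp (contMDiff_const.prodMk contMDiff_id).contMDiffOn fun _ _ => Set.mem_univ _
  · exact ZSection.ext (funext fun x => Multiphase.lineMap_zero _ _ (hr x).1)
  · exact ZSection.ext (funext fun x => Multiphase.lineMap_one _ _ (hr x).1)
  · exact ((R_eq_iff hπ _ _).2 fun x => (hr x).lineMap t).symm

/-- No regularity of `g` is required: where the composite fails to be differentiable, `fderiv` is
zero by convention. -/
theorem fderiv_comp_fst_apply {P Q : Type*} [NormedAddCommGroup P] [NormedSpace ℝ P]
    [NormedAddCommGroup Q] [NormedSpace ℝ Q] (g : P → ℝ) (q : P × Q) (a : Q) :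
    fderiv ℝ (fun s : P × Q => g s.1) q (0, a) = 0 := by
  by_cases h : DifferentiableAt ℝ (fun s : P × Q => g s.1) q
  · have h1 : HasFDerivAt (fun b : Q => (q.1, b)) (ContinuousLinearMap.inr ℝ P Q) q.2 :=
      hasFDerivAt_prodMk_right q.1 q.2
    have h2 := (h.hasFDerivAt (x := (q.1, q.2))).comp q.2 h1
    have h3 : HasFDerivAt (fun _ : Q => g q.1) (0 : Q →L[ℝ] ℝ) q.2 := hasFDerivAt_const _ _
    exact congrArg (fun L => L a) (h2.unique h3)
  · rw [fderiv_zero_of_not_differentiableAt h]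
    rfl

theorem integralForm_zero : integralForm (n := n) (S := S) (fun _ => 0) = 0 := by
  have h (v : Fin n → Euc n) : (0 : Euc n [⋀^Fin n]→L[ℝ] ℝ) v = 0 := rfl
  simp only [integralForm]
  refine finsum_eq_zero_of_forall_eq_zero fun c => ?_
  refine (MeasureTheory.setIntegral_congr_fun (chartAt (Euc n) c).open_target.measurableSet
    fun y _ => ?_).trans (MeasureTheory.integral_zero _ _)
  exact (congrArg _ (h _)).trans (mul_zero _)

/-- The two-form vanishes on directions in which a family is constant. -/
theorem twoForm_comp_fst {P Q : Type} [NormedAddCommGroup P] [NormedSpace ℝ P]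
    [NormedAddCommGroup Q] [NormedSpace ℝ Q] {f : P → CotSection n k π τ}
    (hf : ContMDiff (𝓘(ℝ, P).prod 𝓘(ℝ, Euc n)) 𝓘(ℝ, Euc k) ∞ (fun q : P × S => (f q.1).field q.2))
    (q : P × Q) (a : P) (b : Q) :
    FieldSpace.twoForm (fun s : P × Q => f s.1) q (a, 0) (0, b) = 0 := by
  have hvar : ∀ (s c : P × Q) (x : S), CotSection.variation (fun s : P × Q => f s.1) s c x =
      CotSection.variation f s.1 c.1 x := by
    intro s c x
    apply Subtype.ext
    have h1 : MDifferentiableAt 𝓘(ℝ, P) 𝓘(ℝ, Euc k) (fun p => (f p).field x) s.1 :=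
      (hf.comp (contMDiff_id.prodMk contMDiff_const)).mdifferentiableAt (by norm_num)
    have h2 : MDifferentiableAt 𝓘(ℝ, P × Q) 𝓘(ℝ, P) (Prod.fst : P × Q → P) s :=
      differentiableAt_fst.mdifferentiableAt
    have h3 := mfderiv_comp s h1 h2
    have h4 : mfderiv 𝓘(ℝ, P × Q) 𝓘(ℝ, P) (Prod.fst : P × Q → P) s =
        ContinuousLinearMap.fst ℝ P Q := by
      rw [mfderiv_eq_fderiv, fderiv_fst]
    rw [h4] at h3
    exact congrArg (fun L : P × Q →L[ℝ] Euc k => L c) h3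
  have hone : ∀ s c : P × Q, FieldSpace.oneForm (fun s : P × Q => f s.1) s c =
      FieldSpace.oneForm f s.1 c.1 := by
    intro s c
    change integralForm _ = integralForm _
    simp only [hvar]
  have hzero : ∀ p, FieldSpace.oneForm f p 0 = 0 := by
    intro p
    refine Eq.trans ?_ (integralForm_zero (n := n) (S := S))
    change integralForm _ = integralForm _
    congr 1
    funext x
    have : CotSection.variation f p 0 x = 0 := Subtype.ext (map_zero _)
    rw [this, map_zero]
  -- Of the two derivatives in the two-form, one is of the one-form evaluated at the zero vector,
  -- and the other is of a function of the first factor in the direction of the second.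
  simp only [FieldSpace.twoForm, hone, hzero]
  have h1 := fderiv_comp_fst_apply (P := P) (Q := Q) (fun p => FieldSpace.oneForm f p a) q b
  rw [h1]
  simp

end Affine

/-! ### `Θ` and `Ω` in adapted coordinates. -/

section Coordinates

variable {n k : ℕ} {X Y : Type*}
  [TopologicalSpace X] [ChartedSpace (Euc (n + 1)) X] [IsManifold 𝓘(ℝ, Euc (n + 1)) ∞ X]
  [TopologicalSpace Y] [ChartedSpace (Euc k) Y] [IsManifold 𝓘(ℝ, Euc k) ∞ Y]
  {π : Y → X}
  {Q : Type*} [NormedAddCommGroup Q] [NormedSpace ℝ Q] {U : Set Q}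

namespace AdaptedChart

variable (A : AdaptedChart n (k := k) π)

/-- The base point of `z` in an adapted chart. -/
def coordPt (z : Multiphase n k π) : Euc k := A.chart z.pt

/-- The form `z` in an adapted chart. -/
def coordForm (z : Multiphase n k π) : Euc k [⋀^Fin (n + 1)]→L[ℝ] ℝ :=
  z.form.compContinuousLinearMap (A.dSymm z.pt)

theorem coordForm_apply (z : Multiphase n k π) (u : Fin (n + 1) → Euc k) :
    A.coordForm z u = z.form fun i => A.dSymm z.pt (u i) := rfl

theorem coordForm_eq_zero {z : Multiphase n k π} (hz : z.pt ∈ A.chart.source)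
    {u : Fin (n + 1) → Euc k} {i j : Fin (n + 1)} (hij : i ≠ j) (hi : A.T (u i) = u i)
    (hj : A.T (u j) = u j) : A.coordForm z u = 0 := by
  refine z.form_eq_zero hij ?_ ?_
  · rw [← hi]; exact A.dSymm_mem_vert hz _
  · rw [← hj]; exact A.dSymm_mem_vert hz _

section Smooth

variable {E H M : Type*} [NormedAddCommGroup E] [NormedSpace ℝ E]
    [TopologicalSpace H] {I : ModelWithCorners ℝ E H} [TopologicalSpace M] [ChartedSpace H M]

theorem contMDiffOn_coordPt {f : M → Multiphase n k π} {U : Set M}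
    (hf : Multiphase.SmoothOn I f U) (hU : ∀ m ∈ U, (f m).pt ∈ A.chart.source) :
    ContMDiffOn I 𝓘(ℝ, Euc k) ∞ (fun m => A.coordPt (f m)) U :=
  (contMDiffOn_of_mem_maximalAtlas A.mem_maximalAtlas).comp (Multiphase.pt_smooth hf) hU

theorem contMDiffOn_coordForm {f : M → Multiphase n k π} {U : Set M}
    (hf : Multiphase.SmoothOn I f U) (hU : ∀ m ∈ U, (f m).pt ∈ A.chart.source) :
    ContMDiffOn I 𝓘(ℝ, Euc k [⋀^Fin (n + 1)]→L[ℝ] ℝ) ∞ (fun m => A.coordForm (f m)) U :=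
  fun m hm => contMDiffWithinAt_alternating_of_apply fun v =>
    Multiphase.form_apply_smooth hf (fun i m => A.dSymm (f m).pt (v i))
      (fun _ => A.contMDiffOn_dSymm (Multiphase.pt_smooth hf) contMDiffOn_const hU) m hm

/-- The point of `Z` with given coordinates. -/
def ofCoord (y : Euc k) (α : Euc k [⋀^Fin (n + 1)]→L[ℝ] ℝ) (hy : y ∈ A.chart.target)
    (hα : ∀ u : Fin (n + 1) → Euc k, (∃ i j, i ≠ j ∧ A.T (u i) = u i ∧ A.T (u j) = u j) → α u = 0) :
    Multiphase n k π :=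
  ⟨⟨A.chart.symm y, α.compContinuousLinearMap (A.d (A.chart.symm y))⟩, by
    rintro u ⟨i, j, hij, hi, hj⟩
    have hy' := A.chart.map_target hy
    exact hα _ ⟨i, j, hij, (A.mem_vert hy').1 hi, (A.mem_vert hy').1 hj⟩⟩

theorem smoothOn_of_coord {f : M → Multiphase n k π} {U : Set M} (hU : IsOpen U) {y : M → Euc k}
    {α : M → Euc k [⋀^Fin (n + 1)]→L[ℝ] ℝ} (hy : ContMDiffOn I 𝓘(ℝ, Euc k) ∞ y U)
    (hα : ContMDiffOn I 𝓘(ℝ, Euc k [⋀^Fin (n + 1)]→L[ℝ] ℝ) ∞ α U)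
    (hyU : ∀ m ∈ U, y m ∈ A.chart.target) (hfy : ∀ m ∈ U, (f m).pt = A.chart.symm (y m))
    (hfα : ∀ m ∈ U, ∀ u, (f m).form u = α m fun i => A.d (f m).pt (u i)) :
    Multiphase.SmoothOn I f U := by
  have hpt : ContMDiffOn I 𝓘(ℝ, Euc k) ∞ (fun m => (f m).pt) U :=
    ((contMDiffOn_symm_of_mem_maximalAtlas A.mem_maximalAtlas).comp hy hyU).congr hfy
  refine Multiphase.smoothOn_of_apply hU hpt fun W hWU hW u hu => ?_
  refine ContMDiffOn.congr ?_ fun m hm => hfα m (hWU hm) _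
  refine (hα.mono hWU).alternating_apply fun i => ?_
  exact (A.contMDiffOn_d (hu i) fun m hm => by
    rw [hfy m (hWU hm)]; exact A.chart.map_target (hyU m (hWU hm))).2

end Smooth

theorem mfderiv_pt {f : Q → Multiphase n k π} (hU : IsOpen U)
    (hf : Multiphase.SmoothOn 𝓘(ℝ, Q) f U) (hfU : ∀ q ∈ U, (f q).pt ∈ A.chart.source) {q : Q}
    (hq : q ∈ U) (v : Q) :
    (A.dSymm (f q).pt (fderiv ℝ (fun q => A.coordPt (f q)) q v) : Euc k) =
      mfderiv 𝓘(ℝ, Q) 𝓘(ℝ, Euc k) (fun q => (f q).pt) q v := by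
  have hpt : MDifferentiableAt 𝓘(ℝ, Q) 𝓘(ℝ, Euc k) (fun q => (f q).pt) q :=
    ((Multiphase.pt_smooth hf).contMDiffAt (hU.mem_nhds hq)).mdifferentiableAt (by norm_num)
  have h1 := mfderiv_comp q (g := A.chart) ((mdifferentiable_of_mem_maximalAtlas
    A.mem_maximalAtlas).mdifferentiableAt (hfU q hq)) hpt
  rw [mfderiv_eq_fderiv] at h1
  have h2 := congrArg (fun L : Q →L[ℝ] Euc k => A.dSymm (f q).pt (L v)) h1
  exact h2.trans (A.dSymm_d (hfU q hq) _)

theorem pullTheta_eq {f : Q → Multiphase n k π} (hU : IsOpen U)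
    (hf : Multiphase.SmoothOn 𝓘(ℝ, Q) f U) (hfU : ∀ q ∈ U, (f q).pt ∈ A.chart.source) {q : Q}
    (hq : q ∈ U) :
    Multiphase.pullTheta f q = (A.coordForm (f q)).compContinuousLinearMap
      (fderiv ℝ (fun q => A.coordPt (f q)) q) := by
  ext v
  change (f q).form (fun i => _) = (f q).form (fun i => _)
  congr 1
  funext i
  exact (A.mfderiv_pt hU hf hfU hq (v i)).symm

theorem contDiffAt_coordPt {f : Q → Multiphase n k π} (hU : IsOpen U)
    (hf : Multiphase.SmoothOn 𝓘(ℝ, Q) f U) (hfU : ∀ q ∈ U, (f q).pt ∈ A.chart.source) {q : Q}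
    (hq : q ∈ U) : ContDiffAt ℝ ∞ (fun q => A.coordPt (f q)) q :=
  (A.contMDiffOn_coordPt hf hfU).contDiffOn.contDiffAt (hU.mem_nhds hq)

theorem contDiffAt_coordForm {f : Q → Multiphase n k π} (hU : IsOpen U)
    (hf : Multiphase.SmoothOn 𝓘(ℝ, Q) f U) (hfU : ∀ q ∈ U, (f q).pt ∈ A.chart.source) {q : Q}
    (hq : q ∈ U) : ContDiffAt ℝ ∞ (fun q => A.coordForm (f q)) q :=
  (A.contMDiffOn_coordForm hf hfU).contDiffOn.contDiffAt (hU.mem_nhds hq)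

theorem differentiableAt_pullTheta {f : Q → Multiphase n k π} (hU : IsOpen U)
    (hf : Multiphase.SmoothOn 𝓘(ℝ, Q) f U) (hfU : ∀ q ∈ U, (f q).pt ∈ A.chart.source) {q : Q}
    (hq : q ∈ U) : DifferentiableAt ℝ (Multiphase.pullTheta f) q := by
  have h1 := (A.contDiffAt_coordForm hU hf hfU hq).differentiableAt (by norm_num)
  have h2 : DifferentiableAt ℝ (fderiv ℝ (fun q => A.coordPt (f q))) q :=
    ((A.contDiffAt_coordPt hU hf hfU hq).fderiv_right (m := 1)
      (by norm_cast)).differentiableAt (by norm_num)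
  refine (h1.continuousAlternatingMapCompContinuousLinearMap h2).congr_of_eventuallyEq ?_
  filter_upwards [hU.mem_nhds hq] with p hp
  exact A.pullTheta_eq hU hf hfU hp

/-- The product rule gives one term differentiating the form and one differentiating the derivative
of the base point. The latter alternates to zero because second derivatives are symmetric. What
remains is the coordinate expression of `dΘ`. -/
theorem extDeriv_pullTheta_apply {f : Q → Multiphase n k π} (hU : IsOpen U)
    (hf : Multiphase.SmoothOn 𝓘(ℝ, Q) f U) (hfU : ∀ q ∈ U, (f q).pt ∈ A.chart.source) {q : Q}
    (hq : q ∈ U) (v : Fin (n + 2) → Q) :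
    extDeriv (Multiphase.pullTheta f) q v = ∑ i : Fin (n + 2), (-1 : ℝ) ^ (i : ℕ) *
      fderiv ℝ (fun q => A.coordForm (f q)) q (v i)
        fun j => fderiv ℝ (fun q => A.coordPt (f q)) q (v (i.succAbove j)) := by
  have hpt := A.contDiffAt_coordPt hU hf hfU hq
  have h1 := (A.contDiffAt_coordForm hU hf hfU hq).differentiableAt (by norm_num)
  have h2 : DifferentiableAt ℝ (fderiv ℝ (fun q => A.coordPt (f q))) q :=
    (hpt.fderiv_right (m := 1) (by norm_cast)).differentiableAt (by norm_num)
  have h3 : Multiphase.pullTheta f =ᶠ[𝓝 q] fun q =>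
      (A.coordForm (f q)).compContinuousLinearMap (fderiv ℝ (fun q => A.coordPt (f q)) q) := by
    filter_upwards [hU.mem_nhds hq] with p hp
    exact A.pullTheta_eq hU hf hfU hp
  have hsymm : IsSymmSndFDerivAt ℝ (fun q => A.coordPt (f q)) q :=
    hpt.isSymmSndFDerivAt (by
      rw [minSmoothness_of_isRCLikeNormedField]; exact WithTop.coe_le_coe.2 le_top)
  rw [h3.extDeriv_eq, extDeriv, fderiv_continuousAlternatingMapCompContinuousLinearMap h1 h2,
    ContinuousAlternatingMap.alternatizeUncurryFin_add,
    ContinuousAlternatingMap.alternatizeUncurryFin_fderivCompContinuousLinearMap_eq_zero _ _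
      (fun x y => hsymm x y), add_zero, ContinuousAlternatingMap.alternatizeUncurryFin_apply]
  refine Finset.sum_congr rfl fun i _ => ?_
  have hz (r : ℝ) : ((-1 : ℤ) ^ (i : ℕ)) • r = (-1 : ℝ) ^ (i : ℕ) * r := by
    rw [zsmul_eq_mul]; push_cast; rfl
  exact hz _

/-- In an adapted chart the vertical space is the range of a fixed `T`, so the defining condition of
`Z` is a constant linear condition on the coordinate form and passes to derivatives. -/
theorem fderiv_coordForm_eq_zero {f : Q → Multiphase n k π} (hU : IsOpen U)
    (hf : Multiphase.SmoothOn 𝓘(ℝ, Q) f U) (hfU : ∀ q ∈ U, (f q).pt ∈ A.chart.source) {q : Q}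
    (hq : q ∈ U) (w : Q) {u : Fin (n + 1) → Euc k} {i j : Fin (n + 1)} (hij : i ≠ j)
    (hi : A.T (u i) = u i) (hj : A.T (u j) = u j) :
    fderiv ℝ (fun q => A.coordForm (f q)) q w u = 0 := by
  have h1 := (A.contDiffAt_coordForm hU hf hfU hq).differentiableAt (by norm_num)
  have h2 : fderiv ℝ (fun q => A.coordForm (f q) u) q w = 0 := by
    have : (fun q => A.coordForm (f q) u) =ᶠ[𝓝 q] fun _ => 0 := by
      filter_upwards [hU.mem_nhds hq] with p hp
      exact A.coordForm_eq_zero (hfU p hp) hij hi hj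
    rw [this.fderiv_eq]
    simp
  rwa [fderiv_continuousAlternatingMap_apply_const_apply h1] at h2

/-- The value of `f^*Ω` on two vectors that are mapped to vertical vectors, in coordinates. -/
theorem pullOmega_cons_cons {f : Q → Multiphase n k π} (hU : IsOpen U)
    (hf : Multiphase.SmoothOn 𝓘(ℝ, Q) f U) (hfU : ∀ q ∈ U, (f q).pt ∈ A.chart.source) {q : Q}
    (hq : q ∈ U) {a b : Q} (w : Fin n → Q)
    (ha : A.T (fderiv ℝ (fun q => A.coordPt (f q)) q a) = fderiv ℝ (fun q => A.coordPt (f q)) q a)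
    (hb : A.T (fderiv ℝ (fun q => A.coordPt (f q)) q b) = fderiv ℝ (fun q => A.coordPt (f q)) q b) :
    Multiphase.pullOmega f q (Fin.cons a (Fin.cons b w)) =
      fderiv ℝ (fun q => A.coordForm (f q)) q b
        (Fin.cons (fderiv ℝ (fun q => A.coordPt (f q)) q a)
          fun i => fderiv ℝ (fun q => A.coordPt (f q)) q (w i)) -
      fderiv ℝ (fun q => A.coordForm (f q)) q a
        (Fin.cons (fderiv ℝ (fun q => A.coordPt (f q)) q b)
          fun i => fderiv ℝ (fun q => A.coordPt (f q)) q (w i)) := by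
  change -extDeriv (Multiphase.pullTheta f) q _ = _
  rw [A.extDeriv_pullTheta_apply hU hf hfU hq, Fin.sum_univ_succ, Fin.sum_univ_succ,
    Finset.sum_eq_zero]
  · have e0 : (fun j => fderiv ℝ (fun q => A.coordPt (f q)) q
        ((Fin.cons a (Fin.cons b w) : Fin (n + 2) → Q) ((0 : Fin (n + 2)).succAbove j))) =
        Fin.cons (fderiv ℝ (fun q => A.coordPt (f q)) q b)
          fun i => fderiv ℝ (fun q => A.coordPt (f q)) q (w i) := by
      funext j
      refine Fin.cases ?_ (fun l => ?_) j <;> simp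
    have e1 : (fun j => fderiv ℝ (fun q => A.coordPt (f q)) q
        ((Fin.cons a (Fin.cons b w) : Fin (n + 2) → Q) ((Fin.succ 0 : Fin (n + 2)).succAbove j))) =
        Fin.cons (fderiv ℝ (fun q => A.coordPt (f q)) q a)
          fun i => fderiv ℝ (fun q => A.coordPt (f q)) q (w i) := by
      funext j
      refine Fin.cases ?_ (fun l => ?_) j <;> simp
    rw [e0, e1]
    simp only [Fin.cons_zero, Fin.cons_succ, Fin.val_zero, Fin.val_succ, pow_zero, zero_add,
      pow_one]
    ring
  · intro i _
    have h0 : ((i.succ.succ : Fin (n + 2)).succAbove 0) = 0 := by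
      simp
    -- When the differentiating vector is neither `a` nor `b`, both remain among the arguments of
    -- the form, which vanishes on two vertical vectors.
    have h1 : ∃ l : Fin (n + 1), l ≠ 0 ∧ (i.succ.succ : Fin (n + 2)).succAbove l = 1 := by
      obtain ⟨l, hl⟩ := Fin.exists_succAbove_eq (x := (1 : Fin (n + 2))) (y := i.succ.succ)
        (fun h => by
          rw [← Fin.succ_zero_eq_one] at h
          exact Fin.succ_ne_zero i (Fin.succ_injective _ h).symm)
      refine ⟨l, fun h => ?_, hl⟩
      rw [h, h0] at hl
      exact zero_ne_one hl
    obtain ⟨l, hl0, hl⟩ := h1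
    rw [A.fderiv_coordForm_eq_zero hU hf hfU hq _ hl0, mul_zero]
    · rw [hl]; exact hb
    · rw [h0]; exact ha

end AdaptedChart

/-- The value of `f^*Ω` on two vectors that are mapped to vertical vectors everywhere. -/
theorem pullOmega_cons_cons_of_forall {f : Q → Multiphase n k π}
    {q : Q} (hd : DifferentiableAt ℝ (Multiphase.pullTheta f) q) {a b : Q}
    (hab : ∀ᶠ p in 𝓝 q, ∀ u : Fin (n + 1) → Q, (∃ i j, i ≠ j ∧ u i = a ∧ u j = b) →
      Multiphase.pullTheta f p u = 0) (w : Fin n → Q) :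
    Multiphase.pullOmega f q (Fin.cons a (Fin.cons b w)) =
      -(fderiv ℝ (fun p => Multiphase.pullTheta f p (Fin.cons b w)) q a -
        fderiv ℝ (fun p => Multiphase.pullTheta f p (Fin.cons a w)) q b) := by
  change -extDeriv (Multiphase.pullTheta f) q _ = _
  rw [extDeriv_apply hd, Fin.sum_univ_succ, Fin.sum_univ_succ, Finset.sum_eq_zero]
  · have e0 : (0 : Fin (n + 2)).removeNth (Fin.cons a (Fin.cons b w) : Fin (n + 2) → Q) =
        Fin.cons b w := by
      funext j
      refine Fin.cases ?_ (fun l => ?_) j <;> simp [Fin.removeNth]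
    have e1 : (Fin.succ 0 : Fin (n + 2)).removeNth (Fin.cons a (Fin.cons b w) : Fin (n + 2) → Q) =
        Fin.cons a w := by
      funext j
      refine Fin.cases ?_ (fun l => ?_) j <;> simp [Fin.removeNth]
    rw [e0, e1]
    simp only [Fin.cons_zero, Fin.cons_succ, Fin.val_zero, Fin.val_succ, pow_zero, zero_add,
      pow_one]
    simp only [one_smul, neg_smul]
    ring
  · intro i _
    have h0 : ((i.succ.succ : Fin (n + 2)).succAbove 0) = 0 := by
      simp
    have h1 : ∃ l : Fin (n + 1), l ≠ 0 ∧ (i.succ.succ : Fin (n + 2)).succAbove l = 1 := by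
      obtain ⟨l, hl⟩ := Fin.exists_succAbove_eq (x := (1 : Fin (n + 2))) (y := i.succ.succ)
        (fun h => by
          rw [← Fin.succ_zero_eq_one] at h
          exact Fin.succ_ne_zero i (Fin.succ_injective _ h).symm)
      refine ⟨l, fun h => ?_, hl⟩
      rw [h, h0] at hl
      exact zero_ne_one hl
    obtain ⟨l, hl0, hl⟩ := h1
    have h2 : (fun p => Multiphase.pullTheta f p
        (i.succ.succ.removeNth (Fin.cons a (Fin.cons b w) : Fin (n + 2) → Q))) =ᶠ[𝓝 q]
        fun _ => 0 := by
      filter_upwards [hab] with p hp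
      refine hp _ ⟨0, l, hl0.symm, ?_, ?_⟩
      · simp only [Fin.removeNth, h0, Fin.cons_zero]
      · simp only [Fin.removeNth, hl]
        rfl
    rw [h2.fderiv_eq]
    simp

/-- A canonical transformation preserves the pull-backs of `Ω` to arbitrary parameter spaces. -/
theorem Multiphase.PreservesOmega.pullOmega_eq [FiniteDimensional ℝ Q]
    {Φ : Multiphase n k π → Multiphase n k π} (hΦ : Multiphase.PreservesOmega Φ)
    (hΦs : Multiphase.SmoothMap Φ) (hπ : IsSubmersion 𝓘(ℝ, Euc k) 𝓘(ℝ, Euc (n + 1)) ∞ π)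
    {f : Q → Multiphase n k π} (hU : IsOpen U) (hf : Multiphase.SmoothOn 𝓘(ℝ, Q) f U) {q : Q}
    (hq : q ∈ U) : Multiphase.pullOmega (fun p => Φ (f p)) q = Multiphase.pullOmega f q := by
  -- `PreservesOmega` tests parameter spaces `Euc m` only; `d` commutes with pull-back along a
  -- linear isomorphism, so any finite-dimensional `Q` will do.
  let L : Q ≃L[ℝ] Euc (Module.finrank ℝ Q) := toEuclidean
  have key : ∀ g : Q → Multiphase n k π, Multiphase.SmoothOn 𝓘(ℝ, Q) g U →
      Multiphase.pullOmega (fun p => g (L.symm p)) (L q) =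
        (Multiphase.pullOmega g q).compContinuousLinearMap
          (L.symm : Euc (Module.finrank ℝ Q) →L[ℝ] Q) := by
    intro g hg
    obtain ⟨A, hA⟩ := exists_adaptedChart hπ (g q).pt
    have hpt := Multiphase.pt_smooth hg
    have hV : IsOpen (U ∩ (fun p => (g p).pt) ⁻¹' A.chart.source) :=
      hpt.continuousOn.isOpen_inter_preimage hU A.chart.open_source
    have hd : DifferentiableAt ℝ (Multiphase.pullTheta g) (L.symm (L q)) := by
      rw [L.symm_apply_apply]
      exact A.differentiableAt_pullTheta hV (ContMDiffOn.mono hg Set.inter_subset_left)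
        (fun p hp => hp.2) ⟨hq, hA⟩
    have h1 : Multiphase.pullTheta (fun p => g (L.symm p)) =ᶠ[𝓝 (L q)] fun p =>
        (Multiphase.pullTheta g (L.symm p)).compContinuousLinearMap
          (fderiv ℝ (fun p => L.symm p) p) := by
      have hU' : IsOpen (L.symm ⁻¹' U) := hU.preimage L.symm.continuous
      filter_upwards [hU'.mem_nhds (show L q ∈ L.symm ⁻¹' U by simpa using hq)] with p hp
      have h2 := mfderiv_comp p (g := fun p => (g p).pt) (f := fun p => L.symm p)
        ((hpt.contMDiffAt (hU.mem_nhds hp)).mdifferentiableAt (by norm_num))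
        L.symm.differentiableAt.mdifferentiableAt
      rw [mfderiv_eq_fderiv (f := fun p => L.symm p)] at h2
      ext v
      change (g (L.symm p)).form (fun i => _) = (g (L.symm p)).form (fun i => _)
      congr 1
      funext i
      exact congrArg (fun M : Euc (Module.finrank ℝ Q) →L[ℝ] Euc k => M (v i)) h2
    have h3 := extDeriv_pullback (r := ∞) hd (f := fun p => L.symm p)
      L.symm.contDiff.contDiffAt (by
      rw [minSmoothness_of_isRCLikeNormedField]; exact WithTop.coe_le_coe.2 le_top)
    rw [Multiphase.pullOmega, h1.extDeriv_eq, h3, L.symm.fderiv, L.symm_apply_apply]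
    rfl
  have hΦf : Multiphase.SmoothOn 𝓘(ℝ, Q) (fun p => Φ (f p)) U := hΦs.smoothOn hU hf
  have hfL : Multiphase.SmoothOn 𝓘(ℝ, Euc (Module.finrank ℝ Q)) (fun p => f (L.symm p))
      (L.symm ⁻¹' U) := hf.comp L.symm.contDiff.contMDiff.contMDiffOn fun _ hp => hp
  have h := hΦ _ _ (hU.preimage L.symm.continuous) _ hfL (L q)
    (show L.symm (L q) ∈ U by simpa using hq)
  rw [key _ hf, key _ hΦf] at h
  ext v
  have h4 := congrArg (fun α => α fun i => L (v i)) h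
  have e : ((L.symm : Euc (Module.finrank ℝ Q) →L[ℝ] Q) ∘ fun i => L (v i)) = v := by
    funext i
    exact L.symm_apply_apply (v i)
  simpa only [ContinuousAlternatingMap.compContinuousLinearMap_apply, e] using h4

end Coordinates

/-! ### Invariance of `Ω` applied to a line in a fibre. -/

section CanonicalLine

open LieGroupExp

variable {n k : ℕ} {X Y S : Type*}
  [TopologicalSpace X] [ChartedSpace (Euc (n + 1)) X] [IsManifold 𝓘(ℝ, Euc (n + 1)) ∞ X]
  [TopologicalSpace Y] [ChartedSpace (Euc k) Y] [IsManifold 𝓘(ℝ, Euc k) ∞ Y]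
  [TopologicalSpace S] [ChartedSpace (Euc n) S] [IsManifold 𝓘(ℝ, Euc n) ∞ S]
  {π : Y → X} {τ : S → X}
  {G 𝔤 : Type*} [Group G] [LieRing 𝔤] [LieAlgebra ℝ 𝔤] [TopologicalSpace 𝔤]
  [ContinuousSMul ℝ 𝔤] [LieGroupExp G 𝔤] [MulAction G X] [MulAction G (Multiphase n k π)]
  {Q : Type*} [NormedAddCommGroup Q] [NormedSpace ℝ Q] {U : Set Q}

theorem mfderiv_proj_mfderiv_pt (hπ : ContMDiff 𝓘(ℝ, Euc k) 𝓘(ℝ, Euc (n + 1)) ∞ π)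
    {F : Q → Multiphase n k π} (hU : IsOpen U) (hF : Multiphase.SmoothOn 𝓘(ℝ, Q) F U) {q : Q}
    (hq : q ∈ U) (v : Q) :
    (mfderiv 𝓘(ℝ, Euc k) 𝓘(ℝ, Euc (n + 1)) π (F q).pt
      (mfderiv 𝓘(ℝ, Q) 𝓘(ℝ, Euc k) (fun p => (F p).pt) q v) : Euc (n + 1)) =
      mfderiv 𝓘(ℝ, Q) 𝓘(ℝ, Euc (n + 1)) (fun p => π (F p).pt) q v := by
  have hpt : MDifferentiableAt 𝓘(ℝ, Q) 𝓘(ℝ, Euc k) (fun p => (F p).pt) q :=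
    ((Multiphase.pt_smooth hF).contMDiffAt (hU.mem_nhds hq)).mdifferentiableAt (by norm_num)
  have h := mfderiv_comp q (g := π) (hπ.mdifferentiable (by norm_num) _) hpt
  exact (congrArg (fun L : Q →L[ℝ] Euc (n + 1) => L v) h).symm

/-- The projection to `X` of the derivative of a transformed map into `Z`. -/
theorem mfderiv_proj_mfderiv_smul (hπ : ContMDiff 𝓘(ℝ, Euc k) 𝓘(ℝ, Euc (n + 1)) ∞ π)
    (hG : ActsCanonically n k π G 𝔤) (g : G)
    {F : Q → Multiphase n k π} [FiniteDimensional ℝ Q] (hU : IsOpen U)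
    (hF : Multiphase.SmoothOn 𝓘(ℝ, Q) F U) {q : Q}
    (hq : q ∈ U) (v : Q) :
    (mfderiv 𝓘(ℝ, Euc k) 𝓘(ℝ, Euc (n + 1)) π (g • F q).pt
      (mfderiv 𝓘(ℝ, Q) 𝓘(ℝ, Euc k) (fun p => (g • F p).pt) q v) : Euc (n + 1)) =
      mfderiv 𝓘(ℝ, Euc (n + 1)) 𝓘(ℝ, Euc (n + 1)) (fun x : X => g • x) (π (F q).pt)
        (mfderiv 𝓘(ℝ, Euc k) 𝓘(ℝ, Euc (n + 1)) π (F q).pt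
          (mfderiv 𝓘(ℝ, Q) 𝓘(ℝ, Euc k) (fun p => (F p).pt) q v)) := by
  have hpt : MDifferentiableAt 𝓘(ℝ, Q) 𝓘(ℝ, Euc k) (fun p => (F p).pt) q :=
    ((Multiphase.pt_smooth hF).contMDiffAt (hU.mem_nhds hq)).mdifferentiableAt (by norm_num)
  have hgF : Multiphase.SmoothOn 𝓘(ℝ, Q) (fun p => g • F p) U := (hG.smooth_Z g).smoothOn hU hF
  have h0 := mfderiv_proj_mfderiv_pt hπ hU hgF hq v
  rw [h0, mfderiv_proj_mfderiv_pt hπ hU hF hq v]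
  have e : (fun p => π (g • F p).pt) = (fun x : X => g • x) ∘ fun p => π (F p).pt :=
    funext fun p => hG.covers g (F p)
  have h := mfderiv_comp q (g := fun x : X => g • x) (f := fun p => π (F p).pt)
    ((hG.smooth_X g).mdifferentiable (by norm_num) _)
    ((hπ.mdifferentiable (by norm_num) _).comp q hpt)
  rw [← e] at h
  exact congrArg (fun L : Q →L[ℝ] Euc (n + 1) => L v) h

theorem mfderiv_smul_mfderiv_tau
    (hτ : IsSmoothEmbedding 𝓘(ℝ, Euc n) 𝓘(ℝ, Euc (n + 1)) ∞ τ) (hG : ActsCanonically n k π G 𝔤)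
    (η : stab τ G) (x : S) (w : Euc n) :
    (mfderiv 𝓘(ℝ, Euc (n + 1)) 𝓘(ℝ, Euc (n + 1)) (fun x : X => η.1 • x) (τ x)
      (mfderiv 𝓘(ℝ, Euc n) 𝓘(ℝ, Euc (n + 1)) τ x w) : Euc (n + 1)) =
      mfderiv 𝓘(ℝ, Euc n) 𝓘(ℝ, Euc (n + 1)) τ (etaTau η x)
        (mfderiv 𝓘(ℝ, Euc n) 𝓘(ℝ, Euc n) (etaTau η) x w) := by
  have h1 := mfderiv_comp x (g := fun x : X => η.1 • x) (f := τ)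
    ((hG.smooth_X η.1).mdifferentiable (by norm_num) _)
    (hτ.contMDiff.mdifferentiable (by norm_num) _)
  have h2 := mfderiv_comp x (g := τ) (f := etaTau η)
    (hτ.contMDiff.mdifferentiable (by norm_num) _)
    ((etaTau_smooth hτ hG η).mdifferentiable (by norm_num) _)
  have e : (fun x : X => η.1 • x) ∘ τ = τ ∘ etaTau η := funext fun x => (tau_etaTau η x).symm
  rw [e] at h1
  exact congrArg (fun L : Euc n →L[ℝ] Euc (n + 1) => L w) (h1.symm.trans h2)

theorem smoothOn_lineMap_const {z z' : Multiphase n k π} (h : z.pt = z'.pt) :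
    Multiphase.SmoothOn 𝓘(ℝ, ℝ) (fun t => z.lineMap z' h t) Set.univ :=
  Multiphase.SmoothOn.lineMap (f := fun _ : ℝ => z) (f' := fun _ => z') isOpen_univ
    contMDiffOn_const contMDiffOn_const (fun _ => h) contMDiffOn_id

open Classical in
/-- For a line in a fibre of `R_τ`, transformed by `η`: the velocity of the transformed line pairs to
zero, under `Ω`, with all vectors over the tangent space of `Σ_τ`. -/
theorem fderiv_coordForm_smul_lineMap (hπ : IsSubmersion 𝓘(ℝ, Euc k) 𝓘(ℝ, Euc (n + 1)) ∞ π)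
    (hτ : IsSmoothEmbedding 𝓘(ℝ, Euc n) 𝓘(ℝ, Euc (n + 1)) ∞ τ)
    (hG : ActsCanonically n k π G 𝔤) (η : stab τ G) {x : S} {z z' : Multiphase n k π}
    (hz : π z.pt = τ x) (h : Multiphase.RelatedAt τ x z z') (A' : AdaptedChart n (k := k) π)
    {J : Set ℝ} (hJ : IsOpen J) (hcJ : ∀ t ∈ J, (η.1 • z.lineMap z' h.1 t).pt ∈ A'.chart.source)
    {t₁ : ℝ} (ht₁ : t₁ ∈ J) {v : Euc k} (hv : A'.T v = v) (ζ : Euc k [⋀^Fin (n + 1)]→L[ℝ] ℝ)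
    (hζ : ∀ u : Fin (n + 1) → Euc k,
      (∃ i j, i ≠ j ∧ A'.T (u i) = u i ∧ A'.T (u j) = u j) → ζ u = 0)
    (e : Fin n → Euc k)
    (he : ∀ i, ∃ w : Euc n, (mfderiv 𝓘(ℝ, Euc k) 𝓘(ℝ, Euc (n + 1)) π (η.1 • z.lineMap z' h.1 t₁).pt
      (A'.dSymm (η.1 • z.lineMap z' h.1 t₁).pt (e i)) : Euc (n + 1)) =
        mfderiv 𝓘(ℝ, Euc n) 𝓘(ℝ, Euc (n + 1)) τ (etaTau η x) w) :
    fderiv ℝ (fun t => A'.coordForm (η.1 • z.lineMap z' h.1 t)) t₁ 1 (Fin.cons v e) =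
      ζ (Fin.cons (fderiv ℝ (fun t => A'.coordPt (η.1 • z.lineMap z' h.1 t)) t₁ 1) e) := by
  have hπs := hπ.contMDiff
  set c : ℝ → Multiphase n k π := fun t => η.1 • z.lineMap z' h.1 t with hc
  have hcs : Multiphase.SmoothOn 𝓘(ℝ, ℝ) c J :=
    ContMDiffOn.mono ((hG.smooth_Z η.1).smoothOn isOpen_univ (smoothOn_lineMap_const h.1))
      (Set.subset_univ _)
  have hcπ : ∀ t, π (c t).pt = τ (etaTau η x) := fun t =>
    (hG.covers _ _).trans ((congrArg _ hz).trans (tau_etaTau η x).symm)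
  -- The parameters are `(t, (s, r))`: `t` runs along the image line, `s` moves in the direction
  -- `(v, ζ)`, and `r` moves the base point along the `e i`. Testing `Ω` at one point requires such
  -- a map into `Z`, realizing the given vectors as its derivatives.
  let M : (ℝ × (Fin n → ℝ)) →L[ℝ] Euc k := (ContinuousLinearMap.fst ℝ ℝ (Fin n → ℝ)).smulRight v +
    ∑ i, ((ContinuousLinearMap.proj i).comp (ContinuousLinearMap.snd ℝ ℝ (Fin n → ℝ))).smulRight
      (e i)
  have hM1 : M (1, 0) = v := by simp [M]
  have hM2 : ∀ i, M (0, Pi.single i 1) = e i := fun i => by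
    simp only [M, add_apply, sum_apply,
      ContinuousLinearMap.smulRight_apply, ContinuousLinearMap.coe_fst', zero_smul, zero_add,
      ContinuousLinearMap.comp_apply, ContinuousLinearMap.coe_snd', ContinuousLinearMap.proj_apply]
    rw [Finset.sum_eq_single i]
    · simp
    · intro j _ hj; simp [Pi.single_eq_of_ne hj]
    · simp
  let Yq : ℝ × (ℝ × (Fin n → ℝ)) → Euc k := fun q => A'.coordPt (c q.1) + M q.2
  let Zq : ℝ × (ℝ × (Fin n → ℝ)) → Euc k [⋀^Fin (n + 1)]→L[ℝ] ℝ := fun q =>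
    A'.coordForm (c q.1) + q.2.1 • ζ
  have hYJ := (A'.contMDiffOn_coordPt hcs hcJ).contDiffOn
  have hZJ := (A'.contMDiffOn_coordForm hcs hcJ).contDiffOn
  have hYs : ContDiffOn ℝ ∞ Yq (Prod.fst ⁻¹' J) :=
    (hYJ.comp contDiff_fst.contDiffOn fun q hq => hq).add
      (M.contDiff.comp contDiff_snd).contDiffOn
  have hZs : ContDiffOn ℝ ∞ Zq (Prod.fst ⁻¹' J) :=
    (hZJ.comp contDiff_fst.contDiffOn fun q hq => hq).add
      ((contDiff_fst.comp contDiff_snd).smul contDiff_const).contDiffOn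
  have hJ' : IsOpen (Prod.fst ⁻¹' J : Set (ℝ × (ℝ × (Fin n → ℝ)))) := hJ.preimage continuous_fst
  let U : Set (ℝ × (ℝ × (Fin n → ℝ))) := Prod.fst ⁻¹' J ∩ Yq ⁻¹' A'.chart.target
  have hU : IsOpen U := hYs.continuousOn.isOpen_inter_preimage hJ' A'.chart.open_target
  have hZ0 : ∀ q ∈ U, ∀ u : Fin (n + 1) → Euc k,
      (∃ i j, i ≠ j ∧ A'.T (u i) = u i ∧ A'.T (u j) = u j) → Zq q u = 0 := by
    rintro q hq u hu
    have h2 := hζ u hu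
    obtain ⟨i, j, hij, hi, hj⟩ := hu
    change A'.coordForm (c q.1) u + q.2.1 * ζ u = 0
    rw [h2, A'.coordForm_eq_zero (hcJ _ hq.1) hij hi hj, mul_zero, add_zero]
  -- Outside the open set where the coordinates are admissible the value is irrelevant.
  let F : ℝ × (ℝ × (Fin n → ℝ)) → Multiphase n k π := fun q =>
    if hq : q ∈ U then A'.ofCoord (Yq q) (Zq q) hq.2 (hZ0 q hq) else c t₁
  have hF : ∀ q (hq : q ∈ U), F q = A'.ofCoord (Yq q) (Zq q) hq.2 (hZ0 q hq) := fun q hq =>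
    dif_pos hq
  have hFpt : ∀ q ∈ U, (F q).pt = A'.chart.symm (Yq q) := fun q hq => by rw [hF q hq]; rfl
  have hFs : Multiphase.SmoothOn 𝓘(ℝ, ℝ × (ℝ × (Fin n → ℝ))) F U :=
    A'.smoothOn_of_coord hU (hYs.mono Set.inter_subset_left).contMDiffOn
      (hZs.mono Set.inter_subset_left).contMDiffOn (fun q hq => hq.2) hFpt
      (fun q hq u => by rw [hF q hq]; rfl)
  have hFsrc : ∀ q ∈ U, (F q).pt ∈ A'.chart.source := fun q hq => by
    rw [hFpt q hq]; exact A'.chart.map_target hq.2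
  have hFY : ∀ q ∈ U, A'.coordPt (F q) = Yq q := fun q hq => by
    rw [AdaptedChart.coordPt, hFpt q hq, A'.chart.right_inv hq.2]
  have hFZ : ∀ q ∈ U, A'.coordForm (F q) = Zq q := fun q hq => by
    ext u
    rw [A'.coordForm_apply, hF q hq]
    have hs : (A'.ofCoord (Yq q) (Zq q) hq.2 (hZ0 q hq)).pt ∈ A'.chart.source :=
      A'.chart.map_target hq.2
    exact congrArg (Zq q) (funext fun i => A'.d_dSymm hs (u i))
  have hline : ∀ t ∈ J, ((t, 0) : ℝ × (ℝ × (Fin n → ℝ))) ∈ U := fun t ht => ⟨ht, by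
    change A'.coordPt (c t) + M 0 ∈ A'.chart.target
    rw [map_zero, add_zero]
    exact A'.chart.map_source (hcJ t ht)⟩
  have hFline : ∀ t ∈ J, F (t, 0) = c t := fun t ht => by
    have h1 : (F (t, 0)).pt = (c t).pt := by
      rw [hFpt _ (hline t ht)]
      change A'.chart.symm (A'.coordPt (c t) + M 0) = _
      rw [map_zero, add_zero]
      exact A'.chart.left_inv (hcJ t ht)
    refine Multiphase.form_eq_of_eq h1 ?_
    have h2 := hFZ _ (hline t ht)
    have h3 : Zq (t, 0) = A'.coordForm (c t) := by
      change A'.coordForm (c t) + (0 : ℝ) • ζ = _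
      rw [zero_smul, add_zero]
    rw [h3] at h2
    ext u
    have h4 := congrArg (fun α => α fun i => A'.d (c t).pt (u i)) h2
    simp only [A'.coordForm_apply, h1] at h4
    have e' : (fun i => (A'.dSymm (c t).pt (A'.d (c t).pt (u i)) : Euc k)) = u :=
      funext fun i => A'.dSymm_d (hcJ t ht) _
    exact (congrArg (F (t, 0)).form e').symm.trans (h4.trans (congrArg (c t).form e'))
  have hq₁ : ((t₁, 0) : ℝ × (ℝ × (Fin n → ℝ))) ∈ U := hline t₁ ht₁
  -- derivatives in the coordinates
  set y' := fderiv ℝ (fun t => A'.coordPt (c t)) t₁ 1 with hy'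
  have hcd := (A'.contDiffAt_coordPt hJ hcs hcJ ht₁).differentiableAt (by norm_num)
  have hzd := (A'.contDiffAt_coordForm hJ hcs hcJ ht₁).differentiableAt (by norm_num)
  have hUn : U ∈ 𝓝 ((t₁, 0) : ℝ × (ℝ × (Fin n → ℝ))) := hU.mem_nhds hq₁
  have hdY : ∀ a : ℝ × (ℝ × (Fin n → ℝ)),
      fderiv ℝ (fun q => A'.coordPt (F q)) (t₁, 0) a = a.1 • y' + M a.2 := by
    have h1 : (fun q => A'.coordPt (F q)) =ᶠ[𝓝 (t₁, 0)] Yq := by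
      filter_upwards [hUn] with q hq using hFY q hq
    have h2 : HasFDerivAt Yq ((fderiv ℝ (fun t => A'.coordPt (c t)) t₁).comp
        (ContinuousLinearMap.fst ℝ ℝ (ℝ × (Fin n → ℝ))) +
        M.comp (ContinuousLinearMap.snd ℝ ℝ (ℝ × (Fin n → ℝ)))) (t₁, 0) :=
      (HasFDerivAt.comp (t₁, 0) (g := fun t => A'.coordPt (c t)) hcd.hasFDerivAt
        hasFDerivAt_fst).add (M.hasFDerivAt.comp (t₁, 0) hasFDerivAt_snd)
    intro a
    rw [h1.fderiv_eq, h2.fderiv]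
    change fderiv ℝ (fun t => A'.coordPt (c t)) t₁ a.1 + M a.2 = _
    rw [hy', ← map_smul, smul_eq_mul, mul_one]
  have hdZ : ∀ a : ℝ × (ℝ × (Fin n → ℝ)),
      fderiv ℝ (fun q => A'.coordForm (F q)) (t₁, 0) a =
        a.1 • fderiv ℝ (fun t => A'.coordForm (c t)) t₁ 1 + a.2.1 • ζ := by
    have h1 : (fun q => A'.coordForm (F q)) =ᶠ[𝓝 (t₁, 0)] Zq := by
      filter_upwards [hUn] with q hq using hFZ q hq
    have h2 : HasFDerivAt Zq ((fderiv ℝ (fun t => A'.coordForm (c t)) t₁).comp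
        (ContinuousLinearMap.fst ℝ ℝ (ℝ × (Fin n → ℝ))) +
        (((ContinuousLinearMap.fst ℝ ℝ (Fin n → ℝ)).comp
          (ContinuousLinearMap.snd ℝ ℝ (ℝ × (Fin n → ℝ)))).smulRight ζ)) (t₁, 0) :=
      (HasFDerivAt.comp (t₁, 0) (g := fun t => A'.coordForm (c t)) hzd.hasFDerivAt
        hasFDerivAt_fst).add (((ContinuousLinearMap.fst ℝ ℝ (Fin n → ℝ)).comp
          (ContinuousLinearMap.snd ℝ ℝ (ℝ × (Fin n → ℝ)))).smulRight ζ).hasFDerivAt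
    intro a
    rw [h1.fderiv_eq, h2.fderiv]
    change fderiv ℝ (fun t => A'.coordForm (c t)) t₁ a.1 + a.2.1 • ζ = _
    rw [← map_smul, smul_eq_mul, mul_one]
  -- The image line lies over the single point `τ (etaTau η x)` of `X`, so its base velocity is
  -- vertical, though not yet known to be zero.
  have hyT : A'.T y' = y' := by
    have h1 := A'.mfderiv_pt hJ hcs hcJ ht₁ 1
    have h2 := mfderiv_proj_mfderiv_pt hπs hJ hcs ht₁ 1
    rw [← h1, show (fun t => π (c t).pt) = fun _ => τ (etaTau η x) from funext hcπ,
      mfderiv_const] at h2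
    have h3 : (A'.dSymm (c t₁).pt y' : Euc k) ∈ vert n k π (c t₁).pt := h2
    have h4 := (A'.mem_vert (hcJ _ ht₁)).1 h3
    rwa [A'.d_dSymm (hcJ _ ht₁)] at h4
  have hFq : F (t₁, 0) = c t₁ := hFline t₁ ht₁
  let w : Fin n → ℝ × (ℝ × (Fin n → ℝ)) := fun i => (0, (0, Pi.single i 1))
  have hYa : fderiv ℝ (fun q => A'.coordPt (F q)) (t₁, 0) (1, 0) = y' := by
    rw [hdY]; simp
  have hYb : fderiv ℝ (fun q => A'.coordPt (F q)) (t₁, 0) (0, (1, 0)) = v := by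
    rw [hdY]; simp [hM1]
  have hYw : ∀ i, fderiv ℝ (fun q => A'.coordPt (F q)) (t₁, 0) (w i) = e i := fun i => by
    rw [hdY]; simp [w, hM2]
  have hΩF := A'.pullOmega_cons_cons hU hFs hFsrc hq₁ (a := (1, 0)) (b := (0, (1, 0))) w
    (by rw [hYa, hyT]) (by rw [hYb, hv])
  rw [hYa, hYb, funext hYw, hdZ, hdZ] at hΩF
  simp only [one_smul, zero_smul, zero_add, Prod.fst_zero, add_zero] at hΩF
  -- the same value computed before the transformation
  obtain ⟨A, hA⟩ := exists_adaptedChart hπ z.pt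
  have hGs : Multiphase.SmoothOn 𝓘(ℝ, ℝ × (ℝ × (Fin n → ℝ))) (fun q => η.1⁻¹ • F q) U :=
    (hG.smooth_Z η.1⁻¹).smoothOn hU hFs
  have hGline : ∀ t ∈ J, η.1⁻¹ • F (t, 0) = z.lineMap z' h.1 t := fun t ht => by
    rw [hFline t ht]; exact inv_smul_smul _ _
  let V := U ∩ (fun q => (η.1⁻¹ • F q).pt) ⁻¹' A.chart.source
  have hV : IsOpen V :=
    (Multiphase.pt_smooth hGs).continuousOn.isOpen_inter_preimage hU A.chart.open_source
  have hq₂ : ((t₁, 0) : ℝ × (ℝ × (Fin n → ℝ))) ∈ V := ⟨hq₁, by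
    change (η.1⁻¹ • F (t₁, 0)).pt ∈ A.chart.source
    rw [hGline t₁ ht₁]; exact hA⟩
  have hGsV : Multiphase.SmoothOn 𝓘(ℝ, ℝ × (ℝ × (Fin n → ℝ))) (fun q => η.1⁻¹ • F q) V :=
    ContMDiffOn.mono hGs Set.inter_subset_left
  have hGpt : (η.1⁻¹ • F (t₁, 0)).pt = z.pt := by rw [hGline t₁ ht₁]; rfl
  set DG := fderiv ℝ (fun q => A.coordPt (η.1⁻¹ • F q)) (t₁, 0) with hDG
  set DZ := fderiv ℝ (fun q => A.coordForm (η.1⁻¹ • F q)) (t₁, 0) with hDZ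
  have hlined : HasFDerivAt (fun t : ℝ => ((t, 0) : ℝ × (ℝ × (Fin n → ℝ))))
      (ContinuousLinearMap.inl ℝ ℝ (ℝ × (Fin n → ℝ))) t₁ := hasFDerivAt_prodMk_left _ _
  -- Undoing `η` turns the first direction back into the original line, whose base point in `Y` is
  -- fixed.
  have hDGa : DG (1, 0) = 0 := by
    have h1 := HasFDerivAt.comp t₁ (g := fun q => A.coordPt (η.1⁻¹ • F q))
      ((A.contDiffAt_coordPt hV hGsV (fun q hq => hq.2) hq₂).differentiableAt
        (by norm_num)).hasFDerivAt hlined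
    have h2 : (fun q => A.coordPt (η.1⁻¹ • F q)) ∘ (fun t : ℝ => ((t, 0) : ℝ × (ℝ × (Fin n → ℝ))))
        =ᶠ[𝓝 t₁] fun _ => A.coordPt z := by
      filter_upwards [hJ.mem_nhds ht₁] with t ht
      change A.coordPt (η.1⁻¹ • F (t, 0)) = _
      rw [hGline t ht]; rfl
    have h3 := h1.fderiv
    rw [h2.fderiv_eq] at h3
    simpa using (congrArg (fun L : ℝ →L[ℝ] Euc k => L 1) h3).symm
  have hDGv : ∀ a, (A.dSymm z.pt (DG a) : Euc k) =
      mfderiv 𝓘(ℝ, ℝ × (ℝ × (Fin n → ℝ))) 𝓘(ℝ, Euc k) (fun q => (η.1⁻¹ • F q).pt) (t₁, 0) a :=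
    fun a => by
    rw [← A.mfderiv_pt hV hGsV (fun q hq => hq.2) hq₂ a, hGpt]
  have hproj : ∀ a, (mfderiv 𝓘(ℝ, Euc k) 𝓘(ℝ, Euc (n + 1)) π z.pt (A.dSymm z.pt (DG a)) :
      Euc (n + 1)) = mfderiv 𝓘(ℝ, Euc (n + 1)) 𝓘(ℝ, Euc (n + 1)) (fun x : X => η.1⁻¹ • x)
        (τ (etaTau η x)) (mfderiv 𝓘(ℝ, Euc k) 𝓘(ℝ, Euc (n + 1)) π (c t₁).pt
          (A'.dSymm (c t₁).pt (fderiv ℝ (fun q => A'.coordPt (F q)) (t₁, 0) a))) := fun a => by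
    have h1 := mfderiv_proj_mfderiv_smul hπs hG η.1⁻¹ hU hFs hq₁ a
    rw [← A'.mfderiv_pt hU hFs hFsrc hq₁ a, hFq, hcπ] at h1
    have e2 : ∀ {y₁ y₂ : Y}, y₁ = y₂ → ∀ u : Euc k,
        (mfderiv 𝓘(ℝ, Euc k) 𝓘(ℝ, Euc (n + 1)) π y₁ u : Euc (n + 1)) =
          mfderiv 𝓘(ℝ, Euc k) 𝓘(ℝ, Euc (n + 1)) π y₂ u := by
      rintro _ _ rfl _; rfl
    rw [hFq] at hGpt
    exact (e2 hGpt.symm _).trans ((congrArg _ (hDGv a)).trans h1)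
  have hDGb : (A.dSymm z.pt (DG (0, (1, 0))) : Euc k) ∈ vert n k π z.pt := by
    have h1 := hproj (0, (1, 0))
    rw [hYb] at h1
    have h2 : (A'.dSymm (c t₁).pt v : Euc k) ∈ vert n k π (c t₁).pt := by
      rw [← hv]; exact A'.dSymm_mem_vert (hcJ _ ht₁) v
    have h3 : (mfderiv 𝓘(ℝ, Euc k) 𝓘(ℝ, Euc (n + 1)) π (c t₁).pt (A'.dSymm (c t₁).pt v) :
      Euc (n + 1)) = 0 := h2
    rw [h3] at h1
    exact h1.trans (map_zero _)
  have hDGw : ∀ i, ∃ w' : Euc n, (mfderiv 𝓘(ℝ, Euc k) 𝓘(ℝ, Euc (n + 1)) π z.pt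
      (A.dSymm z.pt (DG (w i))) : Euc (n + 1)) = mfderiv 𝓘(ℝ, Euc n) 𝓘(ℝ, Euc (n + 1)) τ x w' := by
    intro i
    obtain ⟨w₀, hw₀⟩ := he i
    have h1 := hproj (w i)
    rw [hYw] at h1
    have h2 : (mfderiv 𝓘(ℝ, Euc k) 𝓘(ℝ, Euc (n + 1)) π (c t₁).pt (A'.dSymm (c t₁).pt (e i)) :
      Euc (n + 1)) = mfderiv 𝓘(ℝ, Euc n) 𝓘(ℝ, Euc (n + 1)) τ (etaTau η x) w₀ := hw₀
    rw [h2] at h1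
    have h3 := mfderiv_smul_mfderiv_tau hτ hG η⁻¹ (etaTau η x) w₀
    rw [etaTau_inv_etaTau hτ.isEmbedding.injective] at h3
    exact ⟨_, h1.trans h3⟩
  choose w' hw' using hDGw
  -- The fibre velocity of the original line is `z' - z`. It vanishes on these vectors because the
  -- first is vertical, the others lie over the tangent space of `Σ_τ`, and all points of the line
  -- are related to `z`.
  have hDZ0 : DZ (1, 0) (Fin.cons (DG (0, (1, 0))) fun i => DG (w i)) = 0 := by
    have hd := (A.contDiffAt_coordForm hV hGsV (fun q hq => hq.2) hq₂).differentiableAt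
      (by norm_num)
    set u : Fin (n + 1) → Euc k := Fin.cons (DG (0, (1, 0))) fun i => DG (w i) with hu
    have h1 := HasFDerivAt.comp t₁ (g := fun q => A.coordForm (η.1⁻¹ • F q)) hd.hasFDerivAt hlined
    have h2 : (fun q => A.coordForm (η.1⁻¹ • F q)) ∘
        (fun t : ℝ => ((t, 0) : ℝ × (ℝ × (Fin n → ℝ)))) =ᶠ[𝓝 t₁]
        fun t => A.coordForm (z.lineMap z' h.1 t) := by
      filter_upwards [hJ.mem_nhds ht₁] with t ht
      change A.coordForm (η.1⁻¹ • F (t, 0)) = _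
      rw [hGline t ht]
    have h3 := h1.congr_of_eventuallyEq h2.symm
    have h4 := fderiv_continuousAlternatingMap_apply_const_apply h3.differentiableAt u 1
    rw [h3.fderiv] at h4
    have h5 : (fun t => A.coordForm (z.lineMap z' h.1 t) u) = fun _ => A.coordForm z u := by
      funext t
      have h6 := (h.lineMap t).2 _ hDGb (fun i => A.dSymm z.pt (DG (w i))) w' hw'
      have e1 : (fun i => (A.dSymm z.pt (u i) : Euc k)) =
          Fin.cons (A.dSymm z.pt (DG (0, (1, 0)))) fun i => A.dSymm z.pt (DG (w i)) := by
        funext i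
        refine Fin.cases ?_ (fun l => ?_) i <;> simp [hu]
      rw [A.coordForm_apply, A.coordForm_apply, e1]
      exact (congrArg _ e1).trans h6.symm
    rw [h5] at h4
    simpa using h4.symm
  -- Both terms of `Ω` vanish before the transformation, so invariance equates the two terms of
  -- `hΩF` after it.
  have hΩG := A.pullOmega_cons_cons hV hGsV (fun q hq => hq.2) hq₂ (a := (1, 0)) (b := (0, (1, 0))) w
    (by rw [← hDG, hDGa, map_zero]) (by
      rw [← hDG]
      have h1 := (A.mem_vert hA).1 hDGb
      rwa [A.d_dSymm hA] at h1)
  rw [← hDG, ← hDZ, hDZ0, hDGa, ContinuousAlternatingMap.map_coord_zero (DZ (0, (1, 0)))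
    (m := Fin.cons 0 fun i => DG (w i)) 0 rfl, sub_zero,
    (hG.canonical η.1⁻¹).pullOmega_eq (hG.smooth_Z η.1⁻¹) hπ hU hFs hq₁, hΩF] at hΩG
  exact (sub_eq_zero.1 hΩG).symm

end CanonicalLine

/-! ### Transformations permute the fibres of `R_τ`. -/

theorem exists_continuousAlternatingMap_single (n : ℕ) :
    ∃ vol : Euc n [⋀^Fin n]→L[ℝ] ℝ, vol (fun i => EuclideanSpace.single i 1) = 1 := by
  let b := (EuclideanSpace.basisFun (Fin n) ℝ).toBasis
  have hb : ∀ v : Fin n → Euc n, b.det v = (Matrix.of fun i j => v j i).det := fun v => by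
    rw [Module.Basis.det_apply]
    congr 1
  refine ⟨{ b.det with cont := ?_ }, ?_⟩
  · have : Continuous fun v : Fin n → Euc n => b.det v := by
      simp_rw [hb]
      exact Continuous.matrix_det (continuous_pi fun i => continuous_pi fun j => by
        simp only [Matrix.of_apply]; fun_prop)
    exact this
  · have : b.det (fun i => EuclideanSpace.single i 1) = 1 := by
      have h : (fun i => EuclideanSpace.single i (1 : ℝ)) = b := by
        funext i; simp [b]
      rw [h, b.det_self]
    exact this

section CanonicalLine

variable {n k : ℕ} {X Y S : Type*}
  [TopologicalSpace X] [ChartedSpace (Euc (n + 1)) X] [IsManifold 𝓘(ℝ, Euc (n + 1)) ∞ X]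
  [TopologicalSpace Y] [ChartedSpace (Euc k) Y] [IsManifold 𝓘(ℝ, Euc k) ∞ Y]
  [TopologicalSpace S] [ChartedSpace (Euc n) S] [IsManifold 𝓘(ℝ, Euc n) ∞ S]
  {π : Y → X} {τ : S → X}
  {G 𝔤 : Type*} [Group G] [LieRing 𝔤] [LieAlgebra ℝ 𝔤] [TopologicalSpace 𝔤]
  [ContinuousSMul ℝ 𝔤] [LieGroupExp G 𝔤] [MulAction G X] [MulAction G (Multiphase n k π)]

/-- Nondegeneracy of the pairing between fibre directions of `Z` and vertical vectors. It provides
the test form `ζ` that detects a nonzero base velocity. -/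
theorem AdaptedChart.exists_momentumForm_ne_zero (A : AdaptedChart n (k := k) π)
    (hτ : IsSmoothEmbedding 𝓘(ℝ, Euc n) 𝓘(ℝ, Euc (n + 1)) ∞ τ) {y : Y} (hy : y ∈ A.chart.source)
    {x : S} {v : Euc k} (hv : A.T v = v) (hv0 : v ≠ 0) {e : Fin n → Euc k}
    (he : ∀ i, (mfderiv 𝓘(ℝ, Euc k) 𝓘(ℝ, Euc (n + 1)) π y (A.dSymm y (e i)) : Euc (n + 1)) =
      mfderiv 𝓘(ℝ, Euc n) 𝓘(ℝ, Euc (n + 1)) τ x (EuclideanSpace.single i (1 : ℝ) : Euc n)) :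
    ∃ ζ : Euc k [⋀^Fin (n + 1)]→L[ℝ] ℝ, (∀ u : Fin (n + 1) → Euc k,
      (∃ i j, i ≠ j ∧ A.T (u i) = u i ∧ A.T (u j) = u j) → ζ u = 0) ∧ ζ (Fin.cons v e) ≠ 0 := by
  obtain ⟨r, -, W, -, -, hxW, -, -, hr⟩ := exists_mfderiv_retraction hτ.isImmersion x
  obtain ⟨vol, hvol⟩ := exists_continuousAlternatingMap_single n
  let Dr : Euc (n + 1) →L[ℝ] Euc n := mfderiv 𝓘(ℝ, Euc (n + 1)) 𝓘(ℝ, Euc n) r (τ x)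
  let Dπ : Euc k →L[ℝ] Euc (n + 1) := mfderiv 𝓘(ℝ, Euc k) 𝓘(ℝ, Euc (n + 1)) π y
  let q : Euc k →L[ℝ] Euc n := Dr.comp (Dπ.comp (A.dSymm y))
  -- With this `κ` the value at `(v, e)` is `⟨v, v⟩` times the volume of the standard basis, which
  -- is one.
  let κ : Euc k →ₗ[ℝ] (Euc n [⋀^Fin n]→L[ℝ] ℝ) :=
    (LinearMap.toSpanSingleton ℝ _ vol).comp (innerSL ℝ v).toLinearMap
  have hq : ∀ u, A.T u = u → q u = 0 := fun u hu => by
    have h1 : Dπ (A.dSymm y u) = 0 := by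
      have := A.dSymm_mem_vert hy u
      rw [hu] at this
      exact this
    change Dr (Dπ (A.dSymm y u)) = 0
    rw [h1, map_zero]
  refine ⟨momentumForm κ q, ?_, ?_⟩
  · rintro u ⟨i, j, hij, hi, hj⟩
    exact momentumForm_eq_zero hij (hq _ hi) (hq _ hj)
  · have h1 : (fun i => q (e i)) = fun i => EuclideanSpace.single i (1 : ℝ) := by
      funext i
      have h2 : Dπ (A.dSymm y (e i)) = _ := he i
      change Dr (Dπ (A.dSymm y (e i))) = _
      rw [h2]
      exact hr x hxW _
    rw [momentumForm_cons (hq v hv), h1]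
    change inner ℝ v v * vol _ ≠ 0
    rw [hvol, mul_one]
    exact inner_self_ne_zero.2 hv0

/-- The image under `η` of a line in a fibre of `R_τ` stays, locally, in a fibre of `R_τ`. -/
theorem eventually_relatedAt_smul_lineMap (hπ : IsSubmersion 𝓘(ℝ, Euc k) 𝓘(ℝ, Euc (n + 1)) ∞ π)
    (hτ : IsSmoothEmbedding 𝓘(ℝ, Euc n) 𝓘(ℝ, Euc (n + 1)) ∞ τ)
    (hG : ActsCanonically n k π G 𝔤) (η : stab τ G) {x : S} {z z' : Multiphase n k π}
    (hz : π z.pt = τ x) (h : Multiphase.RelatedAt τ x z z') (t₀ : ℝ) :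
    ∀ᶠ t in 𝓝 t₀, Multiphase.RelatedAt τ (etaTau η x) (η.1 • z.lineMap z' h.1 t₀)
      (η.1 • z.lineMap z' h.1 t) := by
  set c : ℝ → Multiphase n k π := fun t => η.1 • z.lineMap z' h.1 t with hc
  have hcs : Multiphase.SmoothOn 𝓘(ℝ, ℝ) c Set.univ :=
    (hG.smooth_Z η.1).smoothOn isOpen_univ (smoothOn_lineMap_const h.1)
  have hcπ : ∀ t, π (c t).pt = τ (etaTau η x) := fun t =>
    (hG.covers _ _).trans ((congrArg _ hz).trans (tau_etaTau η x).symm)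
  obtain ⟨A, hA⟩ := exists_adaptedChart hπ (c t₀).pt
  have hcont : Continuous fun t => (c t).pt :=
    (contMDiffOn_univ.1 (Multiphase.pt_smooth hcs)).continuous
  obtain ⟨ε, hε, hJ⟩ := Metric.isOpen_iff.1 (A.chart.open_source.preimage hcont) t₀ hA
  set J := Metric.ball t₀ ε
  have hcJ : ∀ t ∈ J, (c t).pt ∈ A.chart.source := fun t ht => hJ ht
  have hcsJ : Multiphase.SmoothOn 𝓘(ℝ, ℝ) c J := ContMDiffOn.mono hcs (Set.subset_univ _)
  have hconn : IsPreconnected J := (convex_ball t₀ ε).isPreconnected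
  have key := fun {t₁} (ht₁ : t₁ ∈ J) {v} (hv : A.T v = v) =>
    fderiv_coordForm_smul_lineMap hπ hτ hG η hz h A Metric.isOpen_ball hcJ ht₁ hv
  have hpt0 : ∀ t ∈ J, fderiv ℝ (fun t => A.coordPt (c t)) t = 0 := by
    intro t ht
    set y' := fderiv ℝ (fun t => A.coordPt (c t)) t 1 with hy'
    have hyT : A.T y' = y' := by
      have h1 := A.mfderiv_pt Metric.isOpen_ball hcsJ hcJ ht 1
      have h2 := mfderiv_proj_mfderiv_pt hπ.contMDiff Metric.isOpen_ball hcsJ ht 1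
      rw [← h1, show (fun t => π (c t).pt) = fun _ => τ (etaTau η x) from funext hcπ,
        mfderiv_const] at h2
      have h3 : (A.dSymm (c t).pt y' : Euc k) ∈ vert n k π (c t).pt := h2
      have h4 := (A.mem_vert (hcJ _ ht)).1 h3
      rwa [A.d_dSymm (hcJ _ ht)] at h4
    have hy0 : y' = 0 := by
      by_contra hne
      choose u hu using fun i : Fin n => A.surjective _ (hcJ t ht)
        (mfderiv 𝓘(ℝ, Euc n) 𝓘(ℝ, Euc (n + 1)) τ (etaTau η x) (EuclideanSpace.single i (1 : ℝ) : Euc n))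
      have he : ∀ i, (mfderiv 𝓘(ℝ, Euc k) 𝓘(ℝ, Euc (n + 1)) π (c t).pt
          (A.dSymm (c t).pt (A.d (c t).pt (u i))) : Euc (n + 1)) =
          mfderiv 𝓘(ℝ, Euc n) 𝓘(ℝ, Euc (n + 1)) τ (etaTau η x)
            (EuclideanSpace.single i (1 : ℝ) : Euc n) := fun i =>
        (congrArg _ (A.dSymm_d (hcJ t ht) (u i))).trans (hu i)
      obtain ⟨ζ, hζ, hζ0⟩ := A.exists_momentumForm_ne_zero hτ (hcJ t ht) hyT hne he
      -- Choosing `v = 0` leaves `ζ (y', e) = 0`, contrary to the choice of `ζ`.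
      have h1 := key ht (map_zero A.T) ζ hζ _ fun i => ⟨_, he i⟩
      rw [ContinuousAlternatingMap.map_coord_zero _ 0 (Fin.cons_zero _ _)] at h1
      exact hζ0 h1.symm
    exact ContinuousLinearMap.ext_ring hy0
  have hpt : ∀ t ∈ J, (c t₀).pt = (c t).pt := by
    intro t ht
    have h1 := Metric.isOpen_ball.is_const_of_fderiv_eq_zero hconn
      (fun s hs => ((A.contDiffAt_coordPt Metric.isOpen_ball hcsJ hcJ hs).differentiableAt
        (by norm_num)).differentiableWithinAt) hpt0 (Metric.mem_ball_self hε) ht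
    exact A.chart.injOn (hcJ _ (Metric.mem_ball_self hε)) (hcJ t ht) h1
  filter_upwards [Metric.ball_mem_nhds t₀ hε] with t ht
  refine ⟨hpt t ht, fun v hv u w hu => ?_⟩
  set y := (c t₀).pt with hy
  have hysrc : y ∈ A.chart.source := hA
  have hval : ∀ s ∈ J, A.coordForm (c s) (Fin.cons (A.d y v) fun i => A.d y (u i)) =
      (c s).form (Fin.cons v u) := by
    intro s hs
    rw [A.coordForm_apply, ← hpt s hs]
    congr 1
    funext i
    refine Fin.cases ?_ (fun l => ?_) i
    · exact A.dSymm_d hysrc v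
    · exact A.dSymm_d hysrc (u l)
  have hd : ∀ s ∈ J, DifferentiableAt ℝ (fun s => A.coordForm (c s)) s := fun s hs =>
    (A.contDiffAt_coordForm Metric.isOpen_ball hcsJ hcJ hs).differentiableAt (by norm_num)
  have h1 := Metric.isOpen_ball.is_const_of_fderiv_eq_zero hconn (x := t₀) (y := t)
    (f := fun s => A.coordForm (c s) (Fin.cons (A.d y v) fun i => A.d y (u i)))
    (fun s hs => ((hd s hs).continuousAlternatingMap_apply_const _).differentiableWithinAt)
    (fun s hs => by
      ext
      rw [fderiv_continuousAlternatingMap_apply_const_apply (hd s hs)]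
      -- With `ζ = 0`, the derivative of the coordinate form vanishes on the vectors that define the
      -- relation.
      refine (key hs ((A.mem_vert hysrc).1 hv) 0 (fun _ _ => rfl) _ fun i => ⟨w i, ?_⟩).trans rfl
      change (mfderiv 𝓘(ℝ, Euc k) 𝓘(ℝ, Euc (n + 1)) π (c s).pt
        (A.dSymm (c s).pt (A.d y (u i))) : Euc (n + 1)) = _
      rw [← hpt s hs]
      exact (congrArg _ (A.dSymm_d hysrc (u i))).trans (hu i))
    (Metric.mem_ball_self hε) ht
  rw [hval _ (Metric.mem_ball_self hε), hval t ht] at h1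
  exact h1

/-- Canonical transformations preserving `Σ_τ` permute the fibres of `R_τ`. -/
theorem relatedAt_smul (hπ : IsSubmersion 𝓘(ℝ, Euc k) 𝓘(ℝ, Euc (n + 1)) ∞ π)
    (hτ : IsSmoothEmbedding 𝓘(ℝ, Euc n) 𝓘(ℝ, Euc (n + 1)) ∞ τ)
    (hG : ActsCanonically n k π G 𝔤) (η : stab τ G) {x : S} {z z' : Multiphase n k π}
    (hz : π z.pt = τ x) (h : Multiphase.RelatedAt τ x z z') :
    Multiphase.RelatedAt τ (etaTau η x) (η.1 • z) (η.1 • z') := by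
  have hloc : IsLocallyConstant fun t => Multiphase.RelatedAt τ (etaTau η x)
      (η.1 • z.lineMap z' h.1 0) (η.1 • z.lineMap z' h.1 t) := by
    rw [IsLocallyConstant.iff_eventually_eq]
    intro t₀
    filter_upwards [eventually_relatedAt_smul_lineMap hπ hτ hG η hz h t₀] with t ht
    -- Being related is an equivalence relation, so the truth value is locally constant in `t`;
    -- connectedness of `ℝ` carries it from `0` to `1`.
    exact propext ⟨fun h' => h'.trans ht.symm, fun h' => h'.trans ht⟩
  have h1 := hloc.apply_eq_of_preconnectedSpace 0 1
  rw [Multiphase.lineMap_zero, Multiphase.lineMap_one] at h1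
  exact h1.mp ⟨rfl, fun _ _ _ _ _ => rfl⟩

end CanonicalLine

/-! ### Linearity of the integral of forms and differentiation under it. -/

section Integration

open MeasureTheory

theorem hasFDerivAt_integral_mul_of_contDiffOn {n : ℕ} {P : Type*} [NormedAddCommGroup P]
    [NormedSpace ℝ P] [FiniteDimensional ℝ P] {g : P × Euc n → ℝ} {W K : Set (Euc n)}
    (hW : IsOpen W) (hg : ContDiffOn ℝ ∞ g (Set.univ ×ˢ W)) (hK : IsCompact K) (hKW : K ⊆ W)
    {r : Euc n → ℝ} (hr : ContinuousOn r K) (p : P) :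
    HasFDerivAt (fun q => ∫ y in K, r y * g (q, y))
      (∫ y in K, r y • fderiv ℝ (fun q => g (q, y)) p) p ∧
    IntegrableOn (fun y => r y • fderiv ℝ (fun q => g (q, y)) p) K := by
  have hU : IsOpen (Set.univ ×ˢ W : Set (P × Euc n)) := isOpen_univ.prod hW
  let D : P → Euc n → P →L[ℝ] ℝ := fun q y =>
    (fderiv ℝ g (q, y)).comp (ContinuousLinearMap.inl ℝ P (Euc n))
  have hD : ∀ q, ∀ y ∈ W, HasFDerivAt (fun q => g (q, y)) (D q y) q := fun q y hy =>
    HasFDerivAt.comp q (g := g) (((hg.contDiffAt (hU.mem_nhds ⟨trivial, hy⟩)).differentiableAt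
      (by norm_num)).hasFDerivAt) (hasFDerivAt_prodMk_left q y)
  have hDc : ContinuousOn (fun m : P × Euc n => D m.1 m.2) (Set.univ ×ˢ W) :=
    (hg.continuousOn_fderiv_of_isOpen hU (by norm_num)).clm_comp continuousOn_const
  have hslice : ∀ q : P, Set.MapsTo (fun y : Euc n => (q, y)) K (Set.univ ×ˢ W) :=
    fun q y hy => ⟨trivial, hKW hy⟩
  have hgc : ∀ q, ContinuousOn (fun y => r y * g (q, y)) K := fun q =>
    hr.mul (hg.continuousOn.comp (by fun_prop) (hslice q))
  have hDKc : ContinuousOn (fun y => r y • D p y) K :=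
    hr.smul (ContinuousOn.comp (g := fun m : P × Euc n => D m.1 m.2) hDc (by fun_prop) (hslice p))
  -- The dominating constant is a bound of the integrand's derivative over a compact ball of
  -- parameters times `K`.
  have hcomp : IsCompact (Metric.closedBall p 1 ×ˢ K) := (isCompact_closedBall p 1).prod hK
  have hnorm : ContinuousOn (fun m : P × Euc n => r m.2 • D m.1 m.2) (Metric.closedBall p 1 ×ˢ K) :=
    (hr.comp continuousOn_snd fun m hm => hm.2).smul
      (hDc.mono fun m hm => ⟨trivial, hKW hm.2⟩)
  obtain ⟨C, hC⟩ := hcomp.exists_bound_of_continuousOn hnorm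
  have hcongr : Set.EqOn (fun y => r y • D p y) (fun y => r y • fderiv ℝ (fun q => g (q, y)) p) K :=
    fun y hy => by
      change r y • D p y = r y • fderiv ℝ (fun q => g (q, y)) p
      rw [(hD p y (hKW hy)).fderiv]
  have hint := hDKc.integrableOn_compact hK (μ := volume)
  refine ⟨?_, hint.congr_fun hcongr hK.measurableSet⟩
  rw [← setIntegral_congr_fun hK.measurableSet hcongr]
  refine hasFDerivAt_integral_of_dominated_of_fderiv_le (F' := fun q y => r y • D q y)
    (bound := fun _ => C) (Metric.closedBall_mem_nhds p one_pos) ?_ ?_ hint.aestronglyMeasurable ?_ ?_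
    ?_
  · exact Filter.Eventually.of_forall fun q =>
      ((hgc q).integrableOn_compact hK).aestronglyMeasurable
  · exact (hgc p).integrableOn_compact hK
  · filter_upwards [ae_restrict_mem hK.measurableSet] with y hy q hq using hC (q, y) ⟨hq, hy⟩
  · exact integrableOn_const hK.measure_lt_top.ne
  · filter_upwards [ae_restrict_mem hK.measurableSet] with y hy q _
    exact (hD q y (hKW hy)).const_mul (r y)

variable {n : ℕ} {S : Type*} [TopologicalSpace S] [ChartedSpace (Euc n) S]

/-- The coefficient of an `n`-form in the chart at `c`. -/
def localDensity (α : S → Euc n [⋀^Fin n]→L[ℝ] ℝ) (c : S) (y : Euc n) : ℝ :=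
  α ((chartAt (Euc n) c).symm y) fun i =>
    mfderiv 𝓘(ℝ, Euc n) 𝓘(ℝ, Euc n) (chartAt (Euc n) c).symm y (EuclideanSpace.single i 1)

/-- Continuity of an `n`-form, in the preferred charts. -/
def ContinuousForm (α : S → Euc n [⋀^Fin n]→L[ℝ] ℝ) : Prop :=
  ∀ c, ContinuousOn (localDensity α c) (chartAt (Euc n) c).target

variable [IsManifold 𝓘(ℝ, Euc n) ∞ S] [CompactSpace S] [T2Space S]

theorem chartPartition_support_subset (c : S) :
    tsupport (chartPartition n S c) ⊆ (chartAt (Euc n) c).source :=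
  Classical.choose_spec
    (SmoothPartitionOfUnity.exists_isSubordinate_chartAt_source (I := 𝓘(ℝ, Euc n)) (M := S)) c

variable (n S) in
theorem exists_finset_chartPartition :
    ∃ T : Finset S, (∀ c ∉ T, ∀ x, chartPartition n S c x = 0) ∧
      ∀ x, ∑ c ∈ T, chartPartition n S c x = 1 := by
  have hfin := (chartPartition n S).locallyFinite.finite_nonempty_of_compact
  have h0 : ∀ c ∉ hfin.toFinset, ∀ x, chartPartition n S c x = 0 := by
    intro c hc x
    by_contra hx
    exact hc (hfin.mem_toFinset.2 ⟨x, hx⟩)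
  refine ⟨hfin.toFinset, h0, fun x => ?_⟩
  rw [← (chartPartition n S).sum_eq_one (Set.mem_univ x)]
  refine (finsum_eq_sum_of_support_subset _ fun c hc => ?_).symm
  by_contra h
  exact hc (h0 c h x)

theorem integralForm_eq_sum {T : Finset S} (hT : ∀ c ∉ T, ∀ x, chartPartition n S c x = 0)
    (α : S → Euc n [⋀^Fin n]→L[ℝ] ℝ) :
    integralForm α = ∑ c ∈ T, ∫ y in (chartAt (Euc n) c).target,
      chartPartition n S c ((chartAt (Euc n) c).symm y) * localDensity α c y := by
  refine finsum_eq_sum_of_support_subset _ fun c hc => ?_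
  by_contra h
  refine hc ?_
  have : ∀ y, chartPartition n S c ((chartAt (Euc n) c).symm y) = 0 := fun y => hT c h _
  simp [this]

/-- Chart domains are not compact, so continuity on them does not give integrability. Cutting down
to the image of the support of the partition function replaces each local integral by one over a
compact set. -/
theorem exists_compact_chartPartition (c : S) :
    ∃ K ⊆ (chartAt (Euc n) c).target, IsCompact K ∧
      (∀ y ∈ (chartAt (Euc n) c).target \ K,
        chartPartition n S c ((chartAt (Euc n) c).symm y) = 0) ∧
      ContinuousOn (fun y => chartPartition n S c ((chartAt (Euc n) c).symm y)) K := by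
  set e := chartAt (Euc n) c
  have hsub : tsupport (chartPartition n S c) ⊆ e.source := chartPartition_support_subset c
  have hKt : e '' tsupport (chartPartition n S c) ⊆ e.target := by
    rintro _ ⟨x, hx, rfl⟩; exact e.map_source (hsub hx)
  refine ⟨e '' tsupport (chartPartition n S c), hKt, ?_, ?_, ?_⟩
  · exact (isClosed_tsupport _).isCompact.image_of_continuousOn (e.continuousOn.mono hsub)
  · rintro y ⟨hy, hyK⟩
    by_contra h
    exact hyK ⟨e.symm y, subset_tsupport _ h, e.right_inv hy⟩
  · exact (chartPartition n S c).contMDiff.continuous.comp_continuousOn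
      (e.continuousOn_symm.mono hKt)

theorem integrableOn_chartPartition_mul (c : S) {f : Euc n → ℝ}
    (hf : ContinuousOn f (chartAt (Euc n) c).target) :
    IntegrableOn (fun y => chartPartition n S c ((chartAt (Euc n) c).symm y) * f y)
      (chartAt (Euc n) c).target := by
  obtain ⟨K, hKt, hK, h0, hc⟩ := exists_compact_chartPartition (n := n) c
  refine IntegrableOn.of_forall_sdiff_eq_zero (s := K)
    ((hc.mul (hf.mono hKt)).integrableOn_compact hK)
    (chartAt (Euc n) c).open_target.measurableSet fun y hy => ?_
  rw [h0 y hy, zero_mul]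

theorem localDensity_sub (α β : S → Euc n [⋀^Fin n]→L[ℝ] ℝ) (c : S) (y : Euc n) :
    localDensity (fun x => α x - β x) c y = localDensity α c y - localDensity β c y := rfl

theorem integralForm_sub {α β : S → Euc n [⋀^Fin n]→L[ℝ] ℝ} (hα : ContinuousForm α)
    (hβ : ContinuousForm β) :
    integralForm (fun x => α x - β x) = integralForm α - integralForm β := by
  obtain ⟨T, hT, -⟩ := exists_finset_chartPartition n S
  simp only [integralForm_eq_sum hT, localDensity_sub, mul_sub]
  rw [← Finset.sum_sub_distrib]
  exact Finset.sum_congr rfl fun c _ => integral_sub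
    (integrableOn_chartPartition_mul c (hα c)) (integrableOn_chartPartition_mul c (hβ c))

theorem integralForm_neg (α : S → Euc n [⋀^Fin n]→L[ℝ] ℝ) :
    integralForm (fun x => -α x) = -integralForm α := by
  obtain ⟨T, hT, -⟩ := exists_finset_chartPartition n S
  have h : ∀ c y, localDensity (fun x => -α x) c y = -localDensity α c y := fun c y => rfl
  simp only [integralForm_eq_sum hT, h, mul_neg, integral_neg, Finset.sum_neg_distrib]

/-- Differentiation under the integral of forms. -/
theorem hasFDerivAt_integralForm {P : Type*} [NormedAddCommGroup P]
    [NormedSpace ℝ P] [FiniteDimensional ℝ P] {α : P → S → Euc n [⋀^Fin n]→L[ℝ] ℝ}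
    (hα : ∀ c, ContDiffOn ℝ ∞ (fun m : P × Euc n => localDensity (α m.1) c m.2)
      (Set.univ ×ˢ (chartAt (Euc n) c).target))
    (hd : ∀ x, Differentiable ℝ fun q => α q x) (p : P) :
    DifferentiableAt ℝ (fun q => integralForm (α q)) p ∧ ∀ a,
    ContinuousForm (fun x => fderiv ℝ (fun q => α q x) p a) ∧
    fderiv ℝ (fun q => integralForm (α q)) p a =
      integralForm fun x => fderiv ℝ (fun q => α q x) p a := by
  obtain ⟨T, hT, -⟩ := exists_finset_chartPartition n S
  have hloc : ∀ c y a, localDensity (fun x => fderiv ℝ (fun q => α q x) p a) c y =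
      fderiv ℝ (fun q => localDensity (α q) c y) p a := fun c y a =>
    (fderiv_continuousAlternatingMap_apply_const_apply (hd _ p) _ a).symm
  have hsum : ∀ c, HasFDerivAt (fun q => ∫ y in (chartAt (Euc n) c).target,
      chartPartition n S c ((chartAt (Euc n) c).symm y) * localDensity (α q) c y)
      (∫ y in (chartAt (Euc n) c).target, chartPartition n S c ((chartAt (Euc n) c).symm y) •
        fderiv ℝ (fun q => localDensity (α q) c y) p) p ∧
      IntegrableOn (fun y => chartPartition n S c ((chartAt (Euc n) c).symm y) •
        fderiv ℝ (fun q => localDensity (α q) c y) p) (chartAt (Euc n) c).target := by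
    intro c
    obtain ⟨K, hKt, hK, h0, hc⟩ := exists_compact_chartPartition (n := n) c
    have h1 := hasFDerivAt_integral_mul_of_contDiffOn (chartAt (Euc n) c).open_target (hα c) hK hKt
      hc p
    have hm := (chartAt (Euc n) c).open_target.measurableSet
    constructor
    · rw [setIntegral_eq_of_subset_of_forall_sdiff_eq_zero hm hKt fun y hy => by
        rw [h0 y hy, zero_smul]]
      refine h1.1.congr_of_eventuallyEq (Filter.Eventually.of_forall fun q => ?_)
      exact setIntegral_eq_of_subset_of_forall_sdiff_eq_zero hm hKt fun y hy => by
        rw [h0 y hy, zero_mul]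
    · have h2 := IntegrableOn.of_forall_sdiff_eq_zero (s := K) (t := (chartAt (Euc n) c).target)
        (f := fun y => chartPartition n S c ((chartAt (Euc n) c).symm y) •
          fderiv ℝ (fun q => localDensity (α q) c y) p) h1.2 hm fun y hy => by
            rw [h0 y hy, zero_smul]
      exact h2
  have key := HasFDerivAt.fun_sum fun c (_ : c ∈ T) => (hsum c).1
  simp only [← integralForm_eq_sum hT] at key
  refine ⟨key.differentiableAt, fun a => ⟨fun c => ?_, ?_⟩⟩
  · have h1 : ContinuousOn (fun y => fderiv ℝ (fun m : P × Euc n => localDensity (α m.1) c m.2)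
        (p, y) (a, 0)) (chartAt (Euc n) c).target :=
      (((hα c).continuousOn_fderiv_of_isOpen (isOpen_univ.prod (chartAt (Euc n) c).open_target)
        (by norm_num)).comp (Continuous.continuousOn (by fun_prop))
        fun y hy => ⟨trivial, hy⟩).clm_apply continuousOn_const
    refine h1.congr fun y hy => ?_
    rw [hloc]
    have hm : (p, y) ∈ (Set.univ ×ˢ (chartAt (Euc n) c).target : Set (P × Euc n)) := ⟨trivial, hy⟩
    have h2 := HasFDerivAt.comp p (g := fun m : P × Euc n => localDensity (α m.1) c m.2)
      (f := fun q => (q, y)) ((((hα c).contDiffAt ((isOpen_univ.prod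
        (chartAt (Euc n) c).open_target).mem_nhds hm)).differentiableAt (by norm_num)).hasFDerivAt)
      (hasFDerivAt_prodMk_left p y)
    exact congrArg (fun L : P →L[ℝ] ℝ => L a) h2.fderiv
  · rw [key.fderiv, integralForm_eq_sum hT, sum_apply]
    refine Finset.sum_congr rfl fun c _ => ?_
    rw [ContinuousLinearMap.integral_apply (hsum c).2]
    simp only [hloc]
    rfl

end Integration

/-! ### Invariance of the integral under orientation preserving diffeomorphisms. -/

section ChangeOfVariables

open MeasureTheory

theorem ContinuousAlternatingMap.apply_map_single {n : ℕ} (α : Euc n [⋀^Fin n]→L[ℝ] ℝ)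
    (A : Euc n →L[ℝ] Euc n) :
    α (fun i => A (EuclideanSpace.single i 1)) = A.det * α fun i => EuclideanSpace.single i 1 := by
  let b := (EuclideanSpace.basisFun (Fin n) ℝ).toBasis
  have hb : (fun i => EuclideanSpace.single i (1 : ℝ)) = b := by
    funext i; simp [b]
  have h1 := AlternatingMap.eq_smul_basis_det b α.toAlternatingMap
  have h2 : ∀ v : Fin n → Euc n, α v = α b * b.det v := fun v =>
    congrArg (fun β : Euc n [⋀^Fin n]→ₗ[ℝ] ℝ => β v) h1
  have h3 : (fun i => A (EuclideanSpace.single i (1 : ℝ))) = A.toLinearMap ∘ b := by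
    rw [← hb]; rfl
  rw [h2, h3, Module.Basis.det_comp, hb, b.det_self, mul_one, mul_comm]

variable {n : ℕ} {S : Type*} [TopologicalSpace S] [ChartedSpace (Euc n) S]

/-- Because `mfderiv` reads the target in the preferred chart at the image point, this determinant
is the Jacobian of a transition map of the oriented atlas. -/
theorem OrientedAtlas.det_mfderiv_chart_symm_pos [IsManifold 𝓘(ℝ, Euc n) ∞ S]
    (hS : OrientedAtlas n S) (c : S) {y : Euc n}
    (hy : y ∈ (chartAt (Euc n) c).target) :
    0 < (mfderiv 𝓘(ℝ, Euc n) 𝓘(ℝ, Euc n) (chartAt (Euc n) c).symm y : Euc n →L[ℝ] Euc n).det := by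
  have h1 := hS _ (chart_mem_atlas (Euc n) c) _
    (chart_mem_atlas (Euc n) ((chartAt (Euc n) c).symm y)) y (by simp [hy])
  have hd : MDifferentiableAt 𝓘(ℝ, Euc n) 𝓘(ℝ, Euc n) (chartAt (Euc n) c).symm y :=
    mdifferentiableAt_atlas_symm (chart_mem_atlas _ _) hy
  rw [hd.mfderiv]
  simp only [writtenInExtChartAt, Function.comp_def, extChartAt, chartAt_self_eq, mfld_simps,
    fderivWithin_univ]
  exact h1

theorem OrientedAtlas.det_mfderiv_chart_pos [IsManifold 𝓘(ℝ, Euc n) ∞ S]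
    (hS : OrientedAtlas n S) (c : S) {x : S}
    (hx : x ∈ (chartAt (Euc n) c).source) :
    0 < (mfderiv 𝓘(ℝ, Euc n) 𝓘(ℝ, Euc n) (chartAt (Euc n) c) x : Euc n →L[ℝ] Euc n).det := by
  have h1 := hS _ (chart_mem_atlas (Euc n) x) _
    (chart_mem_atlas (Euc n) c) (chartAt (Euc n) x x) (by simp [hx])
  have hd : MDifferentiableAt 𝓘(ℝ, Euc n) 𝓘(ℝ, Euc n) (chartAt (Euc n) c) x :=
    mdifferentiableAt_atlas (chart_mem_atlas _ _) hx
  rw [hd.mfderiv]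
  simp only [writtenInExtChartAt, Function.comp_def, extChartAt, chartAt_self_eq, mfld_simps,
    fderivWithin_univ]
  exact h1

variable [IsManifold 𝓘(ℝ, Euc n) ∞ S]

/-- Change of variables, for a form supported in a chart domain on both sides. -/
theorem integral_localDensity_comp (hS : OrientedAtlas n S) {h h' : S → S}
    (hh : ContMDiff 𝓘(ℝ, Euc n) 𝓘(ℝ, Euc n) ∞ h)
    (hl : ∀ x, h' (h x) = x) (hr : ∀ x, h (h' x) = x)
    (ho : OrientationPreserving n h) {α β : S → Euc n [⋀^Fin n]→L[ℝ] ℝ}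
    (hαβ : ∀ x (w : Fin n → Euc n), β x w =
      α (h x) fun i => mfderiv 𝓘(ℝ, Euc n) 𝓘(ℝ, Euc n) h x (w i)) (c d : S) {s : S → ℝ}
    (hs : ∀ x, s x ≠ 0 → x ∈ (chartAt (Euc n) d).source ∧ h' x ∈ (chartAt (Euc n) c).source) :
    ∫ y in (chartAt (Euc n) c).target,
        s (h ((chartAt (Euc n) c).symm y)) * localDensity β c y =
      ∫ y in (chartAt (Euc n) d).target, s ((chartAt (Euc n) d).symm y) * localDensity α d y := by
  set e := chartAt (Euc n) c with he
  set f := chartAt (Euc n) d with hf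
  let φ : Euc n → Euc n := fun y => f (h (e.symm y))
  -- The part of the first chart that `h` carries into the second. By `hs` the integrands vanish off
  -- `A` and off its image `φ '' A`, so the classical formula for `φ` on `A` suffices.
  let A : Set (Euc n) := e.target ∩ (fun y => h (e.symm y)) ⁻¹' f.source
  have hA : IsOpen A :=
    (hh.continuous.comp_continuousOn e.continuousOn_symm).isOpen_inter_preimage e.open_target
      f.open_source
  have hAe : A ⊆ e.target := Set.inter_subset_left
  have hφA : φ '' A = f.target ∩ (fun y => h' (f.symm y)) ⁻¹' e.source := by
    ext y
    constructor
    · rintro ⟨y, hy, rfl⟩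
      refine ⟨f.map_source hy.2, ?_⟩
      change h' (f.symm (f (h (e.symm y)))) ∈ e.source
      rw [f.left_inv hy.2, hl]
      exact e.map_target hy.1
    · rintro ⟨hy, hy'⟩
      have h1 : h (e.symm (e (h' (f.symm y)))) = f.symm y := by rw [e.left_inv hy', hr]
      refine ⟨e (h' (f.symm y)), ⟨e.map_source hy', ?_⟩, ?_⟩
      · change h (e.symm (e (h' (f.symm y)))) ∈ f.source
        rw [h1]; exact f.map_target hy
      · change f (h (e.symm (e (h' (f.symm y))))) = y
        rw [h1, f.right_inv hy]
  have hinj : Set.InjOn φ A := by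
    intro y hy z hz hyz
    have h1 := f.injOn hy.2 hz.2 hyz
    have h2 := congrArg h' h1
    simp only [hl] at h2
    exact e.symm.injOn hy.1 hz.1 h2
  let De : Euc n → Euc n →L[ℝ] Euc n := fun y => mfderiv 𝓘(ℝ, Euc n) 𝓘(ℝ, Euc n) e.symm y
  let Dh : S → Euc n →L[ℝ] Euc n := fun x => mfderiv 𝓘(ℝ, Euc n) 𝓘(ℝ, Euc n) h x
  let Df : S → Euc n →L[ℝ] Euc n := fun x => mfderiv 𝓘(ℝ, Euc n) 𝓘(ℝ, Euc n) f x
  let Dfs : Euc n → Euc n →L[ℝ] Euc n := fun y => mfderiv 𝓘(ℝ, Euc n) 𝓘(ℝ, Euc n) f.symm y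
  let φ' : Euc n → Euc n →L[ℝ] Euc n := fun y =>
    (Df (h (e.symm y))).comp ((Dh (e.symm y)).comp (De y))
  have hDe : ∀ y ∈ A, HasMFDerivAt 𝓘(ℝ, Euc n) 𝓘(ℝ, Euc n) e.symm y (De y) := fun y hy =>
    (mdifferentiableAt_atlas_symm (chart_mem_atlas _ _) hy.1).hasMFDerivAt
  have hDh : ∀ y, HasMFDerivAt 𝓘(ℝ, Euc n) 𝓘(ℝ, Euc n) h (e.symm y) (Dh (e.symm y)) := fun y =>
    (hh.mdifferentiableAt (by norm_num)).hasMFDerivAt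
  have hDf : ∀ y ∈ A, HasMFDerivAt 𝓘(ℝ, Euc n) 𝓘(ℝ, Euc n) f (h (e.symm y)) (Df (h (e.symm y))) :=
    fun y hy => (mdifferentiableAt_atlas (chart_mem_atlas _ _) hy.2).hasMFDerivAt
  have hφ' : ∀ y ∈ A, HasFDerivAt φ (φ' y) y := fun y hy =>
    (HasMFDerivAt.comp y (hDf y hy) ((hDh y).comp y (hDe y hy))).hasFDerivAt
  have hdet : ∀ y ∈ A, 0 < (φ' y).det := fun y hy => by
    have h1 : (φ' y).det = (Df (h (e.symm y))).det * ((Dh (e.symm y)).det * (De y).det) := by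
      change LinearMap.det ((Df (h (e.symm y))).toLinearMap ∘ₗ
        ((Dh (e.symm y)).toLinearMap ∘ₗ (De y).toLinearMap)) = _
      rw [LinearMap.det_comp, LinearMap.det_comp]
    rw [h1]
    exact mul_pos (hS.det_mfderiv_chart_pos d hy.2)
      (mul_pos (ho _) (hS.det_mfderiv_chart_symm_pos c hy.1))
  have hDD : ∀ y ∈ A, ∀ w, Dfs (φ y) (φ' y w) = Dh (e.symm y) (De y w) := fun y hy w => by
    have h1 := (mdifferentiable_chart (I := 𝓘(ℝ, Euc n)) d).symm_comp_deriv hy.2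
    exact congrArg (fun L : Euc n →L[ℝ] Euc n => L (Dh (e.symm y) (De y w))) h1
  have hloc : ∀ y ∈ A, s (h (e.symm y)) * localDensity β c y =
      |(φ' y).det| • (s (f.symm (φ y)) * localDensity α d (φ y)) := fun y hy => by
    have h1 : f.symm (φ y) = h (e.symm y) := f.left_inv hy.2
    have h2 : localDensity β c y = (φ' y).det * localDensity α d (φ y) := by
      have h3 := ContinuousAlternatingMap.apply_map_single
        ((α (f.symm (φ y))).compContinuousLinearMap (Dfs (φ y))) (φ' y)
      refine Eq.trans ?_ h3
      refine (hαβ _ _).trans ?_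
      rw [h1]
      exact congrArg (α (h (e.symm y))) (funext fun i => (hDD y hy _).symm)
    -- Orientation is used here: forms transform by the determinant, Lebesgue integrals by its
    -- absolute value.
    rw [h2, h1, abs_of_pos (hdet y hy), smul_eq_mul]
    ring
  rw [setIntegral_eq_of_subset_of_forall_sdiff_eq_zero e.open_target.measurableSet hAe,
    setIntegral_congr_fun hA.measurableSet hloc,
    ← integral_image_eq_integral_abs_det_fderiv_smul volume hA.measurableSet
      (fun y hy => (hφ' y hy).hasFDerivWithinAt) hinj
      (fun y => s (f.symm y) * localDensity α d y), hφA]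
  · refine (setIntegral_eq_of_subset_of_forall_sdiff_eq_zero f.open_target.measurableSet
      Set.inter_subset_left fun y hy => ?_).symm
    by_cases h0 : s (f.symm y) = 0
    · rw [h0, zero_mul]
    · exact absurd ⟨hy.1, (hs _ h0).2⟩ hy.2
  · intro y hy
    by_cases h0 : s (h (e.symm y)) = 0
    · rw [h0, zero_mul]
    · exact absurd ⟨hy.1, (hs _ h0).1⟩ hy.2

/-- The integral of forms is invariant under orientation preserving diffeomorphisms. -/
theorem integralForm_comp [CompactSpace S] [T2Space S] (hS : OrientedAtlas n S) {h h' : S → S}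
    (hh : ContMDiff 𝓘(ℝ, Euc n) 𝓘(ℝ, Euc n) ∞ h) (hh' : Continuous h')
    (hl : ∀ x, h' (h x) = x) (hr : ∀ x, h (h' x) = x)
    (ho : OrientationPreserving n h) {α β : S → Euc n [⋀^Fin n]→L[ℝ] ℝ}
    (hαβ : ∀ x (w : Fin n → Euc n), β x w =
      α (h x) fun i => mfderiv 𝓘(ℝ, Euc n) 𝓘(ℝ, Euc n) h x (w i))
    (hα : ContinuousForm α) (hβ : ContinuousForm β) : integralForm β = integralForm α := by
  obtain ⟨T, hT, hT1⟩ := exists_finset_chartPartition n S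
  have hρ : ∀ c, Continuous (chartPartition n S c) := fun c =>
    (chartPartition n S c).contMDiff.continuous
  have hsrc : ∀ c x, chartPartition n S c x ≠ 0 → x ∈ (chartAt (Euc n) c).source := fun c x hx =>
    chartPartition_support_subset c (subset_tsupport _ hx)
  rw [integralForm_eq_sum hT, integralForm_eq_sum hT]
  -- Each side is split further by the partition transported through `h` or `h'`, so that every
  -- piece is supported in one chart on each side and the double sums match term by term.
  have h1 : ∀ c, ∫ y in (chartAt (Euc n) c).target,
      chartPartition n S c ((chartAt (Euc n) c).symm y) * localDensity β c y =
      ∑ d ∈ T, ∫ y in (chartAt (Euc n) c).target,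
        chartPartition n S c ((chartAt (Euc n) c).symm y) *
          (chartPartition n S d (h ((chartAt (Euc n) c).symm y)) * localDensity β c y) := by
    intro c
    rw [← integral_finsetSum]
    · refine integral_congr_ae (Filter.Eventually.of_forall fun y => ?_)
      change _ = ∑ d ∈ T, _
      rw [← Finset.mul_sum, ← Finset.sum_mul, hT1, one_mul]
    · intro d _
      exact integrableOn_chartPartition_mul c
        ((((hρ d).comp hh.continuous).comp_continuousOn
          (chartAt (Euc n) c).continuousOn_symm).mul (hβ c))
  have h2 : ∀ d, ∫ y in (chartAt (Euc n) d).target,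
      chartPartition n S d ((chartAt (Euc n) d).symm y) * localDensity α d y =
      ∑ c ∈ T, ∫ y in (chartAt (Euc n) d).target,
        chartPartition n S d ((chartAt (Euc n) d).symm y) *
          (chartPartition n S c (h' ((chartAt (Euc n) d).symm y)) * localDensity α d y) := by
    intro d
    rw [← integral_finsetSum]
    · refine integral_congr_ae (Filter.Eventually.of_forall fun y => ?_)
      change _ = ∑ c ∈ T, _
      rw [← Finset.mul_sum, ← Finset.sum_mul, hT1, one_mul]
    · intro c _
      exact integrableOn_chartPartition_mul d
        ((((hρ c).comp hh').comp_continuousOn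
          (chartAt (Euc n) d).continuousOn_symm).mul (hα d))
  simp only [h1, h2]
  rw [Finset.sum_comm]
  refine Finset.sum_congr rfl fun d _ => Finset.sum_congr rfl fun c _ => ?_
  have key := integral_localDensity_comp hS hh hl hr ho hαβ c d
    (s := fun x => chartPartition n S d x * chartPartition n S c (h' x))
    fun x hx => ⟨hsrc d x (left_ne_zero_of_mul hx), hsrc c _ (right_ne_zero_of_mul hx)⟩
  simp only [hl] at key
  refine Eq.trans ?_ (key.trans ?_)
  · congr 1; funext y; ring
  · congr 1; funext y; ring

end ChangeOfVariables

/-! ### `Ω_τ` as the integral of a pointwise form, and its invariance. -/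

section CanonicalAction

open LieGroupExp

variable {n k : ℕ} {X Y S : Type*}
  [TopologicalSpace X] [ChartedSpace (Euc (n + 1)) X] [IsManifold 𝓘(ℝ, Euc (n + 1)) ∞ X]
  [TopologicalSpace Y] [ChartedSpace (Euc k) Y] [IsManifold 𝓘(ℝ, Euc k) ∞ Y]
  [TopologicalSpace S] [ChartedSpace (Euc n) S] [IsManifold 𝓘(ℝ, Euc n) ∞ S]
  {π : Y → X} {τ : S → X}

theorem contDiffOn_pullTheta_apply {Q : Type*} [NormedAddCommGroup Q] [NormedSpace ℝ Q]
    {f : Q → Multiphase n k π} {U : Set Q} (hU : IsOpen U)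
    (hf : Multiphase.SmoothOn 𝓘(ℝ, Q) f U) (v : Fin (n + 1) → Q) :
    ContDiffOn ℝ ∞ (fun q => Multiphase.pullTheta f q v) U := by
  refine contMDiffOn_iff_contDiffOn.1 ?_
  refine Multiphase.form_apply_smooth hf
    (fun i q => mfderiv 𝓘(ℝ, Q) 𝓘(ℝ, Euc k) (fun q => (f q).pt) q (v i)) fun i => ?_
  exact contMDiffOn_mfderiv_field (g := fun q => (f q).pt) hU (Multiphase.pt_smooth hf)
    (φ := fun q => q) (u := fun _ => v i)
    (contMDiffOn_field_vectorSpace_iff.2 ⟨contMDiffOn_id, contMDiffOn_const⟩) fun _ hq => hq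

namespace ZSection

variable {P : Type} [NormedAddCommGroup P] [NormedSpace ℝ P]

/-- The `n`-form on `S` whose integral is the value of `Θ_τ` on the variation of the family `F` in
the direction `b`. -/
def thetaForm (F : P → ZSection n k π τ) (b q : P) (x : S) : Euc n [⋀^Fin n]→L[ℝ] ℝ :=
  (((F q).toFun x).form.curryLeft
      (mfderiv 𝓘(ℝ, P) 𝓘(ℝ, Euc k) (fun q => ((F q).toFun x).pt) q b : Euc k)
    ).compContinuousLinearMap
      (mfderiv 𝓘(ℝ, Euc n) 𝓘(ℝ, Euc k) (fun y => ((F q).toFun y).pt) x : Euc n →L[ℝ] Euc k)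

/-- The `n`-form on `S` whose integral is the value of `Ω_τ` on the variations of the family `F` in
the directions `a` and `b`. -/
def omegaForm (F : P → ZSection n k π τ) (p a b : P) (x : S) : Euc n [⋀^Fin n]→L[ℝ] ℝ :=
  -(fderiv ℝ (fun q => thetaForm F b q x) p a - fderiv ℝ (fun q => thetaForm F a q x) p b)

/-- A family of sections in a parametrization `ψ` of `S`. -/
def pullback (F : P → ZSection n k π τ) (ψ : Euc n → S) (m : P × Euc n) : Multiphase n k π :=
  (F m.1).toFun (ψ m.2)

variable [CompactSpace S] [T2Space S] {F : P → ZSection n k π τ} {ψ : Euc n → S} {W : Set (Euc n)}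

theorem smoothOn_pullback (hF : FieldSpace.IsFamily F)
    (hψ : ContMDiffOn 𝓘(ℝ, Euc n) 𝓘(ℝ, Euc n) ∞ ψ W) :
    Multiphase.SmoothOn 𝓘(ℝ, P × Euc n) (pullback F ψ) (Set.univ ×ˢ W) :=
  Multiphase.SmoothOn.comp (f := fun q : P × S => (F q.1).toFun q.2) hF
    (g := fun m : P × Euc n => (m.1, ψ m.2))
    (contDiff_fst.contMDiff.contMDiffOn.prodMk (hψ.comp contDiff_snd.contMDiff.contMDiffOn
      fun _ hm => hm.2)) fun _ _ => Set.mem_univ _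

/-- A family of sections, read through a parametrization of `S`, is a map from a vector space to
`Z`. In it `(b, 0)` represents the variation and `(0, w)` the tangent vectors of the section, so
`σ^*(i_V Θ)` is a value of the pull-back of `Θ`. -/
theorem pullTheta_pullback (hF : FieldSpace.IsFamily F)
    (hψ : ContMDiffOn 𝓘(ℝ, Euc n) 𝓘(ℝ, Euc n) ∞ ψ W) (hW : IsOpen W) (q b : P) {u : Euc n}
    (hu : u ∈ W) (w : Fin n → Euc n) :
    Multiphase.pullTheta (pullback F ψ) (q, u) (Fin.cons (b, 0) fun i => (0, w i)) =
      thetaForm F b q (ψ u) fun i => mfderiv 𝓘(ℝ, Euc n) 𝓘(ℝ, Euc n) ψ u (w i) := by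
  have hpt : MDifferentiableAt 𝓘(ℝ, P × Euc n) 𝓘(ℝ, Euc k) (fun m => (pullback F ψ m).pt) (q, u) :=
    ((Multiphase.pt_smooth (smoothOn_pullback hF hψ)).contMDiffAt
      ((isOpen_univ.prod hW).mem_nhds ⟨trivial, hu⟩)).mdifferentiableAt (by norm_num)
  have h1 : ∀ b : P, mfderiv 𝓘(ℝ, P) 𝓘(ℝ, Euc k) (fun q => ((F q).toFun (ψ u)).pt) q b =
      (mfderiv 𝓘(ℝ, P × Euc n) 𝓘(ℝ, Euc k) (fun m => (pullback F ψ m).pt) (q, u) :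
        P × Euc n →L[ℝ] Euc k) (b, 0) := fun b => by
    have h2 := HasMFDerivAt.comp q (f := fun q : P => (q, u)) hpt.hasMFDerivAt
      (hasFDerivAt_prodMk_left q u).hasMFDerivAt
    exact congrArg (fun L : P →L[ℝ] Euc k => L b) h2.mfderiv
  have h2 : ∀ w : Euc n, mfderiv 𝓘(ℝ, Euc n) 𝓘(ℝ, Euc k) (fun y => ((F q).toFun y).pt) (ψ u)
      (mfderiv 𝓘(ℝ, Euc n) 𝓘(ℝ, Euc n) ψ u w) =
      (mfderiv 𝓘(ℝ, P × Euc n) 𝓘(ℝ, Euc k) (fun m => (pullback F ψ m).pt) (q, u) :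
        P × Euc n →L[ℝ] Euc k) (0, w) := fun w => by
    have h3 := HasMFDerivAt.comp u (f := fun u : Euc n => (q, u)) hpt.hasMFDerivAt
      (hasFDerivAt_prodMk_right q u).hasMFDerivAt
    have h4 := mfderiv_comp u (g := fun y => ((F q).toFun y).pt) (f := ψ)
      ((F q).smooth_pt.mdifferentiableAt (by norm_num))
      ((hψ.contMDiffAt (hW.mem_nhds hu)).mdifferentiableAt (by norm_num))
    exact congrArg (fun L : Euc n →L[ℝ] Euc k => L w) (h4.symm.trans h3.mfderiv)
  change ((F q).toFun (ψ u)).form (fun i => _) = ((F q).toFun (ψ u)).form (Fin.cons _ fun i => _)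
  congr 1
  funext i
  refine Fin.cases ?_ (fun l => ?_) i
  · exact (h1 b).symm
  · exact (h2 (w l)).symm

theorem contMDiffOn_chartAt_symm (c : S) : ContMDiffOn 𝓘(ℝ, Euc n) 𝓘(ℝ, Euc n) ∞
    (chartAt (Euc n) c).symm (chartAt (Euc n) c).target :=
  contMDiffOn_chart_symm (I := 𝓘(ℝ, Euc n)) (x := c)

/-- The derivative of an inverse chart is surjective. -/
theorem mfderiv_chart_symm_mfderiv_chart (x : S) (w : Euc n) :
    (mfderiv 𝓘(ℝ, Euc n) 𝓘(ℝ, Euc n) (chartAt (Euc n) x).symm (chartAt (Euc n) x x)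
      (mfderiv 𝓘(ℝ, Euc n) 𝓘(ℝ, Euc n) (chartAt (Euc n) x) x w) : Euc n) = w := by
  have h1 := (mdifferentiable_chart (I := 𝓘(ℝ, Euc n)) x).symm_comp_deriv (mem_chart_source _ x)
  exact congrArg (fun L : Euc n →L[ℝ] Euc n => L w) h1

theorem differentiable_thetaForm (hF : FieldSpace.IsFamily F) (b : P) (x : S) :
    Differentiable ℝ fun q => thetaForm F b q x := by
  have h1 : ContMDiff 𝓘(ℝ, P) 𝓘(ℝ, Euc n [⋀^Fin n]→L[ℝ] ℝ) ∞ (fun q => thetaForm F b q x) := by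
    refine contMDiffOn_univ.1 fun q _ => contMDiffWithinAt_alternating_of_apply fun w => ?_
    set u := chartAt (Euc n) x x with hu
    have hut : u ∈ (chartAt (Euc n) x).target := mem_chart_target _ _
    have h2 : (fun q => thetaForm F b q x w) = fun q => Multiphase.pullTheta
        (pullback F (chartAt (Euc n) x).symm) (q, u) (Fin.cons (b, 0) fun i =>
          (0, mfderiv 𝓘(ℝ, Euc n) 𝓘(ℝ, Euc n) (chartAt (Euc n) x) x (w i))) := by
      funext q
      refine Eq.trans ?_ (pullTheta_pullback hF (contMDiffOn_chartAt_symm x)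
        (chartAt (Euc n) x).open_target q b hut _).symm
      rw [hu, (chartAt (Euc n) x).left_inv (mem_chart_source _ x)]
      exact congrArg (thetaForm F b q x)
        (funext fun i => (mfderiv_chart_symm_mfderiv_chart x (w i)).symm)
    rw [h2]
    refine ContDiffOn.contMDiffOn (s := Set.univ) ?_ q trivial
    exact (contDiffOn_pullTheta_apply (isOpen_univ.prod (chartAt (Euc n) x).open_target)
      (smoothOn_pullback hF (contMDiffOn_chartAt_symm x)) _).comp
      (contDiff_prodMk_left u).contDiffOn fun q _ => ⟨trivial, hut⟩
  exact h1.contDiff.differentiable (by norm_num)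

theorem contDiffOn_localDensity_thetaForm (hF : FieldSpace.IsFamily F) (b : P) (c : S) :
    ContDiffOn ℝ ∞ (fun m : P × Euc n => localDensity (thetaForm F b m.1) c m.2)
      (Set.univ ×ˢ (chartAt (Euc n) c).target) :=
  (contDiffOn_pullTheta_apply (isOpen_univ.prod (chartAt (Euc n) c).open_target)
    (smoothOn_pullback hF (contMDiffOn_chartAt_symm c))
    (Fin.cons (b, 0) fun i => (0, EuclideanSpace.single i 1))).congr fun m hm =>
      (pullTheta_pullback hF (contMDiffOn_chartAt_symm c) (chartAt (Euc n) c).open_target m.1 b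
        hm.2 _).symm

theorem twoForm_eq_integralForm [FiniteDimensional ℝ P] (hF : FieldSpace.IsFamily F) (p a b : P) :
    ContinuousForm (omegaForm F p a b) ∧
      FieldSpace.twoForm F p a b = integralForm (omegaForm F p a b) := by
  have h := fun b => (hasFDerivAt_integralForm (contDiffOn_localDensity_thetaForm hF b)
    (differentiable_thetaForm hF b) p).2
  obtain ⟨hc1, h1⟩ := h b a
  obtain ⟨hc2, h2⟩ := h a b
  refine ⟨fun c => ((hc1 c).sub (hc2 c)).neg, ?_⟩
  change -(fderiv ℝ (fun q => integralForm (thetaForm F b q)) p a -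
    fderiv ℝ (fun q => integralForm (thetaForm F a q)) p b) = _
  rw [h1, h2, ← integralForm_sub hc1 hc2, ← integralForm_neg]
  rfl

/-- All the sections cover the same `τ`, so variations are vertical and `Θ` vanishes on pairs of
them. In `dΘ` the terms differentiating along `S` therefore drop out, and the two parameter
derivatives that remain are those of the definition of `Ω_τ`. -/
theorem pullOmega_pullback (hπ : IsSubmersion 𝓘(ℝ, Euc k) 𝓘(ℝ, Euc (n + 1)) ∞ π)
    (hF : FieldSpace.IsFamily F)
    (hψ : ContMDiffOn 𝓘(ℝ, Euc n) 𝓘(ℝ, Euc n) ∞ ψ W) (hW : IsOpen W) (p a b : P) {u : Euc n}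
    (hu : u ∈ W) (w : Fin n → Euc n) :
    Multiphase.pullOmega (pullback F ψ) (p, u)
      (Fin.cons (a, 0) (Fin.cons (b, 0) fun i => (0, w i))) =
      omegaForm F p a b (ψ u) fun i => mfderiv 𝓘(ℝ, Euc n) 𝓘(ℝ, Euc n) ψ u (w i) := by
  have hs := smoothOn_pullback hF hψ
  have hU : IsOpen (Set.univ ×ˢ W : Set (P × Euc n)) := isOpen_univ.prod hW
  have hmem : (p, u) ∈ (Set.univ ×ˢ W : Set (P × Euc n)) := ⟨trivial, hu⟩
  obtain ⟨A, hA⟩ := exists_adaptedChart hπ (pullback F ψ (p, u)).pt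
  have hd : DifferentiableAt ℝ (Multiphase.pullTheta (pullback F ψ)) (p, u) :=
    A.differentiableAt_pullTheta
      ((Multiphase.pt_smooth hs).continuousOn.isOpen_inter_preimage hU A.chart.open_source)
      (ContMDiffOn.mono hs Set.inter_subset_left) (fun _ hm => hm.2) ⟨hmem, hA⟩
  have hvert : ∀ m ∈ (Set.univ ×ˢ W : Set (P × Euc n)), ∀ a : P,
      (mfderiv 𝓘(ℝ, P × Euc n) 𝓘(ℝ, Euc k) (fun m => (pullback F ψ m).pt) m :
        P × Euc n →L[ℝ] Euc k) (a, 0) ∈ vert n k π (pullback F ψ m).pt := by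
    rintro ⟨q, u⟩ hm a
    have hpt : MDifferentiableAt 𝓘(ℝ, P × Euc n) 𝓘(ℝ, Euc k) (fun m => (pullback F ψ m).pt)
        (q, u) := ((Multiphase.pt_smooth hs).contMDiffAt (hU.mem_nhds hm)).mdifferentiableAt
          (by norm_num)
    have h2 := HasMFDerivAt.comp q (f := fun q : P => (q, u)) hpt.hasMFDerivAt
      (hasFDerivAt_prodMk_left q u).hasMFDerivAt
    have h3 := variation_mem_vert (n := n) (k := k) (π := π) (h := fun q => ((F q).toFun (ψ u)).pt)
      (fun q => (F q).covers (ψ u)) q a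
    have h4 := congrArg (fun L : P →L[ℝ] Euc k => L a) h2.mfderiv
    exact h4 ▸ h3
  rw [pullOmega_cons_cons_of_forall hd]
  · have hder : ∀ a b : P, fderiv ℝ (fun m => Multiphase.pullTheta (pullback F ψ) m
        (Fin.cons (b, 0) fun i => (0, w i))) (p, u) (a, 0) =
        fderiv ℝ (fun q => thetaForm F b q (ψ u)) p a
          fun i => mfderiv 𝓘(ℝ, Euc n) 𝓘(ℝ, Euc n) ψ u (w i) := by
      intro a b
      have h1 := HasFDerivAt.comp p (f := fun q : P => (q, u))
        ((((contDiffOn_pullTheta_apply hU hs (Fin.cons (b, 0) fun i => (0, w i))).contDiffAt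
          (hU.mem_nhds hmem)).differentiableAt (by norm_num)).hasFDerivAt)
        (hasFDerivAt_prodMk_left p u)
      have h2 := fderiv_continuousAlternatingMap_apply_const_apply
        (differentiable_thetaForm hF b (ψ u) p)
        (fun i => mfderiv 𝓘(ℝ, Euc n) 𝓘(ℝ, Euc n) ψ u (w i)) a
      rw [← h2]
      have h3 : ((fun m => Multiphase.pullTheta (pullback F ψ) m
          (Fin.cons (b, 0) fun i => (0, w i))) ∘ fun q : P => (q, u)) =
          fun q => thetaForm F b q (ψ u) fun i => mfderiv 𝓘(ℝ, Euc n) 𝓘(ℝ, Euc n) ψ u (w i) :=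
        funext fun q => pullTheta_pullback hF hψ hW q b hu w
      rw [h3] at h1
      exact (congrArg (fun L : P →L[ℝ] ℝ => L a) h1.fderiv).symm
    rw [hder, hder]
    rfl
  · filter_upwards [hU.mem_nhds hmem] with m hm
    rintro v ⟨i, j, hij, hi, hj⟩
    refine (pullback F ψ m).form_eq_zero hij ?_ ?_
    · change (mfderiv 𝓘(ℝ, P × Euc n) 𝓘(ℝ, Euc k) (fun m => (pullback F ψ m).pt) m :
        P × Euc n →L[ℝ] Euc k) (v i) ∈ _
      rw [hi]; exact hvert m hm a
    · change (mfderiv 𝓘(ℝ, P × Euc n) 𝓘(ℝ, Euc k) (fun m => (pullback F ψ m).pt) m :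
        P × Euc n →L[ℝ] Euc k) (v j) ∈ _
      rw [hj]; exact hvert m hm b

end ZSection

variable {G 𝔤 : Type*} [Group G] [LieRing 𝔤] [LieAlgebra ℝ 𝔤] [TopologicalSpace 𝔤]
  [ContinuousSMul ℝ 𝔤] [LieGroupExp G 𝔤] [MulAction G X] [MulAction G (Multiphase n k π)]

/-- The integrand for the transformed family, pulled back by `η_τ`, equals the original integrand by
invariance of `Ω` on `Z`; the integrals agree because `η_τ` preserves orientation. -/
theorem preservesTwoForm_actZ [CompactSpace S] [T2Space S] (hS : OrientedAtlas n S)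
    (hπ : IsSubmersion 𝓘(ℝ, Euc k) 𝓘(ℝ, Euc (n + 1)) ∞ π)
    (hτ : IsSmoothEmbedding 𝓘(ℝ, Euc n) 𝓘(ℝ, Euc (n + 1)) ∞ τ)
    (hG : ActsCanonically n k π G 𝔤) (η : stab τ G) (hη : OrientationPreserving n (etaTau η)) :
    FieldSpace.PreservesTwoForm (fun σ : ZSection n k π τ => actZ hτ hG η σ) := by
  intro P _ _ _ F hF p a b
  have hinj := hτ.isEmbedding.injective
  have hηF : FieldSpace.IsFamily fun q => actZ hτ hG η (F q) := smoothMap_actZ hτ hG η P F hF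
  obtain ⟨hc, h1⟩ := ZSection.twoForm_eq_integralForm hF p a b
  obtain ⟨hc', h1'⟩ := ZSection.twoForm_eq_integralForm hηF p a b
  rw [h1, h1']
  have hh := etaTau_smooth hτ hG η
  refine (integralForm_comp hS hh (etaTau_smooth hτ hG η⁻¹).continuous
    (etaTau_inv_etaTau hinj η) (etaTau_etaTau_inv hinj η) hη (fun x w => ?_) hc' hc).symm
  set e := chartAt (Euc n) x with he
  have hx : e x ∈ e.target := mem_chart_target _ _
  have hex : e.symm (e x) = x := e.left_inv (mem_chart_source _ x)
  have hes := ZSection.contMDiffOn_chartAt_symm (n := n) x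
  have hhe : ContMDiffOn 𝓘(ℝ, Euc n) 𝓘(ℝ, Euc n) ∞ (etaTau η ∘ e.symm) e.target :=
    hh.comp_contMDiffOn hes
  -- Parametrizing `S` by `η_τ ∘ e.symm` cancels the `η_τ⁻¹` in the action and leaves composition
  -- with `η` on `Z` alone.
  have hpull : ZSection.pullback (fun q => actZ hτ hG η (F q)) (etaTau η ∘ e.symm) =
      fun m => η.1 • ZSection.pullback F e.symm m := by
    funext m
    change η.1 • (F m.1).toFun (etaTau η⁻¹ (etaTau η (e.symm m.2))) = _
    rw [etaTau_inv_etaTau hinj]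
    rfl
  let w' : Fin n → Euc n := fun i => mfderiv 𝓘(ℝ, Euc n) 𝓘(ℝ, Euc n) e x (w i)
  have h2 := ZSection.pullOmega_pullback hπ hF hes e.open_target p a b hx w'
  have h3 := ZSection.pullOmega_pullback hπ hηF hhe e.open_target p a b hx w'
  rw [hpull, (hG.canonical η.1).pullOmega_eq (hG.smooth_Z η.1) hπ (isOpen_univ.prod e.open_target)
    (ZSection.smoothOn_pullback hF hes) ⟨trivial, hx⟩, h2] at h3
  have hw : ∀ i, (mfderiv 𝓘(ℝ, Euc n) 𝓘(ℝ, Euc n) e.symm (e x) (w' i) : Euc n) = w i := fun i =>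
    ZSection.mfderiv_chart_symm_mfderiv_chart x (w i)
  have hD : ∀ i, (mfderiv 𝓘(ℝ, Euc n) 𝓘(ℝ, Euc n) (etaTau η ∘ e.symm) (e x) (w' i) : Euc n) =
      mfderiv 𝓘(ℝ, Euc n) 𝓘(ℝ, Euc n) (etaTau η) x (w i) := fun i => by
    have h4 := mfderiv_comp (e x) (g := etaTau η) (f := e.symm)
      (hh.mdifferentiableAt (by norm_num))
      (mdifferentiableAt_atlas_symm (chart_mem_atlas _ _) hx)
    have h5 := congrArg (fun L : Euc n →L[ℝ] Euc n => L (w' i)) h4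
    refine h5.trans ?_
    change (mfderiv 𝓘(ℝ, Euc n) 𝓘(ℝ, Euc n) (etaTau η) (e.symm (e x)) : Euc n →L[ℝ] Euc n)
      (mfderiv 𝓘(ℝ, Euc n) 𝓘(ℝ, Euc n) e.symm (e x) (w' i)) = _
    rw [hex]
    exact congrArg (mfderiv 𝓘(ℝ, Euc n) 𝓘(ℝ, Euc n) (etaTau η) x : Euc n →L[ℝ] Euc n) (hw i)
  have e1 : (fun i => (mfderiv 𝓘(ℝ, Euc n) 𝓘(ℝ, Euc n) e.symm (e x) (w' i) : Euc n)) = w :=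
    funext hw
  have e2 := funext hD
  refine Eq.trans ?_ (h3.trans ?_)
  · rw [hex]
    exact (congrArg (ZSection.omegaForm F p a b x) e1).symm
  · refine (congrArg (ZSection.omegaForm _ p a b _) e2).trans ?_
    change ZSection.omegaForm _ p a b (etaTau η (e.symm (e x))) _ = _
    rw [hex]

end CanonicalAction

/-! ### Descent of the action and of momentum maps through `R_τ`. -/

theorem R_actZ_congr {n k : ℕ} {X Y S : Type*}
    [TopologicalSpace X] [ChartedSpace (Euc (n + 1)) X] [IsManifold 𝓘(ℝ, Euc (n + 1)) ∞ X]
    [TopologicalSpace Y] [ChartedSpace (Euc k) Y] [IsManifold 𝓘(ℝ, Euc k) ∞ Y]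
    [TopologicalSpace S] [ChartedSpace (Euc n) S] [IsManifold 𝓘(ℝ, Euc n) ∞ S]
    {π : Y → X} {τ : S → X}
    {G 𝔤 : Type*} [Group G] [LieRing 𝔤] [LieAlgebra ℝ 𝔤] [TopologicalSpace 𝔤]
    [ContinuousSMul ℝ 𝔤] [LieGroupExp G 𝔤] [MulAction G X] [MulAction G (Multiphase n k π)]
    (hπ : IsSubmersion 𝓘(ℝ, Euc k) 𝓘(ℝ, Euc (n + 1)) ∞ π)
    (hτ : IsSmoothEmbedding 𝓘(ℝ, Euc n) 𝓘(ℝ, Euc (n + 1)) ∞ τ)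
    (hG : ActsCanonically n k π G 𝔤) (η : stab τ G) {σ σ' : ZSection n k π τ} (h : R σ = R σ') :
    R (actZ hτ hG η σ) = R (actZ hτ hG η σ') := by
  rw [R_eq_iff hπ.contMDiff] at h ⊢
  intro x
  have h1 := relatedAt_smul hπ hτ hG η (σ.covers _) (h (etaTau η⁻¹ x))
  rwa [etaTau_etaTau_inv hτ.isEmbedding.injective] at h1

theorem ContMDiff.comp_prod_left {P P' S N : Type*} [NormedAddCommGroup P] [NormedSpace ℝ P]
    [NormedAddCommGroup P'] [NormedSpace ℝ P'] {n k : ℕ}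
    [TopologicalSpace S] [ChartedSpace (Euc n) S] [TopologicalSpace N] [ChartedSpace (Euc k) N]
    {Φ : P' × S → N} (hΦ : ContMDiff (𝓘(ℝ, P').prod 𝓘(ℝ, Euc n)) 𝓘(ℝ, Euc k) ∞ Φ) {g : P → P'}
    (hg : ContDiff ℝ ∞ g) :
    ContMDiff (𝓘(ℝ, P).prod 𝓘(ℝ, Euc n)) 𝓘(ℝ, Euc k) ∞ (fun q : P × S => Φ (g q.1, q.2)) :=
  hΦ.comp ((hg.contMDiff.comp contMDiff_fst).prodMk contMDiff_snd)

/-- `Ω_τ` vanishes on a generator of the action and a direction tangent to a fibre of `R_τ`. -/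
theorem twoForm_orbit_eq_zero {n k : ℕ} {X Y S : Type*}
    [TopologicalSpace X] [ChartedSpace (Euc (n + 1)) X] [IsManifold 𝓘(ℝ, Euc (n + 1)) ∞ X]
    [TopologicalSpace Y] [ChartedSpace (Euc k) Y] [IsManifold 𝓘(ℝ, Euc k) ∞ Y]
    [TopologicalSpace S] [ChartedSpace (Euc n) S] [IsManifold 𝓘(ℝ, Euc n) ∞ S]
    [CompactSpace S] [T2Space S] {π : Y → X} {τ : S → X}
    {G 𝔤 : Type*} [Group G] [LieRing 𝔤] [LieAlgebra ℝ 𝔤] [TopologicalSpace 𝔤]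
    [ContinuousSMul ℝ 𝔤] [LieGroupExp G 𝔤] [MulAction G X] [MulAction G (Multiphase n k π)]
    (hπ : IsSubmersion 𝓘(ℝ, Euc k) 𝓘(ℝ, Euc (n + 1)) ∞ π)
    (hτ : IsSmoothEmbedding 𝓘(ℝ, Euc n) 𝓘(ℝ, Euc (n + 1)) ∞ τ)
    (hG : ActsCanonically n k π G 𝔤) {𝔤τ : LieSubalgebra ℝ 𝔤}
    (h𝔤τ : IsLieAlgebraOf 𝔤τ (stab τ G)) (ξ : 𝔤τ) {F : ℝ → ZSection n k π τ}
    (hRF : ∀ t, R (F t) = R (F 0)) (t : ℝ) :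
    FieldSpace.twoForm (fun q : ℝ × ℝ => R (actZ hτ hG (expτ h𝔤τ ξ q.1) (F q.2))) (0, t) (1, 0)
      (0, 1) = 0 := by
  have h1 : (fun q : ℝ × ℝ => R (actZ hτ hG (expτ h𝔤τ ξ q.1) (F q.2))) =
      fun q => R (actZ hτ hG (expτ h𝔤τ ξ q.1) (F 0)) :=
    funext fun q => R_actZ_congr hπ hτ hG _ (hRF q.2)
  have hF0 : FieldSpace.IsFamily (fun _ : ℝ => F 0) :=
    Multiphase.SmoothOn.comp (F 0).smooth (contMDiff_snd (I := 𝓘(ℝ, ℝ))).contMDiffOn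
      fun _ _ => Set.mem_univ _
  have h2 := (smoothMap_R _ _ (smoothFlow_actZ hτ hG h𝔤τ ξ ℝ _ hF0)).1
  have h3 := h2.comp_prod_left (contDiff_prodMk_left (𝕜 := ℝ) (0 : ℝ))
  rw [h1]
  exact twoForm_comp_fst (f := fun r : ℝ => R (actZ hτ hG (expτ h𝔤τ ξ r) (F 0))) h3 (0, t) 1 1

theorem proposition7p5 {n k : ℕ} {X Y S : Type*}
    [TopologicalSpace X] [ChartedSpace (Euc (n + 1)) X]
    [IsManifold 𝓘(ℝ, Euc (n + 1)) ∞ X] [T2Space X] [SecondCountableTopology X]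
    [TopologicalSpace Y] [ChartedSpace (Euc k) Y]
    [IsManifold 𝓘(ℝ, Euc k) ∞ Y] [T2Space Y] [SecondCountableTopology Y]
    [TopologicalSpace S] [ChartedSpace (Euc n) S]
    [IsManifold 𝓘(ℝ, Euc n) ∞ S] [T2Space S] [CompactSpace S] [ConnectedSpace S]
    (hS : OrientedAtlas n S)
    (π : Y → X) (hπ : IsSubmersion 𝓘(ℝ, Euc k) 𝓘(ℝ, Euc (n + 1)) ∞ π)
    (τ : S → X) (hτ : IsSmoothEmbedding 𝓘(ℝ, Euc n) 𝓘(ℝ, Euc (n + 1)) ∞ τ)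
    {G 𝔤 : Type*} [Group G] [LieRing 𝔤] [LieAlgebra ℝ 𝔤] [TopologicalSpace 𝔤]
    [ContinuousSMul ℝ 𝔤] [LieGroupExp G 𝔤]
    [MulAction G X] [MulAction G (Multiphase n k π)] (hG : ActsCanonically n k π G 𝔤)
    (𝔤τ : LieSubalgebra ℝ 𝔤) (h𝔤τ : IsLieAlgebraOf 𝔤τ (stab τ G)) :
    Function.Surjective (R : ZSection n k π τ → CotSection n k π τ) ∧
    ∃ A : stab τ G →* Equiv.Perm (CotSection n k π τ),
      -- the action of `𝒢_τ` on `𝒵_τ` descends through `R_τ` to the smooth action `A` on `T^*𝒴_τ`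
      (∀ (η : stab τ G) (σ : ZSection n k π τ), A η (R σ) = R (actZ hτ hG η σ)) ∧
      (∀ η : stab τ G, FieldSpace.SmoothMap (fun x : CotSection n k π τ => A η x)) ∧
      FieldSpace.SmoothFlow (fun (ξ : 𝔤τ) t (x : CotSection n k π τ) => A (expτ h𝔤τ ξ t) x) ∧
      -- which is canonical
      (∀ η : stab τ G, OrientationPreserving n (etaTau η) →
        FieldSpace.PreservesTwoForm (fun x : CotSection n k π τ => A η x)) ∧
      -- and momentum maps for the action on `𝒵_τ` descend to momentum maps for `A`
      ∀ J : ZSection n k π τ → (𝔤τ →L[ℝ] ℝ),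
        FieldSpace.IsMomentumMap (fun ξ t σ => actZ hτ hG (expτ h𝔤τ ξ t) σ) J →
        ∃ 𝒥 : CotSection n k π τ → (𝔤τ →L[ℝ] ℝ),
          (∀ σ, 𝒥 (R σ) = J σ) ∧
          (∀ 𝒥' : CotSection n k π τ → (𝔤τ →L[ℝ] ℝ), (∀ σ, 𝒥' (R σ) = J σ) → 𝒥' = 𝒥) ∧
          FieldSpace.IsMomentumMap (fun ξ t x => A (expτ h𝔤τ ξ t) x) 𝒥 ∧
          (AdEquivariant h𝔤τ (fun η σ => actZ hτ hG η σ) J →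
            AdEquivariant h𝔤τ (fun η x => A η x) 𝒥) := by
  have hsurj : Function.Surjective (R : ZSection n k π τ → CotSection n k π τ) :=
    R_surjective hπ hτ.isImmersion
  refine ⟨hsurj, ?_⟩
  -- An arbitrary, possibly non-smooth choice of preimages: the results do not depend on it, and
  -- smoothness is obtained from family lifts instead.
  let s := Function.surjInv hsurj
  have hs : ∀ x, R (s x) = x := Function.surjInv_eq hsurj
  let a : stab τ G → CotSection n k π τ → CotSection n k π τ := fun η x => R (actZ hτ hG η (s x))
  have ha : ∀ η σ, a η (R σ) = R (actZ hτ hG η σ) :=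
    fun η σ => R_actZ_congr hπ hτ hG η (hs (R σ))
  have ha_mul : ∀ η η' x, a (η * η') x = a η (a η' x) := by
    intro η η' x
    obtain ⟨σ, rfl⟩ := hsurj x
    rw [ha (η * η') σ, ha η' σ, ha η, actZ_mul]
  have ha_one : ∀ x, a 1 x = x := by
    intro x
    obtain ⟨σ, rfl⟩ := hsurj x
    rw [ha 1 σ, actZ_one]
  let A : stab τ G →* Equiv.Perm (CotSection n k π τ) :=
    { toFun := fun η => ⟨a η, a η⁻¹,
        fun x => by rw [← ha_mul, inv_mul_cancel, ha_one],
        fun x => by rw [← ha_mul, mul_inv_cancel, ha_one]⟩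
      map_one' := Equiv.ext ha_one
      map_mul' := fun η η' => Equiv.ext (ha_mul η η') }
  have hA : ∀ η σ, A η (R σ) = R (actZ hτ hG η σ) := ha
  have hflow : FieldSpace.SmoothFlow
      (fun (ξ : 𝔤τ) t (x : CotSection n k π τ) => A (expτ h𝔤τ ξ t) x) := by
    intro ξ P _ _ _ f hf
    obtain ⟨F, hF, hRF⟩ := exists_family_lift hπ hτ.isImmersion hf
    have h1 := smoothMap_R _ _ (smoothFlow_actZ hτ hG h𝔤τ ξ P F hF)
    simpa only [← hA, hRF] using h1
  refine ⟨A, hA, ?_, hflow, ?_, ?_⟩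
  · intro η P _ _ _ f hf
    obtain ⟨F, hF, hRF⟩ := exists_family_lift hπ hτ.isImmersion hf
    have h1 := smoothMap_R _ _ (smoothMap_actZ hτ hG η P F hF)
    simpa only [← hA, hRF] using h1
  · intro η hη P _ _ _ f hf p u v
    obtain ⟨F, hF, hRF⟩ := exists_family_lift hπ hτ.isImmersion hf
    obtain rfl : (fun p => R (F p)) = f := funext hRF
    have h1 := preservesTwoForm_actZ hS hπ hτ hG η hη P F hF p u v
    simp only [hA]
    rw [twoForm_R, twoForm_R]
    exact h1
  · intro J hJ
    -- Along a family in the fibre joining `σ` to `σ'`, the momentum identity gives the derivative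
    -- of `⟨J, ξ⟩` as `Ω_τ` on the generator and a direction that `R_τ` collapses, hence zero.
    have hconst : ∀ σ σ', R σ = R σ' → J σ = J σ' := by
      intro σ σ' h
      obtain ⟨F, hF, rfl, rfl, hRF⟩ := exists_isFamily_joining hπ.contMDiff h
      ext ξ
      obtain ⟨hd, hJ'⟩ := hJ ξ ℝ F hF
      refine is_const_of_fderiv_eq_zero (𝕜 := ℝ) (hd.differentiable (by norm_num)) (fun t => ?_) 0 1
      ext
      rw [hJ', ← twoForm_R]
      exact twoForm_orbit_eq_zero hπ hτ hG h𝔤τ ξ hRF t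
    have hJs : ∀ σ, J (s (R σ)) = J σ := fun σ => hconst _ _ (hs (R σ))
    refine ⟨fun x => J (s x), hJs, ?_, ?_, ?_⟩
    · intro 𝒥' h𝒥'
      funext x
      rw [← h𝒥' (s x), hs]
    · intro ξ P _ _ _ f hf
      obtain ⟨F, hF, hRF⟩ := exists_family_lift hπ hτ.isImmersion hf
      obtain rfl : (fun p => R (F p)) = f := funext hRF
      have h1 := hJ ξ P F hF
      simp only [hJs, hA]
      exact h1
    · intro hAd η x ξ
      obtain ⟨σ, rfl⟩ := hsurj x
      have h1 := hAd η σ ξ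
      simp only [hA, hJs]
      exact h1
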